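/- Let $(V,Y,\mathbf 1,\omega)$ be a vertex operator algebra over $\mathbb C$, $g$ an automorphism of $V$ of finite order $T$, and $V^r=\{v\in V: gv=e^{2\pi i r/T}v\}$ for $0\le r<T$. Put $\delta_0=1$ and $\delta_r=0$ for $r\neq 0$. Let $O_g(V)\subseteq V$ be the span of all $u\circ_g v=\mathrm{Res}_z\,\frac{(1+z)^{\mathrm{wt}\,u-1+\delta_r+r/T}}{z^{1+\delta_r}}Y(u,z)v$ with $u\in V^r$ homogeneous and $v\in V$, and let $A_g(V)=V/O_g(V)$, an associative algebra with unit $\mathbf 1+O_g(V)$ under the product induced by the bilinear product $u*_gv=\mathrm{Res}_z\,\frac{(1+z)^{\mathrm{wt}\,u}}{z}Y(u,z)v$ for homogeneous $u\in V^0$ and $u*_gv=0$ for $u\in V^r$, $r\ne0$. Let $\mathcal L(V,g)=\bigoplus_{r=0}^{T-1}t^{r/T}\mathbb C[t,t^{-1}]\otimes V^r$, $D=\frac{d}{dt}\otimes 1+1\otimes L(-1)$, and let $V[g]=\mathcal L(V,g)/D\mathcal L(V,g)$ be the Lie algebra with bracket $[a(p),b(q)]=\sum_{i\ge 0}\binom{p}{i}(a_ib)(p+q-i)$,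 where $a(q)$ is the image of $t^q\otimes a$. It is $\frac1T\mathbb Z$-graded by $\deg a(q)=\mathrm{wt}\,a-q-1$; let $V[g]_-$ be its part of negative degree and $V[g]_0$ its part of degree $0$. For a unital $A_g(V)$-module $U$, let $P=V[g]_-\oplus V[g]_0$ act on $U$ so that $V[g]_-$ acts as $0$ and $a(\mathrm{wt}\,a-1)$ acts as $a+O_g(V)$ for homogeneous $a\in V^0$, and let $M(U)=U(V[g])\otimes_{U(P)}U$, graded by $\frac1T\mathbb Z_{\ge0}$ with $U$ in degree $0$. An admissible $g$-twisted $V$-module is a weak $g$-twisted $V$-module $M$ with a grading $M=\bigoplus_{n\in\frac1T\mathbb Z_{\ge 0}}M(n)$ such that $v_mM(n)\subseteq M(n+\mathrm{wt}\,v-m-1)$ for homogeneous $v\in V$; morphisms are the grade-preserving linear maps commuting with all $v_m$. For such $M$, $\Omega(M)$ is the space of all $w\in M$ with $a_qw=0$ for all homogeneous $a\in V$ and all $q$ with $\mathrm{wt}\,a-q-1<0$; it is an $A_g(V)$-module on which $a+O_g(V)$ acts as $a_{\mathrm{wt}\,a-1}$ for homogeneous $a\in V^0$, and $\Omega$ is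 a functor (by restriction of morphisms) to $A_g(V)$-modules. Then for every $A_g(V)$-module $U$, among the graded $V[g]$-submodules of $M(U)$ that meet $U$ in $0$ there is a largest one, $J$; thus $J$ is the unique maximal graded $V[g]$-submodule with $J\cap U=0$. The quotient $L(U)=M(U)/J$, with $v_q$ acting as $v(q)$ for $v\in V^r$ and $q\in \frac rT+\mathbb Z$ (and as $0$ for other $q$) and with the grading induced from $M(U)$, is an admissible $g$-twisted $V$-module, and the natural map $U\to L(U)$ is an isomorphism of $A_g(V)$-modules from $U$ onto $\Omega(L(U))$. Moreover, $L$ is a functor from $A_g(V)$-modules to admissible $g$-twisted $V$-modules, where $L(f)$ extends $f$ on the images of the modules $U$, and these isomorphisms $U\cong\Omega(L(U))$ form a natural isomorphism between the identity functor and $\Omega\circ L$. -/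

import Mathlib

open CategoryTheory

universe u v

/-- A vertex operator algebra over `ℂ`. The vertex operators are given through their modes:
`mode n a b` is `a_n b`, where `Y(a, z) = ∑ a_n z^{-n-1}`. The Jacobi identity is stated
coefficientwise (coefficient of `z₀^{-n-1} z₁^{-m-1} z₂^{-k-1}`); all sums over `i` are finite.
With `ω = conf`, `L(n) = ω_{n+1}`, and the homogeneous space `V_n` is the eigenspace of `L(0)` for
the integer `n`. -/
class VertexOperatorAlgebra (V : Type u) [AddCommGroup V] [Module ℂ V] where
  mode : ℤ → V →ₗ[ℂ] V →ₗ[ℂ] V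
  vac : V
  conf : V
  rank : ℂ
  trunc : ∀ a b : V, ∃ N : ℤ, ∀ n ≥ N, mode n a b = 0
  vac_mode : ∀ (n : ℤ) (b : V), mode n vac b = if n = -1 then b else 0
  mode_vac : ∀ (n : ℤ) (a : V), 0 ≤ n → mode n a vac = 0
  mode_neg_one_vac : ∀ a : V, mode (-1) a vac = a
  jacobi : ∀ (a b c : V) (m n k : ℤ),
    ∑ᶠ i : ℕ, Ring.choose (m : ℂ) i • mode (m + k - i) (mode (n + i) a b) c =
      ∑ᶠ i : ℕ, ((-1) ^ i * Ring.choose (n : ℂ) i) •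
        (mode (m + n - i) a (mode (k + i) b c) -
          (-1 : ℂ) ^ n • mode (n + k - i) b (mode (m + i) a c))
  virasoro : ∀ (m n : ℤ) (b : V),
    mode (m + 1) conf (mode (n + 1) conf b) - mode (n + 1) conf (mode (m + 1) conf b) =
      ((m : ℂ) - n) • mode (m + n + 1) conf b +
        (if m + n = 0 then ((m : ℂ) ^ 3 - m) / 12 * rank else 0) • b
  deriv : ∀ (n : ℤ) (a b : V), mode n (mode 0 conf a) b = -(n : ℂ) • mode (n - 1) a b
  graded : DirectSum.IsInternal fun n : ℤ => Module.End.eigenspace (mode 1 conf) (n : ℂ)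
  finite_dim : ∀ n : ℤ, FiniteDimensional ℂ (Module.End.eigenspace (mode 1 conf) (n : ℂ))
  bounded_below : ∃ N : ℤ, ∀ n < N, Module.End.eigenspace (mode 1 conf) (n : ℂ) = ⊥

namespace VertexOperatorAlgebra

noncomputable section

variable {V : Type u} [AddCommGroup V] [Module ℂ V] [VertexOperatorAlgebra V]

variable (V) in
/-- The space `V_n` of vectors of weight `n`. -/
def wtSpace (n : ℤ) : Submodule ℂ V :=
  Module.End.eigenspace (mode 1 (conf : V)) (n : ℂ)

theorem mem_wtSpace {n : ℤ} {a : V} : a ∈ wtSpace V n ↔ mode 1 (conf : V) a = (n : ℂ) • a :=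
  Module.End.mem_eigenspace_iff

theorem bijective_coe :
    Function.Bijective (DirectSum.coeLinearMap fun n => wtSpace V n) := graded

variable (V) in
/-- The map from `V` to the direct sum of its weight spaces. -/
def wtEquiv : V ≃ₗ[ℂ] DirectSum ℤ fun n => wtSpace V n :=
  (LinearEquiv.ofBijective (DirectSum.coeLinearMap fun n => wtSpace V n) bijective_coe).symm

/-- The linear map on `V` which is `F n` on `V_n`. -/
def byWeight {W : Type*} [AddCommGroup W] [Module ℂ W] (F : ℤ → V →ₗ[ℂ] W) : V →ₗ[ℂ] W :=
  DirectSum.toModule ℂ ℤ W (fun n => (F n).comp (wtSpace V n).subtype) ∘ₗ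
    (wtEquiv V).toLinearMap

theorem byWeight_apply {W : Type*} [AddCommGroup W] [Module ℂ W] (F : ℤ → V →ₗ[ℂ] W)
    {n : ℤ} {a : V} (ha : a ∈ wtSpace V n) : byWeight F a = F n a := by
  have h : wtEquiv V a = DirectSum.lof ℂ ℤ (fun n => wtSpace V n) n ⟨a, ha⟩ := by
    rw [wtEquiv, LinearEquiv.symm_apply_eq]
    simp [LinearEquiv.ofBijective_apply, DirectSum.coeLinearMap_lof]
  simp [byWeight, h]

theorem wt_induction {p : V → Prop} (x : V) (hom : ∀ n, ∀ a ∈ wtSpace V n, p a)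
    (zero : p 0) (add : ∀ a b, p a → p b → p (a + b)) : p x := by
  have h : x ∈ ⨆ n, wtSpace V n := by
    have := (graded (V := V)).submodule_iSup_eq_top
    change (⨆ n, wtSpace V n) = ⊤ at this
    rw [this]; trivial
  exact Submodule.iSup_induction _ (motive := p) h hom zero add

theorem finite_support_mode (a b : V) (k : ℤ) {W : Type*} [AddCommGroup W] [Module ℂ W]
    (F : ℕ → V →ₗ[ℂ] W) : (Function.support fun i : ℕ => F i (mode (k + i) a b)).Finite := by
  obtain ⟨N, hN⟩ := trunc a b
  refine (Set.finite_Iio (N - k).toNat).subset fun i hi => ?_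
  by_contra h
  apply hi
  simp only [Set.mem_Iio, not_lt] at h
  have : mode (k + i) a b = 0 := hN _ (by omega)
  simp [this]

/-- The bilinear map `(a, b) ↦ ∑_{i ≥ 0} F_i (a_{k+i} b)`; the sum is finite. -/
def modeSum {W : Type*} [AddCommGroup W] [Module ℂ W] (k : ℤ) (F : ℕ → V →ₗ[ℂ] W) :
    V →ₗ[ℂ] V →ₗ[ℂ] W :=
  LinearMap.mk₂ ℂ (fun a b => ∑ᶠ i : ℕ, F i (mode (k + i) a b))
    (fun a a' b => by
      simp only [map_add, LinearMap.add_apply]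
      exact finsum_add_distrib (finite_support_mode a b k F) (finite_support_mode a' b k F))
    (fun c a b => by simp only [map_smul, LinearMap.smul_apply, smul_finsum])
    (fun a b b' => by
      simp only [map_add]
      exact finsum_add_distrib (finite_support_mode a b k F) (finite_support_mode a b' k F))
    (fun c a b => by simp only [map_smul, smul_finsum])

theorem modeSum_apply {W : Type*} [AddCommGroup W] [Module ℂ W] (k : ℤ) (F : ℕ → V →ₗ[ℂ] W)
    (a b : V) : modeSum k F a b = ∑ᶠ i : ℕ, F i (mode (k + i) a b) := rfl

/-- `Res_z (1 + z)^x z^k Y(a, z) b = ∑_{i ≥ 0} (x choose i) a_{k+i} b`. -/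
def res (x : ℂ) (k : ℤ) : V →ₗ[ℂ] V →ₗ[ℂ] V :=
  modeSum k fun i => Ring.choose x i • LinearMap.id

theorem finsum_range {W : Type*} [AddCommMonoid W] (f : ℕ → W) (N : ℕ) (h : ∀ i ≥ N, f i = 0) :
    ∑ᶠ i, f i = ∑ i ∈ Finset.range N, f i := by
  apply finsum_eq_sum_of_support_subset
  intro i hi
  by_contra hn
  exact hi (h i (by simpa using hn))

/-- The commutator formula. -/
theorem commutator (a b c : V) (m k : ℤ) :
    mode m a (mode k b c) - mode k b (mode m a c) =
      ∑ᶠ i : ℕ, Ring.choose (m : ℂ) i • mode (m + k - i) (mode i a b) c := by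
  have h := jacobi a b c m 0 k
  simp only [zero_add, add_zero, Int.cast_zero] at h
  rw [h, finsum_range _ 1]
  · simp
  · intro i hi
    rw [Ring.choose_zero_pos _ (by omega)]
    simp

theorem mode_mem_wtSpace {n w : ℤ} {a b : V} (ha : a ∈ wtSpace V n) (hb : b ∈ wtSpace V w)
    (m : ℤ) : mode m a b ∈ wtSpace V (n + w - m - 1) := by
  rw [mem_wtSpace] at *
  have h := commutator (conf : V) a b 1 m
  rw [finsum_range _ 2] at h
  · simp only [Finset.sum_range_succ, Finset.sum_range_zero, zero_add, Ring.choose_zero_right,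
      Nat.cast_zero, Nat.cast_one, Int.cast_one, Ring.choose_one_right, one_smul, deriv, ha, hb,
      map_smul, LinearMap.smul_apply, sub_zero] at h
    rw [sub_eq_iff_eq_add] at h
    rw [h, show (1 + m - 1 : ℤ) = m by ring, ← add_smul, ← add_smul]
    congr 1
    push_cast
    ring
  · intro i hi
    rw [Int.cast_one, ← Nat.cast_one, Ring.choose_natCast, Nat.choose_eq_zero_of_lt (by omega)]
    simp

end

end VertexOperatorAlgebra

open VertexOperatorAlgebra in
/-- An automorphism of a vertex operator algebra, of finite order `T`. -/
structure FiniteOrderAut (V : Type u) [AddCommGroup V] [Module ℂ V] [VertexOperatorAlgebra V] where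
  toEquiv : V ≃ₗ[ℂ] V
  map_mode : ∀ (n : ℤ) (a b : V), toEquiv (mode n a b) = mode n (toEquiv a) (toEquiv b)
  map_vac : toEquiv vac = vac
  map_conf : toEquiv conf = conf
  T : ℕ
  T_pos : 0 < T
  order_eq : orderOf toEquiv = T

namespace FiniteOrderAut

noncomputable section

open VertexOperatorAlgebra

variable {V : Type u} [AddCommGroup V] [Module ℂ V] [VertexOperatorAlgebra V]
variable (g : FiniteOrderAut V)

/-- The eigenspace of `g` for the eigenvalue `e^{2πiq}`. The space written `V^r` is
`g.eig (r / T)`. -/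
def eig (q : ℚ) : Submodule ℂ V :=
  Module.End.eigenspace (g.toEquiv : V →ₗ[ℂ] V) (Complex.exp (2 * Real.pi * Complex.I * q))

theorem mem_eig {q : ℚ} {a : V} :
    a ∈ g.eig q ↔ g.toEquiv a = Complex.exp (2 * Real.pi * Complex.I * q) • a :=
  Module.End.mem_eigenspace_iff

theorem exp_sub_int (p : ℚ) (i : ℤ) : Complex.exp (2 * Real.pi * Complex.I * (p - i : ℚ)) =
    Complex.exp (2 * Real.pi * Complex.I * p) := by
  rw [Complex.exp_eq_exp_iff_exists_int]
  exact ⟨-i, by push_cast; ring⟩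

theorem mode_mem_eig {p q : ℚ} {a b : V} (ha : a ∈ g.eig p) (hb : b ∈ g.eig q) (m : ℤ) :
    mode m a b ∈ g.eig (p + q) := by
  rw [mem_eig] at *
  rw [map_mode, ha, hb]
  simp only [map_smul, LinearMap.smul_apply, smul_smul, ← Complex.exp_add]
  congr 2
  push_cast
  ring

theorem pow_T (a : V) : (g.toEquiv ^ g.T) a = a := by
  rw [← g.order_eq, pow_orderOf_eq_one]
  rfl

theorem pow_mem_wtSpace {n : ℤ} {a : V} (ha : a ∈ wtSpace V n) (k : ℕ) :
    (g.toEquiv ^ k) a ∈ wtSpace V n := by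
  induction k with
  | zero => simpa using ha
  | succ k ih =>
    rw [pow_succ', LinearEquiv.mul_apply]
    rw [mem_wtSpace] at *
    have := congrArg g.toEquiv ih
    rwa [map_mode, map_conf, map_smul] at this

/-- The averaging operator `T⁻¹ ∑_{k < T} e^{-2πiqk} g^k`. -/
def avg (q : ℚ) : V →ₗ[ℂ] V :=
  (g.T : ℂ)⁻¹ • ∑ k ∈ Finset.range g.T,
    Complex.exp (-(2 * Real.pi * Complex.I * q * k)) • ((g.toEquiv ^ k : V ≃ₗ[ℂ] V) : V →ₗ[ℂ] V)

theorem avg_apply (q : ℚ) (a : V) : g.avg q a = (g.T : ℂ)⁻¹ • ∑ k ∈ Finset.range g.T,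
    Complex.exp (-(2 * Real.pi * Complex.I * q * k)) • (g.toEquiv ^ k) a := by
  simp [avg, LinearMap.sum_apply]

open Classical in
/-- The projection of `V` onto `g.eig q` along the other eigenspaces of `g`. It is `0` when `q`
is not in `(1/T)ℤ`, since then `g.eig q = 0`. -/
def proj (q : ℚ) : V →ₗ[ℂ] V := if ∃ k : ℤ, q = k / g.T then g.avg q else 0

theorem T_ne : (g.T : ℂ) ≠ 0 := by exact_mod_cast g.T_pos.ne'

theorem proj_mem (q : ℚ) (a : V) : g.proj q a ∈ g.eig q := by
  unfold proj
  split_ifs with h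
  · obtain ⟨m, rfl⟩ := h
    rw [mem_eig, avg_apply, map_smul, map_sum, smul_comm]
    congr 1
    have key : ∀ k : ℕ, g.toEquiv (Complex.exp (-(2 * Real.pi * Complex.I * ((m / g.T : ℚ)) * k)) •
        (g.toEquiv ^ k) a) = Complex.exp (2 * Real.pi * Complex.I * ((m / g.T : ℚ))) •
        (Complex.exp (-(2 * Real.pi * Complex.I * ((m / g.T : ℚ)) * (k + 1 : ℕ))) •
          (g.toEquiv ^ (k + 1)) a) := by
      intro k
      rw [map_smul, smul_smul, ← Complex.exp_add, pow_succ', LinearEquiv.mul_apply]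
      congr 2
      push_cast
      ring
    rw [Finset.sum_congr rfl fun k _ => key k, ← Finset.smul_sum]
    congr 1
    have e := Finset.sum_range_succ (fun k : ℕ =>
      Complex.exp (-(2 * Real.pi * Complex.I * ((m / g.T : ℚ)) * k)) • (g.toEquiv ^ k) a) g.T
    rw [Finset.sum_range_succ'] at e
    have h1 : Complex.exp (-(2 * Real.pi * Complex.I * ((m / g.T : ℚ)) * g.T)) = 1 := by
      rw [Complex.exp_eq_one_iff]
      refine ⟨-m, ?_⟩
      have := g.T_ne
      push_cast
      field_simp
    rw [h1, pow_T, one_smul] at e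
    simpa using e
  · exact Submodule.zero_mem _

theorem proj_apply {q : ℚ} {a : V} (ha : a ∈ g.eig q) : g.proj q a = a := by
  by_cases h0 : a = 0
  · rw [h0, map_zero]
  have hpow : ∀ k : ℕ, (g.toEquiv ^ k) a = Complex.exp (2 * Real.pi * Complex.I * q * k) • a := by
    intro k
    induction k with
    | zero => simp
    | succ k ih =>
      rw [pow_succ', LinearEquiv.mul_apply, ih, map_smul, g.mem_eig.mp ha, smul_smul,
        ← Complex.exp_add]
      congr 2
      push_cast
      ring
  have hT := g.T_ne
  have hq : ∃ k : ℤ, q = k / g.T := by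
    have h1 := hpow g.T
    rw [pow_T] at h1
    have h2 : Complex.exp (2 * Real.pi * Complex.I * q * g.T) = 1 := by
      by_contra hne
      have : (Complex.exp (2 * Real.pi * Complex.I * q * g.T) - 1) • a = 0 := by
        rw [sub_smul, ← h1, one_smul, sub_self]
      exact (smul_ne_zero (sub_ne_zero.mpr hne) h0) this
    obtain ⟨k, hk⟩ := Complex.exp_eq_one_iff.mp h2
    refine ⟨k, ?_⟩
    have h3 : (q : ℂ) * g.T = k := by
      have : (2 * Real.pi * Complex.I : ℂ) ≠ 0 := Complex.two_pi_I_ne_zero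
      apply mul_left_cancel₀ this
      linear_combination hk
    have hT' : (g.T : ℚ) ≠ 0 := by exact_mod_cast g.T_pos.ne'
    rw [eq_div_iff hT']
    exact_mod_cast h3
  rw [proj, if_pos hq, avg_apply, inv_smul_eq_iff₀ hT]
  simp only [hpow, smul_smul, ← Complex.exp_add, neg_add_cancel, Complex.exp_zero, one_smul,
    Finset.sum_const, Finset.card_range, Nat.cast_smul_eq_nsmul]

theorem proj_mem_wtSpace {n : ℤ} {a : V} (ha : a ∈ wtSpace V n) (q : ℚ) :
    g.proj q a ∈ wtSpace V n := by
  unfold proj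
  split_ifs with h
  · rw [avg_apply]
    exact Submodule.smul_mem _ _ (Submodule.sum_mem _ fun k _ =>
      Submodule.smul_mem _ _ (g.pow_mem_wtSpace ha k))
  · exact Submodule.zero_mem _

theorem sum_proj (a : V) : ∑ r ∈ Finset.range g.T, g.proj (r / g.T) a = a := by
  have h : ∀ r : ℕ, g.proj (r / g.T) a = g.avg (r / g.T) a := fun r => by
    rw [proj, if_pos ⟨r, by simp⟩]
  have hT := g.T_ne
  set ζ := Complex.exp (2 * Real.pi * Complex.I / g.T) with hζ
  have hp : IsPrimitiveRoot ζ g.T := Complex.isPrimitiveRoot_exp _ g.T_pos.ne'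
  simp only [h, avg_apply, ← Finset.smul_sum]
  rw [Finset.sum_comm, inv_smul_eq_iff₀ hT]
  simp only [← Finset.sum_smul]
  have e : ∀ k ∈ Finset.range g.T, (∑ r ∈ Finset.range g.T,
      Complex.exp (-(2 * Real.pi * Complex.I * ((r / g.T : ℚ) : ℂ) * k))) =
      if k = 0 then (g.T : ℂ) else 0 := by
    intro k hk
    have e1 : ∀ r : ℕ, Complex.exp (-(2 * Real.pi * Complex.I * ((r / g.T : ℚ) : ℂ) * k)) =
        ((ζ ^ k)⁻¹) ^ r := by
      intro r
      rw [hζ, ← Complex.exp_nat_mul, ← Complex.exp_neg, ← Complex.exp_nat_mul]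
      congr 1
      push_cast
      field_simp
    simp only [e1]
    split_ifs with h0
    · simp [h0]
    · have hne : (ζ ^ k)⁻¹ ≠ 1 := by
        rw [ne_eq, inv_eq_one]
        exact hp.pow_ne_one_of_pos_of_lt h0 (Finset.mem_range.mp hk)
      rw [geom_sum_eq hne, inv_pow, ← pow_mul, mul_comm, pow_mul, hp.pow_eq_one]
      simp
  rw [Finset.sum_congr rfl fun k hk => by rw [e k hk]]
  simp [g.T_pos]

theorem eig_induction {p : V → Prop} (x : V) (hom : ∀ r < g.T, ∀ a ∈ g.eig (r / g.T), p a)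
    (zero : p 0) (add : ∀ a b, p a → p b → p (a + b)) : p x := by
  rw [← g.sum_proj x]
  exact Finset.sum_induction _ p add zero fun r hr =>
    hom r (Finset.mem_range.mp hr) _ (g.proj_mem _ x)

end

end FiniteOrderAut

namespace FiniteOrderAut

noncomputable section

open VertexOperatorAlgebra

variable {V : Type u} [AddCommGroup V] [Module ℂ V] [VertexOperatorAlgebra V]
variable (g : FiniteOrderAut V)

/-- `δ_r` is `1` for `r = 0` and `0` otherwise. -/
def delta (r : ℕ) : ℕ := if r = 0 then 1 else 0

/-- `u ∘_g v = Res_z (1 + z)^{wt u - 1 + δ_r + r/T} z^{-1-δ_r} Y(u, z) v` for `u ∈ V^r` of weight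
`n`. -/
def circ (n : ℤ) (r : ℕ) (a b : V) : V :=
  res ((n : ℂ) - 1 + delta r + r / g.T) (-1 - delta r) a b

/-- `O_g(V)`, the linear span of all `u ∘_g v`. -/
def Og : Submodule ℂ V :=
  Submodule.span ℂ {x | ∃ (n : ℤ) (r : ℕ) (a b : V), r < g.T ∧ a ∈ wtSpace V n ∧
    a ∈ g.eig (r / g.T) ∧ x = g.circ n r a b}

/-- The bilinear product `*_g` on `V`: for `a` homogeneous in `V^0`,
`a *_g b = Res_z (1 + z)^{wt a} z^{-1} Y(a, z) b`, and `a *_g b = 0` for `a ∈ V^r`, `r ≠ 0`. -/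
def star : V →ₗ[ℂ] V →ₗ[ℂ] V := byWeight (fun n => res (n : ℂ) (-1)) ∘ₗ g.proj 0

/-- The underlying space of the algebra `A_g(V)`; its product is induced by `*_g` and its unit is
the image of the vacuum. -/
abbrev Ag : Type u := V ⧸ g.Og

/-- A (left, unital) module for the associative algebra `A_g(V)`: a complex vector space with a
linear map from `A_g(V)` to its endomorphisms that respects products and the unit. -/
structure AgMod where
  carrier : Type v
  [addCommGroup : AddCommGroup carrier]
  [module : Module ℂ carrier]
  rho : g.Ag →ₗ[ℂ] Module.End ℂ carrier
  rho_one : rho (g.Og.mkQ vac) = 1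
  rho_mul : ∀ a b : V, rho (g.Og.mkQ (g.star a b)) = rho (g.Og.mkQ a) * rho (g.Og.mkQ b)

attribute [instance] AgMod.addCommGroup AgMod.module

variable {g}

/-- The morphisms of `A_g(V)`-modules. -/
@[ext]
structure AgMod.Hom (U W : AgMod.{u, v} g) where
  toLin : U.carrier →ₗ[ℂ] W.carrier
  comm : ∀ (a : g.Ag) (x : U.carrier), toLin (U.rho a x) = W.rho a (toLin x)

instance : Category (AgMod.{u, v} g) where
  Hom := AgMod.Hom
  id U := ⟨LinearMap.id, fun _ _ => rfl⟩
  comp f h := ⟨h.toLin ∘ₗ f.toLin, fun a x => by simp [f.comm, h.comm]⟩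

variable (g)

/-- The axioms of a weak `g`-twisted `V`-module `M`, with vertex operators given through their
modes: `Y n v` is the operator `v_n` (`n ∈ ℚ`), where `Y_M(v, z) = ∑ v_n z^{-n-1}`. The twisted
Jacobi identity is stated coefficientwise (coefficient of `z₀^{-n-1} z₁^{-m-1} z₂^{-k-1}`); both
sides of it vanish for `u ∈ V^r` unless `m ∈ r/T + ℤ`, and all sums over `i` are finite. -/
structure IsWeakTwisted {M : Type v} [AddCommGroup M] [Module ℂ M]
    (Y : ℚ → V →ₗ[ℂ] Module.End ℂ M) : Prop where
  support : ∀ r < g.T, ∀ a ∈ g.eig (r / g.T), ∀ n : ℚ, (¬ ∃ j : ℤ, n = r / g.T + j) → Y n a = 0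
  trunc : ∀ (a : V) (w : M), ∃ N : ℚ, ∀ n ≥ N, Y n a w = 0
  vacuum : ∀ n : ℚ, Y n vac = if n = -1 then 1 else 0
  jacobi : ∀ r < g.T, ∀ a ∈ g.eig (r / g.T), ∀ (b : V) (w : M) (m : ℚ) (n : ℤ) (k : ℚ),
    (∃ j : ℤ, m = r / g.T + j) →
    ∑ᶠ i : ℕ, Ring.choose (m : ℂ) i • Y (m + k - i) (mode (n + i) a b) w =
      ∑ᶠ i : ℕ, ((-1) ^ i * Ring.choose (n : ℂ) i) •
        (Y (m + n - i) a (Y (k + i) b w) - (-1 : ℂ) ^ n • Y (n + k - i) b (Y (m + i) a w))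

/-- The axioms of an admissible `g`-twisted `V`-module: a weak `g`-twisted module with a grading
`M = ⊕ M(n)`, `n ∈ (1/T)ℤ_+`, such that `v_m M(n) ⊆ M(n + wt v - m - 1)` for homogeneous `v`. The
grading is indexed by `ℚ`, with `M(n) = 0` for `n` outside of `(1/T)ℤ_+`. -/
structure IsAdmissible {M : Type v} [AddCommGroup M] [Module ℂ M]
    (Y : ℚ → V →ₗ[ℂ] Module.End ℂ M) (gr : ℚ → Submodule ℂ M) : Prop where
  weak : g.IsWeakTwisted Y
  internal : DirectSum.IsInternal gr
  gr_support : ∀ n : ℚ, (¬ ∃ k : ℕ, n = k / g.T) → gr n = ⊥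
  map_gr : ∀ (w : ℤ), ∀ a ∈ wtSpace V w, ∀ (m n : ℚ), ∀ x ∈ gr n, Y m a x ∈ gr (n + w - m - 1)

/-- An admissible `g`-twisted `V`-module. -/
structure AdmMod where
  carrier : Type v
  [addCommGroup : AddCommGroup carrier]
  [module : Module ℂ carrier]
  Y : ℚ → V →ₗ[ℂ] Module.End ℂ carrier
  gr : ℚ → Submodule ℂ carrier
  isAdmissible : g.IsAdmissible Y gr

attribute [instance] AdmMod.addCommGroup AdmMod.module

variable {g}

/-- The morphisms of admissible `g`-twisted `V`-modules: the grade-preserving linear maps that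
commute with all `v_n`. -/
@[ext]
structure AdmMod.Hom (M N : AdmMod.{u, v} g) where
  toLin : M.carrier →ₗ[ℂ] N.carrier
  comm : ∀ (n : ℚ) (a : V) (x : M.carrier), toLin (M.Y n a x) = N.Y n a (toLin x)
  map_gr : ∀ (n : ℚ), ∀ x ∈ M.gr n, toLin x ∈ N.gr n

instance : Category (AdmMod.{u, v} g) where
  Hom := AdmMod.Hom
  id M := ⟨LinearMap.id, fun _ _ _ => rfl, fun _ _ h => h⟩
  comp f h := ⟨h.toLin ∘ₗ f.toLin, fun n a x => by simp [f.comm, h.comm],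
    fun n x hx => h.map_gr n _ (f.map_gr n x hx)⟩

/-! ### The functor `Ω` -/

section Omega

variable {M : Type v} [AddCommGroup M] [Module ℂ M]

/-- The space of lowest weight vectors: those killed by all `a_q` of negative degree
`wt a - q - 1`, for `a` homogeneous. -/
def Omega (Y : ℚ → V →ₗ[ℂ] Module.End ℂ M) : Submodule ℂ M where
  carrier := {x | ∀ n : ℤ, ∀ a ∈ wtSpace V n, ∀ q : ℚ, n - q - 1 < 0 → Y q a x = 0}
  zero_mem' := fun n a _ q _ => map_zero _
  add_mem' := fun hx hy n a ha q hq => by rw [map_add, hx n a ha q hq, hy n a ha q hq, add_zero]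
  smul_mem' := fun c x hx n a ha q hq => by rw [map_smul, hx n a ha q hq, smul_zero]

/-- The linear map `o` from `V` to endomorphisms with `o(a) = a_{wt a - 1}` for homogeneous `a`.
On a `g`-twisted module it vanishes on `V^r`, `r ≠ 0`. -/
def oMap (Y : ℚ → V →ₗ[ℂ] Module.End ℂ M) : V →ₗ[ℂ] Module.End ℂ M :=
  byWeight fun n => Y ((n : ℚ) - 1)

theorem oMap_apply (Y : ℚ → V →ₗ[ℂ] Module.End ℂ M) {n : ℤ} {a : V} (ha : a ∈ wtSpace V n) :
    oMap Y a = Y ((n : ℚ) - 1) a := byWeight_apply _ ha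

variable {Y : ℚ → V →ₗ[ℂ] Module.End ℂ M}

theorem oMap_mem (h : g.IsWeakTwisted Y) (a : V) {x : M} (hx : x ∈ Omega Y) :
    oMap Y a x ∈ Omega Y := by
  induction a using wt_induction with
  | zero => simp
  | add a b iha ihb => rw [map_add]; exact Submodule.add_mem _ iha ihb
  | hom n a ha =>
    rw [oMap_apply Y ha]
    intro w b hb q hq
    rw [← g.sum_proj b]
    rw [map_sum, LinearMap.sum_apply]
    refine Finset.sum_eq_zero fun r hr => ?_
    have hc := g.proj_mem_wtSpace hb (r / g.T)
    have hc' := g.proj_mem (r / g.T) b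
    generalize g.proj (r / g.T) b = c at hc hc'
    by_cases hj : ∃ j : ℤ, q = r / g.T + j
    · have J := h.jacobi r (Finset.mem_range.mp hr) c hc' a x q 0 (n - 1) hj
      rw [finsum_range _ 0, finsum_range _ 1] at J
      · simpa [hx w c hc q hq] using J.symm
      · intro i hi
        rw [Int.cast_zero, Ring.choose_zero_pos _ (by omega)]
        simp
      · intro i _
        rw [hx _ _ (mode_mem_wtSpace hc ha (0 + i)) _ (by push_cast; linarith), smul_zero]
    · rw [h.support r (Finset.mem_range.mp hr) c hc' q hj]
      rfl

theorem oMap_res {n w : ℤ} {a b : V} (ha : a ∈ wtSpace V n) (hb : b ∈ wtSpace V w)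
    (y : ℂ) (k : ℤ) (x : M) : oMap Y (res y k a b) x =
      ∑ᶠ i : ℕ, Ring.choose y i • Y ((n : ℚ) + w - k - 2 - i) (mode (k + i) a b) x := by
  rw [res, modeSum_apply]
  have := (((LinearMap.applyₗ x : Module.End ℂ M →ₗ[ℂ] M) ∘ₗ oMap Y : V →ₗ[ℂ] M).toAddMonoidHom).map_finsum
    (finite_support_mode a b k fun i => Ring.choose y i • LinearMap.id)
  simp only [LinearMap.toAddMonoidHom_coe, LinearMap.comp_apply, LinearMap.applyₗ_apply_apply] at this
  refine this.trans (finsum_congr fun i => ?_)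
  simp only [LinearMap.smul_apply, LinearMap.id_apply, map_smul]
  rw [oMap_apply Y (mode_mem_wtSpace ha hb _)]
  congr 4
  push_cast
  ring

theorem oMap_circ (h : g.IsWeakTwisted Y) {n : ℤ} {r : ℕ} {a : V} (b : V) (hr : r < g.T)
    (ha : a ∈ wtSpace V n) (ha' : a ∈ g.eig (r / g.T)) {x : M} (hx : x ∈ Omega Y) :
    oMap Y (g.circ n r a b) x = 0 := by
  unfold circ
  induction b using wt_induction with
  | zero => simp
  | add b c hb hc => rw [map_add, map_add, LinearMap.add_apply, hb, hc, add_zero]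
  | hom w b hb =>
    rw [oMap_res ha hb]
    have hT : (0 : ℚ) < g.T := by exact_mod_cast g.T_pos
    have hrT : (r / g.T : ℚ) < 1 := by rw [div_lt_one hT]; exact_mod_cast hr
    have hr0 : (0 : ℚ) ≤ r / g.T := by positivity
    have hd : (0 : ℚ) < (r / g.T : ℚ) + delta r := by
      unfold delta
      split_ifs with h0
      · simp [h0]
      · have : (0 : ℚ) < r := by exact_mod_cast Nat.pos_of_ne_zero h0
        simp only [Nat.cast_zero, add_zero]
        positivity
    have hd1 : (delta r : ℚ) ≤ 1 := by unfold delta; split_ifs <;> simp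
    have hd2 : (r / g.T : ℚ) < delta r + 1 := by
      have : (0 : ℚ) ≤ delta r := by positivity
      linarith
    have J := h.jacobi r hr a ha' b x ((n : ℚ) - 1 + delta r + r / g.T) (-1 - delta r)
      ((w : ℚ) - r / g.T) ⟨n - 1 + delta r, by push_cast; ring⟩
    rw [finsum_range (fun i : ℕ => ((-1) ^ i * _) • (_ : M)) 0] at J
    · rw [Finset.sum_range_zero] at J
      rw [← J]
      refine finsum_congr fun i => ?_
      congr 4
      · push_cast; ring
      · push_cast; ring
    · intro i _
      have hi : (0 : ℚ) ≤ i := by positivity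
      rw [hx w b hb _ (by linarith), hx n a ha _ (by linarith)]
      simp

theorem oMap_Og (h : g.IsWeakTwisted Y) {a : V} (ha : a ∈ g.Og) {x : M} (hx : x ∈ Omega Y) :
    oMap Y a x = 0 := by
  induction ha using Submodule.span_induction with
  | mem a ha =>
    obtain ⟨n, r, a, b, hr, h1, h2, rfl⟩ := ha
    exact oMap_circ h b hr h1 h2 hx
  | zero => simp
  | add a b _ _ iha ihb => rw [map_add, LinearMap.add_apply, iha, ihb, add_zero]
  | smul c a _ iha => rw [map_smul, LinearMap.smul_apply, iha, smul_zero]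

theorem oMap_proj (h : g.IsWeakTwisted Y) (a : V) : oMap Y (g.proj 0 a) = oMap Y a := by
  induction a using wt_induction with
  | zero => simp
  | add a b iha ihb => rw [map_add, map_add, map_add, iha, ihb]
  | hom n a ha =>
    conv_rhs => rw [← g.sum_proj a, map_sum, ← Finset.sum_erase_add _ _
      (Finset.mem_range.mpr g.T_pos)]
    rw [Finset.sum_eq_zero]
    · simp
    · intro r hr
      rw [Finset.mem_erase, Finset.mem_range] at hr
      rw [oMap_apply Y (g.proj_mem_wtSpace ha _)]
      refine h.support r hr.2 _ (g.proj_mem _ a) _ ?_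
      rintro ⟨j, hj⟩
      have hT : (0 : ℚ) < g.T := by exact_mod_cast g.T_pos
      have e : (r : ℚ) = (n - 1 - j) * g.T := by
        have : (r / g.T : ℚ) = n - 1 - j := by linarith
        rw [← this]
        field_simp
      have e' : (r : ℤ) = (n - 1 - j) * g.T := by exact_mod_cast e
      have h1 : (g.T : ℤ) ∣ r := ⟨n - 1 - j, by rw [e']; ring⟩
      exact hr.1 (Nat.eq_zero_of_dvd_of_lt (by exact_mod_cast h1) hr.2)

theorem oMap_star (h : g.IsWeakTwisted Y) (a b : V) {x : M} (hx : x ∈ Omega Y) :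
    oMap Y (g.star a b) x = oMap Y a (oMap Y b x) := by
  induction a using wt_induction with
  | zero => simp
  | add a c iha ihc => simp only [map_add, LinearMap.add_apply, iha, ihc]
  | hom n a ha =>
    rw [← oMap_proj h a]
    have hc := g.proj_mem_wtSpace ha 0
    have hc' := g.proj_mem 0 a
    rw [star, LinearMap.comp_apply, byWeight_apply _ hc]
    generalize g.proj 0 a = c at hc hc'
    induction b using wt_induction with
    | zero => simp
    | add b d ihb ihd => simp only [map_add, LinearMap.add_apply, ihb, ihd]
    | hom w b hb =>
      rw [oMap_res hc hb, oMap_apply Y hc, oMap_apply Y hb]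
      have J := h.jacobi 0 g.T_pos c (by simpa using hc') b x n (-1) ((w : ℚ) - 1)
        ⟨n, by simp⟩
      rw [finsum_range (fun i : ℕ => ((-1) ^ i * _) • (_ : M)) 1] at J
      · rw [Finset.sum_range_one, hx n c hc _ (by simp)] at J
        simp only [ map_zero, smul_zero, sub_zero, Nat.cast_zero, add_zero,
          pow_zero, Ring.choose_zero_right, one_mul, one_smul] at J
        rw [show ((n : ℚ) + ((-1 : ℤ) : ℚ)) = n - 1 by push_cast; ring] at J
        rw [← J]
        refine finsum_congr fun i => ?_
        congr 4
        · push_cast; ring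
      · intro i hi
        have hi : (1 : ℚ) ≤ i := by exact_mod_cast hi
        rw [hx w b hb _ (by linarith), hx n c hc _ (by linarith)]
        simp

theorem vac_mem_wtSpace : (vac : V) ∈ wtSpace V 0 := by
  rw [mem_wtSpace, mode_vac _ _ (by norm_num)]
  simp

variable (Y) in
/-- The action `a ↦ o(a)` of `A_g(V)` on the space of lowest weight vectors. -/
def omegaRho (h : g.IsWeakTwisted Y) : g.Ag →ₗ[ℂ] Module.End ℂ (Omega Y) :=
  g.Og.liftQ
    { toFun := fun a => (oMap Y a).restrict fun _ hx => oMap_mem h a hx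
      map_add' := fun a b => by ext x; simp [LinearMap.restrict_apply]
      map_smul' := fun c a => by ext x; simp [LinearMap.restrict_apply] }
    fun a ha => by
      rw [LinearMap.mem_ker]
      ext x
      exact oMap_Og h ha x.2

end Omega

/-- The `A_g(V)`-module `Ω(M)`. -/
def OmegaObj (M : AdmMod.{u, v} g) : AgMod.{u, v} g where
  carrier := Omega M.Y
  rho := omegaRho M.Y M.isAdmissible.weak
  rho_one := by
    ext x
    change oMap M.Y vac x = (x : M.carrier)
    rw [oMap_apply _ vac_mem_wtSpace, M.isAdmissible.weak.vacuum]
    simp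
  rho_mul a b := by
    ext x
    exact oMap_star M.isAdmissible.weak a b x.2

variable (g) in
/-- The functor `Ω` from admissible `g`-twisted `V`-modules to `A_g(V)`-modules; on morphisms it is
restriction. -/
def OmegaFunctor : AdmMod.{u, v} g ⥤ AgMod.{u, v} g where
  obj := OmegaObj
  map {M N} f :=
    { toLin := f.toLin.restrict (p := Omega M.Y) (q := Omega N.Y) fun x hx n a ha q hq => by
        rw [← f.comm, hx n a ha q hq, map_zero]
      comm := fun a (x : Omega M.Y) => by
        induction a using Submodule.Quotient.induction_on with
        | H a =>
          apply Subtype.ext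
          change f.toLin (oMap M.Y a x) = oMap N.Y a (f.toLin x)
          induction a using wt_induction with
          | zero => simp
          | add a b iha ihb => simp only [map_add, LinearMap.add_apply, iha, ihb]
          | hom n a ha => rw [oMap_apply _ ha, oMap_apply _ ha, f.comm] }

end

end FiniteOrderAut

/-! ### The Lie algebra `V[g]` -/

namespace VertexOperatorAlgebra

noncomputable section

variable {V : Type u} [AddCommGroup V] [Module ℂ V] [VertexOperatorAlgebra V]

variable (V) in
/-- Finite sums of terms `t^q ⊗ a` with `q ∈ ℚ` and `a ∈ V`; `t^q ⊗ a` is `Finsupp.single q a`. -/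
abbrev Loop : Type u := ℚ →₀ V

/-- The product `(x, y) ↦ x_0 y` of the tensor product vertex algebra:
`(t^p ⊗ a, t^q ⊗ b) ↦ ∑_{i ≥ 0} (p choose i) t^{p+q-i} ⊗ a_i b`. -/
def loopBracket : Loop V →ₗ[ℂ] Loop V →ₗ[ℂ] Loop V :=
  Finsupp.lsum ℂ fun p => LinearMap.flip (Finsupp.lsum ℂ fun q => LinearMap.flip
    (modeSum 0 fun i => Ring.choose (p : ℂ) i • Finsupp.lsingle (p + q - i)))

/-- `D = d/dt ⊗ 1 + 1 ⊗ L(-1)`. -/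
def loopD : Loop V →ₗ[ℂ] Loop V :=
  Finsupp.lsum ℂ fun p => (p : ℂ) • Finsupp.lsingle (p - 1) + Finsupp.lsingle p ∘ₗ mode 0 conf

theorem loopD_single (p : ℚ) (a : V) : loopD (Finsupp.single p a) =
    (p : ℂ) • Finsupp.single (p - 1) a + Finsupp.single p (mode 0 conf a) := by
  simp [loopD]

theorem loopBracket_single' (p q : ℚ) (a b : V) :
    loopBracket (Finsupp.single p a) (Finsupp.single q b) =
      ∑ᶠ i : ℕ, Ring.choose (p : ℂ) i • Finsupp.single (p + q - i) (mode (i : ℤ) a b) := by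
  simp [loopBracket, modeSum_apply]

theorem loopBracket_single (p q : ℚ) (a b : V) (N : ℕ) (h : ∀ i : ℕ, N ≤ i → mode (i : ℤ) a b = 0) :
    loopBracket (Finsupp.single p a) (Finsupp.single q b) =
      ∑ i ∈ Finset.range N,
        Ring.choose (p : ℂ) i • Finsupp.single (p + q - i) (mode (i : ℤ) a b) := by
  rw [loopBracket_single', finsum_range _ N]
  intro i hi
  rw [h i hi]
  simp

theorem trunc_nat (a b : V) : ∃ N : ℕ, ∀ i : ℕ, N ≤ i → mode (i : ℤ) a b = 0 := by
  obtain ⟨N, hN⟩ := trunc a b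
  exact ⟨N.toNat, fun i hi => hN _ (by omega)⟩

theorem choose_succ_mul (x : ℂ) (i : ℕ) :
    ((i : ℂ) + 1) * Ring.choose x (i + 1) = x * Ring.choose (x - 1) i := by
  have := Ring.choose_smul_choose x (n := i + 1) (k := 1) (by omega)
  simpa using this

theorem choose_succ_mul' (x : ℂ) (i : ℕ) :
    ((i : ℂ) + 1) * Ring.choose x (i + 1) = Ring.choose x i * (x - i) := by
  have := Ring.choose_smul_choose x (n := i + 1) (k := i) (by omega)
  simpa using this

theorem loopBracket_D (x y : Loop V) : loopBracket (loopD x) y = 0 := by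
  induction x using Finsupp.induction_linear with
  | zero => simp
  | add x x' h h' => simp [h, h']
  | single p a =>
    induction y using Finsupp.induction_linear with
    | zero => simp
    | add y y' h h' => simp [h, h']
    | single q b =>
      obtain ⟨N, hN⟩ := trunc_nat a b
      rw [loopD_single, map_add, map_smul, LinearMap.add_apply, LinearMap.smul_apply,
        loopBracket_single _ _ _ _ N hN, loopBracket_single _ _ _ _ (N + 1), Finset.sum_range_succ']
      · simp only [deriv]
        simp only [Finset.smul_sum, smul_smul]
        rw [← add_assoc, ← Finset.sum_add_distrib, Finset.sum_eq_zero]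
        · simp
        · intro i _
          have e1 : p - 1 + q - i = p + q - (i + 1 : ℕ) := by push_cast; ring
          have e2 : ((i + 1 : ℕ) : ℤ) - 1 = i := by push_cast; ring
          rw [e1, e2, ← Finsupp.smul_single, smul_smul, ← add_smul]
          have := choose_succ_mul (p : ℂ) i
          push_cast
          rw [← this]
          convert zero_smul ℂ _ using 2
          ring
      · intro i hi
        rw [deriv]
        obtain ⟨j, rfl⟩ : ∃ j, i = j + 1 := ⟨i - 1, by omega⟩
        rw [show ((j + 1 : ℕ) : ℤ) - 1 = j by push_cast; ring, hN j (by omega), smul_zero]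

/-- Reorganising a double sum by antidiagonals. -/
theorem sum_antidiag {W : Type*} [AddCommGroup W] [Module ℂ W] (N : ℕ) (f : ℕ → ℕ → ℂ) (E : ℕ → W)
    (hE : ∀ l, N ≤ l → E l = 0) :
    ∑ j ∈ Finset.range N, ∑ i ∈ Finset.range N, f j i • E (j + i) =
      ∑ l ∈ Finset.range N, (∑ ji ∈ Finset.HasAntidiagonal.antidiagonal l, f ji.1 ji.2) • E l := by
  simp only [Finset.sum_smul]
  rw [← Finset.sum_product', Finset.sum_sigma']
  symm
  apply Finset.sum_of_injOn (fun x : (_ : ℕ) × ℕ × ℕ => x.2)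
  · rintro ⟨l, j, i⟩ hx ⟨l', j', i'⟩ hx' h
    simp only [Finset.coe_sigma, Set.mem_sigma_iff, Finset.mem_coe, Finset.HasAntidiagonal.mem_antidiagonal] at hx hx'
    obtain ⟨rfl, rfl⟩ := Prod.mk.inj h
    obtain rfl : l = l' := hx.2.symm.trans hx'.2
    rfl
  · rintro ⟨l, j, i⟩ hx
    simp only [Finset.coe_sigma, Set.mem_sigma_iff, Finset.mem_coe, Finset.HasAntidiagonal.mem_antidiagonal,
      Finset.mem_range] at hx
    simp only [Finset.coe_product, Set.mem_prod, Finset.mem_coe, Finset.mem_range]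
    omega
  · rintro ⟨j, i⟩ hx hn
    rw [hE, smul_zero]
    by_contra hlt
    simp only [not_le] at hlt
    apply hn
    refine ⟨⟨j + i, j, i⟩, ?_, rfl⟩
    simp only [Finset.coe_sigma, Set.mem_sigma_iff, Finset.mem_coe, Finset.HasAntidiagonal.mem_antidiagonal,
      Finset.mem_range]
    exact ⟨hlt, trivial⟩
  · rintro ⟨l, j, i⟩ hx
    simp only [Finset.mem_sigma, Finset.HasAntidiagonal.mem_antidiagonal] at hx
    simp [hx.2]

theorem choose_neg_pow (x : ℂ) (n : ℕ) :
    Ring.choose x n = (-1) ^ n * Ring.choose (-x + n - 1) n := by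
  have := Ring.choose_neg (-x) n
  rw [neg_neg] at this
  rw [this, Units.smul_def, Int.coe_negOnePow_natCast, zsmul_eq_mul]
  push_cast
  rfl

theorem choose_skew (p q : ℂ) (l : ℕ) :
    ∑ ji ∈ Finset.HasAntidiagonal.antidiagonal l,
      ((-1) ^ ji.1 * Ring.choose q ji.1 * Ring.choose (p + q - ji.1) ji.2) = Ring.choose p l := by
  rw [choose_neg_pow p l, show -p + (l : ℂ) - 1 = q + (l - 1 - p - q) by ring,
    Ring.add_choose_eq l (Commute.all _ _), Finset.mul_sum]
  refine Finset.sum_congr rfl fun ji h => ?_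
  rw [Finset.HasAntidiagonal.mem_antidiagonal] at h
  rw [choose_neg_pow (p + q - ji.1) ji.2, ← h, pow_add]
  rw [show -(p + q - (ji.1 : ℂ)) + ji.2 - 1 = ((ji.1 + ji.2 : ℕ) : ℂ) - 1 - p - q by push_cast; ring]
  ring

theorem choose_jacobi (p q : ℂ) (k l : ℕ) :
    ∑ ij ∈ Finset.HasAntidiagonal.antidiagonal l, (Ring.choose p (k + ij.1) * (k + ij.1).choose k *
      Ring.choose q ij.2) = Ring.choose p k * Ring.choose (p + q - k) l := by
  rw [show p + q - k = p - k + q by ring, Ring.add_choose_eq l (Commute.all _ _), Finset.mul_sum]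
  refine Finset.sum_congr rfl fun ij _ => ?_
  have := Ring.choose_smul_choose p (n := k + ij.1) (k := k) (by omega)
  rw [nsmul_eq_mul, Nat.add_sub_cancel_left] at this
  rw [← mul_assoc, ← this]
  ring

/-- Skew-symmetry of the modes. -/
theorem mode_skew (a b : V) (j : ℕ) (N : ℕ) (hN : ∀ i : ℕ, N ≤ i → mode (i : ℤ) a b = 0) :
    mode (j : ℤ) b a = ∑ i ∈ Finset.range N,
      (-(-1) ^ j * (-1) ^ i : ℂ) • mode (-1 - (i : ℤ)) (mode ((j + i : ℕ) : ℤ) a b) vac := by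
  have J := jacobi a b (vac : V) (-1) j 0
  rw [finsum_range _ N, finsum_range _ 1] at J
  · rw [Finset.sum_range_one] at J
    simp only [Nat.cast_zero, add_zero, pow_zero, Ring.choose_zero_right, one_mul, one_smul,
      mode_neg_one_vac, sub_zero, zpow_natCast] at J
    rw [mode_vac _ b (by omega), map_zero, zero_sub] at J
    have h2 : ((-1 : ℂ) ^ j) * (-1) ^ j = 1 := by rw [← mul_pow]; simp
    have : mode (j : ℤ) b a = (-(-1 : ℂ) ^ j) • -((-1 : ℂ) ^ j • mode (j : ℤ) b a) := by
      rw [smul_neg, neg_smul, neg_neg, smul_smul, h2, one_smul]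
    rw [this, ← J, Finset.smul_sum]
    refine Finset.sum_congr rfl fun i _ => ?_
    rw [smul_smul, choose_neg_pow]
    simp only [Int.cast_neg, Int.cast_one, neg_neg, add_sub_cancel_left]
    rw [← Nat.cast_one, show ((i : ℂ)) = ((i : ℕ) : ℂ) from rfl, Ring.choose_natCast]
    simp
  · intro i hi
    rw [mode_vac _ b (by omega), mode_vac _ a (by omega)]
    simp
  · intro i hi
    rw [show (j : ℤ) + i = ((j + i : ℕ) : ℤ) by push_cast; ring, hN _ (by omega)]
    simp

theorem loopBracket_leibniz (x y z : Loop V) : loopBracket x (loopBracket y z) =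
    loopBracket (loopBracket x y) z + loopBracket y (loopBracket x z) := by
  induction x using Finsupp.induction_linear with
  | zero => simp
  | add x x' h h' => simp only [map_add, LinearMap.add_apply, h, h']; abel
  | single p a =>
  induction y using Finsupp.induction_linear with
  | zero => simp
  | add x x' h h' => simp only [map_add, LinearMap.add_apply, h, h']; abel
  | single q b =>
  induction z using Finsupp.induction_linear with
  | zero => simp
  | add x x' h h' => simp only [map_add, h, h']; abel
  | single s c =>
  obtain ⟨N₁, h₁⟩ := trunc_nat a b
  obtain ⟨N₂, h₂⟩ := trunc_nat b c
  obtain ⟨N₃, h₃⟩ := trunc_nat a c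
  choose f₁ hf₁ using fun k : ℕ => trunc_nat (mode (k : ℤ) a b) c
  choose f₂ hf₂ using fun k : ℕ => trunc_nat a (mode (k : ℤ) b c)
  choose f₃ hf₃ using fun k : ℕ => trunc_nat b (mode (k : ℤ) a c)
  obtain ⟨M, hM⟩ : ∃ M, N₁ ≤ M ∧ N₂ ≤ M ∧ N₃ ≤ M ∧ (∀ k < N₁, f₁ k ≤ M) ∧ (∀ k < N₂, f₂ k ≤ M) ∧
      (∀ k < N₃, f₃ k ≤ M) := by
    refine ⟨N₁ + N₂ + N₃ + ∑ k ∈ Finset.range N₁, f₁ k + ∑ k ∈ Finset.range N₂, f₂ k +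
      ∑ k ∈ Finset.range N₃, f₃ k, by omega, by omega, by omega, ?_, ?_, ?_⟩
    · intro k hk
      have := Finset.single_le_sum (f := f₁) (fun _ _ => Nat.zero_le _) (Finset.mem_range.mpr hk)
      omega
    · intro k hk
      have := Finset.single_le_sum (f := f₂) (fun _ _ => Nat.zero_le _) (Finset.mem_range.mpr hk)
      omega
    · intro k hk
      have := Finset.single_le_sum (f := f₃) (fun _ _ => Nat.zero_le _) (Finset.mem_range.mpr hk)
      omega
  obtain ⟨m₁, m₂, m₃, m₄, m₅, m₆⟩ := hM
  have F1 : ∀ k l : ℕ, M + M ≤ k + l → mode (l : ℤ) (mode (k : ℤ) a b) c = 0 := by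
    intro k l h
    by_cases hk : k < N₁
    · have := m₄ k hk
      exact hf₁ k l (by omega)
    · rw [h₁ k (by omega)]; simp
  have F1' : ∀ k l : ℕ, M ≤ l → mode (l : ℤ) (mode (k : ℤ) a b) c = 0 := by
    intro k l h
    by_cases hk : k < N₁
    · have := m₄ k hk
      exact hf₁ k l (by omega)
    · rw [h₁ k (by omega)]; simp
  have F2 : ∀ k l : ℕ, M + M ≤ l → mode (l : ℤ) a (mode (k : ℤ) b c) = 0 := by
    intro k l h
    by_cases hk : k < N₂
    · have := m₅ k hk
      exact hf₂ k l (by omega)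
    · rw [h₂ k (by omega)]; simp
  have F3 : ∀ k l : ℕ, M + M ≤ l → mode (l : ℤ) b (mode (k : ℤ) a c) = 0 := by
    intro k l h
    by_cases hk : k < N₃
    · have := m₆ k hk
      exact hf₃ k l (by omega)
    · rw [h₃ k (by omega)]; simp
  set N := M + M with hN
  have A : loopBracket (Finsupp.single p a) (loopBracket (Finsupp.single q b)
      (Finsupp.single s c)) = ∑ i ∈ Finset.range N, ∑ j ∈ Finset.range N,
      (Ring.choose (p : ℂ) i * Ring.choose (q : ℂ) j) •
        Finsupp.single (p + q + s - (i + j : ℕ)) (mode (i : ℤ) a (mode (j : ℤ) b c)) := by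
    rw [loopBracket_single _ _ _ _ N (fun i hi => h₂ i (by omega)), map_sum, Finset.sum_comm]
    refine Finset.sum_congr rfl fun j _ => ?_
    rw [map_smul, loopBracket_single _ _ _ _ N (F2 j), Finset.smul_sum]
    refine Finset.sum_congr rfl fun i _ => ?_
    rw [smul_smul, mul_comm]
    congr 2
    push_cast; ring
  have B : loopBracket (Finsupp.single q b) (loopBracket (Finsupp.single p a)
      (Finsupp.single s c)) = ∑ i ∈ Finset.range N, ∑ j ∈ Finset.range N,
      (Ring.choose (p : ℂ) i * Ring.choose (q : ℂ) j) •
        Finsupp.single (p + q + s - (i + j : ℕ)) (mode (j : ℤ) b (mode (i : ℤ) a c)) := by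
    rw [loopBracket_single _ _ _ _ N (fun i hi => h₃ i (by omega)), map_sum]
    refine Finset.sum_congr rfl fun j _ => ?_
    rw [map_smul, loopBracket_single _ _ _ _ N (F3 j), Finset.smul_sum]
    refine Finset.sum_congr rfl fun i _ => ?_
    rw [smul_smul]
    congr 2
    push_cast; ring
  have C : loopBracket (loopBracket (Finsupp.single p a) (Finsupp.single q b))
      (Finsupp.single s c) = ∑ k ∈ Finset.range N, ∑ l ∈ Finset.range N,
      (Ring.choose (p : ℂ) k * Ring.choose ((p : ℂ) + q - k) l) •
        Finsupp.single (p + q + s - (k + l : ℕ)) (mode (l : ℤ) (mode (k : ℤ) a b) c) := by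
    rw [loopBracket_single _ _ _ _ N (fun i hi => h₁ i (by omega)), map_sum, LinearMap.sum_apply]
    refine Finset.sum_congr rfl fun k _ => ?_
    rw [map_smul, LinearMap.smul_apply,
      loopBracket_single _ _ _ _ N (fun i hi => F1' k i (by omega)), Finset.smul_sum]
    refine Finset.sum_congr rfl fun i _ => ?_
    rw [smul_smul]
    congr 2
    · push_cast; rfl
    · push_cast; ring
  rw [← sub_eq_iff_eq_add, A, B, C]
  simp only [← Finset.sum_sub_distrib, ← smul_sub, ← Finsupp.single_sub]
  have comm : ∀ i j : ℕ, mode (i : ℤ) a (mode (j : ℤ) b c) - mode (j : ℤ) b (mode (i : ℤ) a c) =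
      ∑ k ∈ Finset.range N, (i.choose k : ℂ) • mode ((i : ℤ) + j - k) (mode (k : ℤ) a b) c := by
    intro i j
    rw [commutator, finsum_range _ N]
    · simp only [Int.cast_natCast, Ring.choose_natCast]
    · intro k hk
      rw [h₁ k (by omega)]; simp
  simp only [comm, Finsupp.single_finsetSum, Finset.smul_sum]
  rw [Finset.sum_congr rfl fun i _ => Finset.sum_comm, Finset.sum_comm]
  refine Finset.sum_congr rfl fun k _ => ?_
  have key : ∀ i, N ≤ i → ∑ j ∈ Finset.range N, (Ring.choose (p : ℂ) i * Ring.choose (q : ℂ) j) •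
      Finsupp.single (p + q + s - (i + j : ℕ))
        ((i.choose k : ℂ) • mode ((i : ℤ) + j - k) (mode (k : ℤ) a b) c) = 0 := by
    intro i hi
    refine Finset.sum_eq_zero fun j _ => ?_
    by_cases hik : i < k
    · rw [Nat.choose_eq_zero_of_lt hik]; simp
    · rw [show (i : ℤ) + j - k = ((i + j - k : ℕ) : ℤ) by omega, F1 _ _ (by omega)]; simp
  rw [Finset.sum_subset (Finset.range_subset_range.mpr (Nat.le_add_left N k))
    (fun i _ hi => key i (by simpa using hi)), Finset.sum_range_add,
    Finset.sum_eq_zero (s := Finset.range k), zero_add]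
  · have S := sum_antidiag N (fun i j => Ring.choose (p : ℂ) (k + i) * (k + i).choose k *
      Ring.choose (q : ℂ) j) (fun l => Finsupp.single (p + q + s - (k + l : ℕ))
        (mode (l : ℤ) (mode (k : ℤ) a b) c)) (fun l hl => by
          rw [F1 k l (by omega), Finsupp.single_zero])
    simp only [choose_jacobi] at S
    rw [← S]
    refine Finset.sum_congr rfl fun i _ => Finset.sum_congr rfl fun j _ => ?_
    rw [← Finsupp.smul_single, smul_smul, add_assoc k i j,
      show ((k + i : ℕ) : ℤ) + j - k = ((i + j : ℕ) : ℤ) by push_cast; ring]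
    congr 1
    ring
  · intro i hi
    rw [Nat.choose_eq_zero_of_lt (Finset.mem_range.mp hi)]
    simp

end

end VertexOperatorAlgebra

namespace FiniteOrderAut

noncomputable section

open VertexOperatorAlgebra

variable {V : Type u} [AddCommGroup V] [Module ℂ V] [VertexOperatorAlgebra V]
variable (g : FiniteOrderAut V)

theorem eig_sub_int (q : ℚ) (i : ℤ) : g.eig (q - i) = g.eig q := by
  simp only [eig, exp_sub_int]

theorem eig_sub_nat (q : ℚ) (i : ℕ) : g.eig (q - i) = g.eig q := g.eig_sub_int q i

theorem L_mem_eig {q : ℚ} {a : V} (ha : a ∈ g.eig q) : mode 0 conf a ∈ g.eig q := by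
  have h : (conf : V) ∈ g.eig 0 := by simp [mem_eig, g.map_conf]
  simpa using g.mode_mem_eig h ha 0

/-- `ℒ(V, g)`, spanned by the `t^q ⊗ a` with `a ∈ V` and `g a = e^{2πiq} a`; for `a ≠ 0` such a `q`
lies in `(1/T)ℤ`. -/
def loopInv : Submodule ℂ (Loop V) where
  carrier := {f | ∀ q, f q ∈ g.eig q}
  zero_mem' := fun _ => Submodule.zero_mem _
  add_mem' := fun hf hh q => Submodule.add_mem _ (hf q) (hh q)
  smul_mem' := fun c _ hf q => Submodule.smul_mem _ c (hf q)

variable {g}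

theorem single_mem {q : ℚ} {a : V} (ha : a ∈ g.eig q) : Finsupp.single q a ∈ g.loopInv := by
  intro p
  by_cases h : q = p
  · subst h; simpa using ha
  · rw [Finsupp.single_eq_of_ne' h]; exact Submodule.zero_mem _

theorem loop_induction {p : Loop V → Prop} {x : Loop V} (hx : x ∈ g.loopInv) (zero : p 0)
    (add : ∀ x y, p x → p y → p (x + y))
    (single : ∀ q, ∀ a ∈ g.eig q, p (Finsupp.single q a)) : p x := by
  rw [← Finsupp.sum_single x]
  exact Finset.sum_induction _ p add zero fun q _ => single q _ (hx q)

theorem loopD_mem {x : Loop V} (hx : x ∈ g.loopInv) : loopD x ∈ g.loopInv := by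
  refine loop_induction (p := fun x => loopD x ∈ g.loopInv) hx (by simp) (fun x y hx hy => ?_)
    (fun q a ha => ?_)
  · rw [map_add]
    exact Submodule.add_mem _ hx hy
  · rw [loopD_single]
    refine Submodule.add_mem _ (Submodule.smul_mem _ _ (single_mem ?_)) (single_mem (g.L_mem_eig ha))
    have := g.eig_sub_nat q 1
    rw [Nat.cast_one] at this
    rwa [this]

theorem loopBracket_mem {x y : Loop V} (hx : x ∈ g.loopInv) (hy : y ∈ g.loopInv) :
    loopBracket x y ∈ g.loopInv := by
  refine loop_induction (p := fun x => loopBracket x y ∈ g.loopInv) hx (by simp)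
    (fun x x' h h' => ?_) (fun p a ha => ?_)
  · rw [map_add]
    exact Submodule.add_mem _ h h'
  · refine loop_induction (p := fun y => loopBracket _ y ∈ g.loopInv) hy (by simp)
      (fun x x' h h' => ?_) (fun q b hb => ?_)
    · rw [map_add]
      exact Submodule.add_mem _ h h'
    · obtain ⟨N, hN⟩ := trunc_nat a b
      rw [loopBracket_single _ _ _ _ N hN]
      refine Submodule.sum_mem _ fun i _ => Submodule.smul_mem _ _ (single_mem ?_)
      rw [g.eig_sub_nat]
      exact g.mode_mem_eig ha hb i

variable (g)

/-- `D ℒ(V, g)`. -/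
def loopDInv : Submodule ℂ (Loop V) := g.loopInv.map loopD

variable {g}

theorem mkQ_single_L (s : ℚ) {x : V} (hx : x ∈ g.eig s) :
    g.loopDInv.mkQ (Finsupp.single s (mode 0 conf x)) =
      -((s : ℂ) • g.loopDInv.mkQ (Finsupp.single (s - 1) x)) := by
  rw [eq_neg_iff_add_eq_zero, ← map_smul, ← map_add, Submodule.mkQ_apply,
    Submodule.Quotient.mk_eq_zero]
  exact ⟨_, single_mem hx, by rw [loopD_single, add_comm]⟩

theorem mkQ_single_exp (i : ℕ) (s : ℚ) {x : V} (hx : x ∈ g.eig s) :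
    g.loopDInv.mkQ (Finsupp.single s (mode (-1 - (i : ℤ)) x vac)) =
      ((-1) ^ i * Ring.choose (s : ℂ) i) • g.loopDInv.mkQ (Finsupp.single (s - i) x) := by
  induction i generalizing x with
  | zero => simp [mode_neg_one_vac]
  | succ i ih =>
    have hd := deriv (-1 - (i : ℤ)) x (vac : V)
    have h0 : (i : ℂ) + 1 ≠ 0 := by exact_mod_cast Nat.succ_ne_zero i
    have e : mode (-1 - ((i + 1 : ℕ) : ℤ)) x vac =
        ((i : ℂ) + 1)⁻¹ • mode (-1 - (i : ℤ)) (mode 0 conf x) vac := by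
      rw [hd, smul_smul, show -1 - (i : ℤ) - 1 = -1 - ((i + 1 : ℕ) : ℤ) by push_cast; ring]
      rw [show ((i : ℂ) + 1)⁻¹ * -(((-1 - (i : ℤ)) : ℤ) : ℂ) = 1 by push_cast; field_simp; ring,
        one_smul]
    rw [e, ← Finsupp.smul_single, map_smul, ih (g.L_mem_eig hx), mkQ_single_L (s - i)
      (by rwa [g.eig_sub_nat]), smul_neg, smul_neg, smul_smul, smul_smul, ← neg_smul,
      show s - i - 1 = s - ((i + 1 : ℕ) : ℚ) by push_cast; ring]
    congr 1
    have := choose_succ_mul' (s : ℂ) i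
    have h2 : Ring.choose (s : ℂ) (i + 1) = ((i : ℂ) + 1)⁻¹ * (Ring.choose (s : ℂ) i * (s - i)) := by
      rw [← this, inv_mul_cancel_left₀ h0]
    rw [h2]
    push_cast
    ring

theorem loopBracket_skew {x y : Loop V} (hx : x ∈ g.loopInv) (hy : y ∈ g.loopInv) :
    loopBracket x y + loopBracket y x ∈ g.loopDInv := by
  rw [← Submodule.Quotient.mk_eq_zero, ← Submodule.mkQ_apply]
  refine loop_induction (p := fun x => g.loopDInv.mkQ (loopBracket x y + loopBracket y x) = 0) hx
    (by simp) (fun x x' h h' => ?_) (fun p a ha => ?_)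
  · simp only [map_add, LinearMap.add_apply] at *
    rw [add_add_add_comm, h, h', add_zero]
  refine loop_induction (p := fun y => g.loopDInv.mkQ (loopBracket _ y + loopBracket y _) = 0) hy
    (by simp) (fun x x' h h' => ?_) (fun q b hb => ?_)
  · simp only [map_add, LinearMap.add_apply] at *
    rw [add_add_add_comm, h, h', add_zero]
  obtain ⟨N₁, h₁⟩ := trunc_nat a b
  obtain ⟨N₂, h₂⟩ := trunc_nat b a
  set N := max N₁ N₂
  have hN₁ : ∀ i : ℕ, N ≤ i → mode (i : ℤ) a b = 0 := fun i hi => h₁ i ((le_max_left _ _).trans hi)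
  have hN₂ : ∀ i : ℕ, N ≤ i → mode (i : ℤ) b a = 0 := fun i hi => h₂ i ((le_max_right _ _).trans hi)
  rw [loopBracket_single _ _ _ _ N hN₁, loopBracket_single _ _ _ _ N hN₂, map_add, map_sum, map_sum]
  have S := sum_antidiag N (fun j i => (-1) ^ j * Ring.choose (q : ℂ) j *
    Ring.choose ((p : ℂ) + q - j) i) (fun l => g.loopDInv.mkQ (Finsupp.single (p + q - (l : ℕ))
      (mode (l : ℤ) a b))) (fun l hl => by rw [hN₁ l hl]; simp)
  simp only [choose_skew] at S
  simp only [map_smul]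
  rw [← S, ← Finset.sum_add_distrib]
  refine Finset.sum_eq_zero fun j _ => ?_
  rw [mode_skew a b j N hN₁, Finsupp.single_finsetSum, map_sum, Finset.smul_sum,
    ← Finset.sum_add_distrib]
  refine Finset.sum_eq_zero fun i _ => ?_
  have hm : mode ((j + i : ℕ) : ℤ) a b ∈ g.eig (q + p - j) := by
    rw [g.eig_sub_nat, add_comm]
    exact g.mode_mem_eig ha hb _
  rw [← Finsupp.smul_single, map_smul, mkQ_single_exp i _ hm, smul_smul, smul_smul,
    show q + p - (j : ℚ) - i = p + q - (j + i : ℕ) by push_cast; ring, ← add_smul]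
  convert zero_smul ℂ _ using 2
  have h2 : ((-1 : ℂ) ^ i) * (-1) ^ i = 1 := by rw [← mul_pow]; simp
  rw [show (((q + p - (j : ℚ)) : ℚ) : ℂ) = (p : ℂ) + q - j by push_cast; ring]
  linear_combination (-(-1) ^ j * Ring.choose (q : ℂ) j * Ring.choose ((p : ℂ) + q - j) i) * h2

variable (g)

/-- The Lie algebra `V[g] = ℒ(V, g) / D ℒ(V, g)`. -/
def Vg : Type u := g.loopInv ⧸ g.loopDInv.comap g.loopInv.subtype

instance : AddCommGroup g.Vg :=
  inferInstanceAs (AddCommGroup (g.loopInv ⧸ g.loopDInv.comap g.loopInv.subtype))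

instance : Module ℂ g.Vg :=
  inferInstanceAs (Module ℂ (g.loopInv ⧸ g.loopDInv.comap g.loopInv.subtype))

/-- The quotient map from `ℒ(V, g)` onto `V[g]`. -/
def toVg : g.loopInv →ₗ[ℂ] g.Vg := (g.loopDInv.comap g.loopInv.subtype).mkQ

theorem toVg_surjective : Function.Surjective g.toVg := Submodule.mkQ_surjective _

theorem toVg_eq_zero {x : g.loopInv} : g.toVg x = 0 ↔ (x : Loop V) ∈ g.loopDInv :=
  Submodule.Quotient.mk_eq_zero _

/-- The product `(x, y) ↦ x_0 y` on `ℒ(V, g)`. -/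
def invBracket : g.loopInv →ₗ[ℂ] g.loopInv →ₗ[ℂ] g.loopInv :=
  LinearMap.mk₂ ℂ (fun x y => ⟨loopBracket x y, loopBracket_mem x.2 y.2⟩)
    (fun _ _ _ => by ext1; simp) (fun _ _ _ => by ext1; simp)
    (fun _ _ _ => by ext1; simp) (fun _ _ _ => by ext1; simp)

/-- The bracket of `V[g]`, induced by `(x, y) ↦ x_0 y`. -/
def vgBracket : g.Vg →ₗ[ℂ] g.Vg →ₗ[ℂ] g.Vg :=
  (g.loopDInv.comap g.loopInv.subtype).liftQ
    { toFun := fun x => (g.loopDInv.comap g.loopInv.subtype).liftQ (g.toVg ∘ₗ g.invBracket x) (by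
        rintro y ⟨z, hz, hy⟩
        rw [LinearMap.mem_ker, LinearMap.comp_apply, toVg_eq_zero]
        have := loopBracket_skew (g := g) x.2 y.2
        rw [Submodule.subtype_apply] at hy
        rw [← hy, loopBracket_D, add_zero] at this
        change loopBracket (x : Loop V) (y : Loop V) ∈ _
        rwa [← hy])
      map_add' := fun x y => by
        apply LinearMap.ext
        intro z
        obtain ⟨z, rfl⟩ := g.toVg_surjective z
        change g.toVg (g.invBracket (x + y) z) =
          g.toVg (g.invBracket x z) + g.toVg (g.invBracket y z)
        rw [map_add, LinearMap.add_apply, map_add]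
      map_smul' := fun c x => by
        apply LinearMap.ext
        intro z
        obtain ⟨z, rfl⟩ := g.toVg_surjective z
        change g.toVg (g.invBracket (c • x) z) = c • g.toVg (g.invBracket x z)
        rw [map_smul, LinearMap.smul_apply, map_smul] }
    (by
      rintro x ⟨z, hz, hx⟩
      rw [LinearMap.mem_ker]
      apply LinearMap.ext
      intro y
      obtain ⟨y, rfl⟩ := g.toVg_surjective y
      change g.toVg (g.invBracket x y) = 0
      rw [toVg_eq_zero]
      change loopBracket (x : Loop V) (y : Loop V) ∈ _
      rw [Submodule.subtype_apply] at hx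
      rw [← hx, loopBracket_D]
      exact Submodule.zero_mem _)

theorem vgBracket_toVg (x y : g.loopInv) :
    g.vgBracket (g.toVg x) (g.toVg y) = g.toVg (g.invBracket x y) := rfl

instance : LieRing g.Vg where
  bracket x y := g.vgBracket x y
  add_lie x y z := by
    change g.vgBracket (x + y) z = g.vgBracket x z + g.vgBracket y z
    rw [map_add, LinearMap.add_apply]
  lie_add x y z := map_add (g.vgBracket x) y z
  lie_self x := by
    obtain ⟨x, rfl⟩ := g.toVg_surjective x
    change g.toVg (g.invBracket x x) = 0
    have h := loopBracket_skew (g := g) x.2 x.2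
    have h2 : g.toVg (g.invBracket x x + g.invBracket x x) = 0 := by
      rw [toVg_eq_zero]; exact h
    rw [map_add, ← two_smul ℂ] at h2
    exact (smul_eq_zero.mp h2).resolve_left two_ne_zero
  leibniz_lie x y z := by
    obtain ⟨x, rfl⟩ := g.toVg_surjective x
    obtain ⟨y, rfl⟩ := g.toVg_surjective y
    obtain ⟨z, rfl⟩ := g.toVg_surjective z
    change g.toVg (g.invBracket x (g.invBracket y z)) =
      g.toVg (g.invBracket (g.invBracket x y) z) + g.toVg (g.invBracket y (g.invBracket x z))
    rw [← map_add]
    congr 1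
    ext1
    exact loopBracket_leibniz _ _ _

instance : LieAlgebra ℂ g.Vg where
  lie_smul c x y := map_smul (g.vgBracket x) c y

/-- The element `a(q)` of `V[g]`: the image of `t^q ⊗ a` for `a ∈ V` with `g a = e^{2πiq} a`, and
`0` for `a` in the other eigenspaces of `g`. -/
def elem (q : ℚ) : V →ₗ[ℂ] g.Vg :=
  g.toVg ∘ₗ (Finsupp.lsingle q ∘ₗ g.proj q).codRestrict g.loopInv fun a =>
    single_mem (g.proj_mem q a)

/-- The subspace `V[g]_n` of degree `n`, where `deg a(q) = wt a - q - 1`. -/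
def VgDeg (n : ℚ) : Submodule ℂ g.Vg :=
  Submodule.span ℂ {x | ∃ (w : ℤ) (q : ℚ) (a : V), a ∈ wtSpace V w ∧ (w : ℚ) - q - 1 = n ∧
    x = g.elem q a}

/-- The universal enveloping algebra of `V[g]`. -/
abbrev UEg : Type u := UniversalEnvelopingAlgebra ℂ g.Vg

attribute [local instance] LieRing.ofAssociativeRing LieAlgebra.ofAssociativeAlgebra in
/-- The canonical map from `V[g]` to its universal enveloping algebra. -/
def iota : g.Vg →ₗ[ℂ] g.UEg := (UniversalEnvelopingAlgebra.ι ℂ (L := g.Vg)).toLinearMap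

/-! ### The induced module `M(U)`, its maximal submodule, and `L(U)` -/

variable {g}

open TensorProduct

/-- The relations `x p ⊗ u = x ⊗ p u` for `p ∈ P = V[g]_- ⊕ V[g]_0`: the spaces of negative degree
act on `U` as `0`, and `o(a) = a(wt a - 1)` acts as `a + O_g(V)` for homogeneous `a ∈ V^0`. -/
def indRel (U : AgMod.{u, v} g) : Submodule g.UEg (g.UEg ⊗[ℂ] U.carrier) :=
  Submodule.span g.UEg
    ({x | ∃ n < (0 : ℚ), ∃ y ∈ g.VgDeg n, ∃ z : U.carrier, x = g.iota y ⊗ₜ[ℂ] z} ∪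
     {x | ∃ (w : ℤ), ∃ a ∈ wtSpace V w, a ∈ g.eig 0 ∧ ∃ z : U.carrier,
       x = g.iota (g.elem ((w : ℚ) - 1) a) ⊗ₜ[ℂ] z -
         (1 : g.UEg) ⊗ₜ[ℂ] (U.rho (g.Og.mkQ a) z)})

/-- The induced module `M(U) = U(V[g]) ⊗_{U(P)} U`. -/
abbrev Ind (U : AgMod.{u, v} g) : Type (max u v) := (g.UEg ⊗[ℂ] U.carrier) ⧸ indRel U

/-- The canonical map from `U` to `M(U)`. -/
def indIncl (U : AgMod.{u, v} g) : U.carrier →ₗ[ℂ] Ind U :=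
  (indRel U).mkQ.restrictScalars ℂ ∘ₗ TensorProduct.mk ℂ g.UEg U.carrier 1

/-- The subspace `M(U)(n)`, spanned by all `x₁ ⋯ x_k u` with `u ∈ U` and with `x_i ∈ V[g]`
homogeneous of degrees adding up to `n`. -/
def indGr (U : AgMod.{u, v} g) (n : ℚ) : Submodule ℂ (Ind U) :=
  Submodule.span ℂ {x | ∃ (l : List (ℚ × g.Vg)) (z : U.carrier), (∀ p ∈ l, p.2 ∈ g.VgDeg p.1) ∧
    (l.map Prod.fst).sum = n ∧ x = (l.map fun p => g.iota p.2).prod • indIncl U z}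

/-- The graded `V[g]`-submodules `J` of `M(U)` with `J ∩ U = 0`. A `V[g]`-submodule is the same as
a submodule over the universal enveloping algebra; it is graded if it is the sum of its
intersections with the `M(U)(n)`. -/
structure IsGradedAvoiding (U : AgMod.{u, v} g) (J : Submodule g.UEg (Ind U)) : Prop where
  graded : J.restrictScalars ℂ ≤ ⨆ n : ℚ, J.restrictScalars ℂ ⊓ indGr U n
  inter_eq : J.restrictScalars ℂ ⊓ LinearMap.range (indIncl U) = ⊥

/-- The submodule `J` of `M(U)` generated by all graded `V[g]`-submodules that meet `U` in `0`. -/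
def maxJ (U : AgMod.{u, v} g) : Submodule g.UEg (Ind U) := sSup {J | IsGradedAvoiding U J}

/-- The underlying space of `L(U) = M(U) / J`. -/
abbrev LCar (U : AgMod.{u, v} g) : Type (max u v) := Ind U ⧸ maxJ U

/-- The quotient map `M(U) → L(U)`. -/
def LMk (U : AgMod.{u, v} g) : Ind U →ₗ[ℂ] LCar U := (maxJ U).mkQ.restrictScalars ℂ

/-- The vertex operators on `L(U)`: the mode `a_q` acts as `a(q) ∈ V[g]`. -/
def LY (U : AgMod.{u, v} g) (q : ℚ) : V →ₗ[ℂ] Module.End ℂ (LCar U) :=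
  (Algebra.lsmul ℂ ℂ (LCar U)).toLinearMap ∘ₗ g.iota ∘ₗ g.elem q

/-- The grading of `L(U)` induced by that of `M(U)`. -/
def LGr (U : AgMod.{u, v} g) (n : ℚ) : Submodule ℂ (LCar U) := (indGr U n).map (LMk U)

/-- `L(U)` as an admissible `g`-twisted `V`-module, given that it satisfies the axioms. -/
def LObj (U : AgMod.{u, v} g) (h : g.IsAdmissible (LY U) (LGr U)) : AdmMod.{u, max u v} g where
  carrier := LCar U
  Y := LY U
  gr := LGr U
  isAdmissible := h

end

end FiniteOrderAut

/-! ### Universal enveloping algebras -/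

/-! The central object is a projection `indProj` of M(U) onto U that kills y w for every y in V[g]
of positive degree. Let R consist of the w such that the projection of x w is zero for all x in
U(V[g]). R is a graded submodule meeting U in 0. Conversely, a graded submodule meeting U in 0 has
no component in degree 0, because M(U)(0) = U; the projection vanishes in all other degrees, so the
submodule lies in R. Hence J = R (`maxJ_eq`), and L(U) inherits a projection to U that is
nondegenerate: w = 0 as soon as the projection of x w is zero for all x (`LCar_eq_zero`).

This is combined with a triangular argument (`smul_mem_of_triangular`): if a subspace W of L(U) is
stable under P and lies in the kernel of the projection, then so does U(V[g]) W, because positive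
factors can be moved to the left. So W = 0.

The projection would follow from the Poincaré-Birkhoff-Witt theorem, which is avoided here. Instead
U(P) is made a right V[g]-module, so that V[g] acts from the left on linear maps from U(P) to U
(`EnvAlg.exists_extension`). This needs a representation of P on U: the relations D = 0 are
respected because L(-1) a + (wt a) a lies in O_g(V) (`mkQ_deriv`), and brackets are respected by the
commutator formula in A_g(V) (`rho_comm`).

For the twisted Jacobi identity, `jac` is the difference of its two sides. For n ≥ 0 it vanishes by
the commutator formula. For n < 0 it is first studied on U, after projection to U. If m = wt a - 1 +
δ_r + r/T, all terms in which a acts first vanish, and what remains says that elements of O_g(V) act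
as zero on U or that U respects the product *_g (`LProj_jac_base`). The relation z₁ - z₂ = z₀
(`jac_succ`) carries this to every m. So the span of all values of `jac` on U lies in the kernel of
the projection; it is stable under P because commutators of the operators `jac` with c_p are again
combinations of such operators (`jac_ad`). Hence it is zero, and the same stability spreads the
identity from U to L(U).

Finally, Ω(L(U)) is graded, and its part of degree n ≠ 0 is stable under P and killed by the
projection, hence zero. So Ω(L(U)) = U. Naturality holds because U generates L(U). -/

namespace EnvAlg

noncomputable section

variable {R : Type*} {L : Type*} [CommRing R] [LieRing L] [LieAlgebra R L]

attribute [local instance] LieRing.ofAssociativeRing LieAlgebra.ofAssociativeAlgebra in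
variable (R L) in
/-- The canonical map to the universal enveloping algebra, as a linear map. -/
def incl : L →ₗ[R] UniversalEnvelopingAlgebra R L :=
  (UniversalEnvelopingAlgebra.ι R (L := L)).toLinearMap

attribute [local instance] LieRing.ofAssociativeRing LieAlgebra.ofAssociativeAlgebra in
theorem incl_lie (x y : L) : incl R L ⁅x, y⁆ =
    incl R L x * incl R L y - incl R L y * incl R L x :=
  (UniversalEnvelopingAlgebra.ι R (L := L)).map_lie x y

attribute [local instance] LieRing.ofAssociativeRing LieAlgebra.ofAssociativeAlgebra in
/-- The algebra homomorphism extending a linear map that takes brackets to commutators. -/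
def lift {A : Type*} [Ring A] [Algebra R A] (f : L →ₗ[R] A)
    (hf : ∀ x y, f ⁅x, y⁆ = f x * f y - f y * f x) : UniversalEnvelopingAlgebra R L →ₐ[R] A :=
  UniversalEnvelopingAlgebra.lift R { f with map_lie' := fun {x y} => hf x y }

attribute [local instance] LieRing.ofAssociativeRing LieAlgebra.ofAssociativeAlgebra in
theorem lift_incl {A : Type*} [Ring A] [Algebra R A] (f : L →ₗ[R] A)
    (hf : ∀ x y, f ⁅x, y⁆ = f x * f y - f y * f x) (x : L) : lift f hf (incl R L x) = f x :=
  UniversalEnvelopingAlgebra.lift_ι_apply R _ x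

theorem mkAlgHom_surjective :
    Function.Surjective (UniversalEnvelopingAlgebra.mkAlgHom R L) :=
  RingCon.mkₐ_surjective _

theorem adjoin_range_incl : Algebra.adjoin R (Set.range (incl R L)) = ⊤ := by
  have h : Set.range (incl R L) =
      UniversalEnvelopingAlgebra.mkAlgHom R L '' Set.range (TensorAlgebra.ι R (M := L)) := by
    rw [← Set.range_comp]; rfl
  rw [h, ← AlgHom.map_adjoin, TensorAlgebra.adjoin_range_ι, Algebra.map_top,
    AlgHom.range_eq_top]
  exact mkAlgHom_surjective

theorem mem_span_list_prod (t : UniversalEnvelopingAlgebra R L) :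
    t ∈ Submodule.span R (Set.range fun l : List L => (l.map (incl R L)).prod) := by
  have h : t ∈ Algebra.adjoin R (Set.range (incl R L)) := by
    rw [adjoin_range_incl]; trivial
  rw [← Subalgebra.mem_toSubmodule, Algebra.adjoin_eq_span] at h
  refine Submodule.span_mono ?_ h
  intro x hx
  obtain ⟨l, hl, rfl⟩ := Submonoid.exists_list_of_mem_closure hx
  obtain ⟨l', rfl⟩ : ∃ l' : List L, l'.map (incl R L) = l := by
    clear hx
    induction l with
    | nil => exact ⟨[], rfl⟩
    | cons a l ih =>
      obtain ⟨l', rfl⟩ := ih fun y hy => hl y (List.mem_cons_of_mem _ hy)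
      obtain ⟨y, rfl⟩ := hl a List.mem_cons_self
      exact ⟨y :: l', rfl⟩
  exact ⟨l', rfl⟩

/-- Induction on elements of the enveloping algebra, adding factors on the left. -/
theorem induction_left {p : UniversalEnvelopingAlgebra R L → Prop}
    (t : UniversalEnvelopingAlgebra R L) (one : p 1) (add : ∀ s t, p s → p t → p (s + t))
    (smul : ∀ (c : R) t, p t → p (c • t)) (mul : ∀ x t, p t → p (incl R L x * t)) : p t := by
  induction mem_span_list_prod t using Submodule.span_induction with
  | mem x hx =>
    obtain ⟨l, rfl⟩ := hx
    induction l with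
    | nil => simpa using one
    | cons a l ih => simpa using mul a _ ih
  | zero => simpa using smul 0 1 one
  | add x y _ _ hx hy => exact add x y hx hy
  | smul c x _ hx => exact smul c x hx

/-- Induction on elements of the enveloping algebra, adding factors on the right. -/
theorem induction_right {p : UniversalEnvelopingAlgebra R L → Prop}
    (t : UniversalEnvelopingAlgebra R L) (one : p 1) (add : ∀ s t, p s → p t → p (s + t))
    (smul : ∀ (c : R) t, p t → p (c • t)) (mul : ∀ x t, p t → p (t * incl R L x)) : p t := by
  induction mem_span_list_prod t using Submodule.span_induction with
  | mem x hx =>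
    obtain ⟨l, rfl⟩ := hx
    induction l using List.reverseRecOn with
    | nil => simpa using one
    | append_singleton l a ih => simpa using mul a _ ih
  | zero => simpa using smul 0 1 one
  | add x y _ _ hx hy => exact add x y hx hy
  | smul c x _ hx => exact smul c x hx

/-! For a Lie algebra `L` with a subalgebra `P` and a projection `pr : L → P` whose kernel is closed
under the bracket, `L` acts from the right on the enveloping algebra of `P`: it is the quotient of
the enveloping algebra of `L` by the right ideal generated by the kernel of `pr`. -/

section Induced

variable {P : LieSubalgebra R L} (pr : L →ₗ[R] P)

/-- The operator `θ ↦ (y ↦ θ(y) x + θ([x, y]))` on linear maps from `L` to `U(P)`. -/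
def twist : P →ₗ[R] Module.End R (L →ₗ[R] UniversalEnvelopingAlgebra R P) :=
  LinearMap.mk₂ R
    (fun x θ => LinearMap.mulRight R (incl R P x) ∘ₗ θ + θ ∘ₗ (LieAlgebra.ad R L (x : L) : L →ₗ[R] L))
    (fun x y θ => by ext z; simp [mul_add]; abel)
    (fun c x θ => by ext z; simp)
    (fun x θ θ' => by ext z; simp [add_mul]; abel)
    (fun c x θ => by ext z; simp)

theorem twist_apply (x : P) (θ : L →ₗ[R] UniversalEnvelopingAlgebra R P) (y : L) :
    twist x θ y = θ y * incl R P x + θ ⁅(x : L), y⁆ := rfl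

variable (R P) in
/-- The right action of `U(P)` on linear maps from `L` to `U(P)`. -/
def twistLift : UniversalEnvelopingAlgebra R P →ₐ[R]
    (Module.End R (L →ₗ[R] UniversalEnvelopingAlgebra R P))ᵐᵒᵖ :=
  lift (R := R) (L := P) (A := (Module.End R (L →ₗ[R] UniversalEnvelopingAlgebra R P))ᵐᵒᵖ)
      ((MulOpposite.opLinearEquiv R).toLinearMap ∘ₗ twist) fun x y => by
    -- The opposite algebra is needed because a right factor of t acts last: t x corresponds to
    -- `twist x` applied to what t gives.
    refine MulOpposite.unop_injective (LinearMap.ext fun θ => LinearMap.ext fun z => ?_)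
    simp only [LinearMap.comp_apply, LinearEquiv.coe_coe, MulOpposite.coe_opLinearEquiv,
      MulOpposite.unop_op, MulOpposite.unop_sub, MulOpposite.unop_mul, LinearMap.sub_apply,
      Module.End.mul_apply, twist_apply, incl_lie, LieSubalgebra.coe_bracket, lie_lie, map_sub]
    noncomm_ring

/-- The right action of `L` on `U(P)`. -/
def rightAct (t : UniversalEnvelopingAlgebra R P) : L →ₗ[R] UniversalEnvelopingAlgebra R P :=
  (twistLift R P t).unop (incl R P ∘ₗ pr)

theorem rightAct_one (y : L) : rightAct pr 1 y = incl R P (pr y) := by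
  simp [rightAct]

/-- This is the rule t x y = t y x + t [x, y], valid in any quotient of U(L) by a right ideal. With
the value at t = 1 it determines the action. -/
theorem rightAct_mul (t : UniversalEnvelopingAlgebra R P) (x : P) (y : L) :
    rightAct pr (t * incl R P x) y = rightAct pr t y * incl R P x + rightAct pr t ⁅(x : L), y⁆ := by
  simp only [rightAct, map_mul, MulOpposite.unop_mul, Module.End.mul_apply]
  rw [twistLift, lift_incl]
  rfl

theorem rightAct_add (s t : UniversalEnvelopingAlgebra R P) :
    rightAct pr (s + t) = rightAct pr s + rightAct pr t := by
  simp [rightAct]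

theorem rightAct_smul (c : R) (t : UniversalEnvelopingAlgebra R P) :
    rightAct pr (c • t) = c • rightAct pr t := by
  simp [rightAct]

theorem rightAct_coe (hpr : ∀ x : P, pr x = x) (t : UniversalEnvelopingAlgebra R P) (x : P) :
    rightAct pr t x = t * incl R P x := by
  induction t using induction_right generalizing x with
  | one => rw [rightAct_one, hpr, one_mul]
  | add s t hs ht => rw [rightAct_add, LinearMap.add_apply, hs, ht, add_mul]
  | smul c t ht => rw [rightAct_smul, LinearMap.smul_apply, ht, smul_mul_assoc]
  | mul y t ht =>
    rw [rightAct_mul, ht, ← LieSubalgebra.coe_bracket, ht, incl_lie]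
    noncomm_ring

/-- Induction on t: the inductive step is the Jacobi identity of L, so everything rests on t = 1,
where the kernel of `pr` has to be closed under the bracket. -/
theorem rightAct_lie (hpr : ∀ x : P, pr x = x)
    (hker : ∀ y z, pr y = 0 → pr z = 0 → pr ⁅y, z⁆ = 0)
    (t : UniversalEnvelopingAlgebra R P) (y z : L) :
    rightAct pr t ⁅y, z⁆ = rightAct pr (rightAct pr t y) z - rightAct pr (rightAct pr t z) y := by
  induction t using induction_right generalizing y z with
  | one =>
    have e : ∀ s : P, ∀ z : L, rightAct pr (incl R P s) z =
        incl R P (pr z) * incl R P s + incl R P (pr ⁅(s : L), z⁆) := by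
      intro s z
      rw [← one_mul (incl R P s), rightAct_mul, rightAct_one, rightAct_one, one_mul]
    -- The components of y and z in the kernel have bracket in the kernel; expanding this writes `pr
    -- ⁅y, z⁆` in terms of brackets with an entry from P.
    have h := hker (y - pr y) (z - pr z) (by simp [hpr]) (by simp [hpr])
    simp only [sub_lie, lie_sub, map_sub] at h
    rw [← LieSubalgebra.coe_bracket, hpr] at h
    have h' : pr ⁅y, z⁆ = pr ⁅y, (pr z : L)⁆ + pr ⁅(pr y : L), z⁆ - ⁅pr y, pr z⁆ := by
      rw [← sub_eq_zero, ← h]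
      abel
    rw [rightAct_one, rightAct_one, rightAct_one, e, e, h', map_sub, map_add, incl_lie,
      ← lie_skew y, map_neg, map_neg]
    abel
  | add s t hs ht =>
    simp only [rightAct_add, LinearMap.add_apply, hs, ht]
    abel
  | smul c t ht => simp only [rightAct_smul, LinearMap.smul_apply, ht, smul_sub]
  | mul x t ht =>
    simp only [rightAct_mul, rightAct_add, LinearMap.add_apply]
    rw [leibniz_lie, map_add, ht y z, ht ⁅(x : L), y⁆ z, ht y ⁅(x : L), z⁆]
    noncomm_ring

/-- For a representation of `P` on `U`, the action of `U(L)` on linear maps from `U(P)` to `U`. -/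
def coindAct (hpr : ∀ x : P, pr x = x)
    (hker : ∀ y z, pr y = 0 → pr z = 0 → pr ⁅y, z⁆ = 0) (U : Type*) [AddCommGroup U]
    [Module R U] : UniversalEnvelopingAlgebra R L →ₐ[R]
      Module.End R (UniversalEnvelopingAlgebra R P →ₗ[R] U) :=
  lift (LinearMap.mk₂ R (fun y f => f ∘ₗ
      { toFun := fun t => rightAct pr t y
        map_add' := fun s t => by rw [rightAct_add, LinearMap.add_apply]
        map_smul' := fun c t => by rw [rightAct_smul]; rfl })
    (fun x y f => by ext t; simp) (fun c x f => by ext t; simp)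
    (fun x f f' => by ext t; simp) (fun c x f => by ext t; simp)) fun x y => by
      ext f t
      simp [rightAct_lie pr hpr hker]

theorem coindAct_incl (hpr : ∀ x : P, pr x = x)
    (hker : ∀ y z, pr y = 0 → pr z = 0 → pr ⁅y, z⁆ = 0) {U : Type*}
    [AddCommGroup U] [Module R U] (y : L) (f : UniversalEnvelopingAlgebra R P →ₗ[R] U)
    (t : UniversalEnvelopingAlgebra R P) :
    coindAct pr hpr hker U (incl R L y) f t = f (rightAct pr t y) := by
  rw [coindAct, lift_incl]
  rfl

/-- A representation `ρ` of `P` on `U` extends to a linear map `E` on `U(L)` with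
`E(x p) = E(x) ρ(p)` for `p ∈ P` and with `E(y x) = 0` for `y` in the kernel of `pr`. -/
theorem exists_extension (hpr : ∀ x : P, pr x = x)
    (hker : ∀ y z, pr y = 0 → pr z = 0 → pr ⁅y, z⁆ = 0) {U : Type*}
    [AddCommGroup U] [Module R U] (ρ : P →ₗ[R] Module.End R U)
    (hρ : ∀ x y, ρ ⁅x, y⁆ = ρ x * ρ y - ρ y * ρ x) :
    ∃ E : UniversalEnvelopingAlgebra R L →ₗ[R] Module.End R U, E 1 = 1 ∧
      (∀ x (p : P), E (x * incl R L p) = E x * ρ p) ∧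
      ∀ y x, pr y = 0 → E (incl R L y * x) = 0 := by
  -- Coinduction in place of induction: u becomes the map t ↦ ρ(t) u on U(P), and E(x) u is the
  -- value at 1 of x acting on that map.
  let F : U →ₗ[R] (UniversalEnvelopingAlgebra R P →ₗ[R] U) := (lift ρ hρ).toLinearMap.flip
  have hF : ∀ (p : P) (u : U), coindAct pr hpr hker U (incl R L p) (F u) = F (ρ p u) := by
    intro p u
    ext t
    rw [coindAct_incl, rightAct_coe pr hpr]
    simp [F, lift_incl]
  refine ⟨LinearMap.mk₂ R (fun x u => coindAct pr hpr hker U x (F u) 1) (by simp) (by simp)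
    (by simp) (by simp), ?_, ?_, ?_⟩
  · ext u
    simp [F]
  · intro x p
    ext u
    simp [hF]
  · intro y x hy
    ext u
    simp [coindAct_incl, rightAct_one, hy]

end Induced

end

end EnvAlg

/-! ### Residues and skew-symmetry in V -/

namespace VertexOperatorAlgebra

noncomputable section

variable {V : Type u} [AddCommGroup V] [Module ℂ V] [VertexOperatorAlgebra V]

theorem trunc_add (a b : V) (k : ℤ) : ∃ N : ℕ, ∀ i : ℕ, N ≤ i → mode (k + i) a b = 0 := by
  obtain ⟨N, hN⟩ := trunc a b
  exact ⟨(N - k).toNat, fun i hi => hN _ (by omega)⟩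

theorem res_eq_sum (x : ℂ) (k : ℤ) (a b : V) {N : ℕ} (h : ∀ i : ℕ, N ≤ i → mode (k + i) a b = 0) :
    res x k a b = ∑ i ∈ Finset.range N, Ring.choose x i • mode (k + i) a b := by
  rw [res, modeSum_apply, finsum_range _ N]
  · rfl
  · intro i hi
    rw [h i hi, map_zero]

/-- (1 + z)^{x+1} = (1 + z)^x + z (1 + z)^x. -/
theorem res_add_one (x : ℂ) (k : ℤ) (a b : V) :
    res (x + 1) k a b = res x k a b + res x (k + 1) a b := by
  obtain ⟨N, hN⟩ := trunc_add a b k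
  rw [res_eq_sum _ _ _ _ (N := N + 1) fun i hi => hN i (by omega),
    res_eq_sum _ _ _ _ (N := N + 1) fun i hi => hN i (by omega),
    res_eq_sum _ _ _ _ (N := N) fun i hi => by
      have := hN (i + 1) (by omega)
      push_cast at this
      rwa [add_assoc, add_comm (1 : ℤ)],
    Finset.sum_range_succ', Finset.sum_range_succ' _ N]
  simp only [Ring.choose_succ_succ, add_smul, Finset.sum_add_distrib]
  push_cast
  simp only [Ring.choose_zero_right, add_comm (1 : ℤ), add_assoc]
  abel

/-- Integration by parts: Y(L(-1) a, z) is the derivative of Y(a, z). -/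
theorem res_deriv (x : ℂ) (k : ℤ) (a b : V) : res (x + 1) k (mode 0 conf a) b =
    -((x + 1) • res x k a b + (k : ℂ) • res (x + 1) (k - 1) a b) := by
  obtain ⟨N, hN⟩ := trunc_add a b (k - 1)
  have hN' : ∀ i : ℕ, N ≤ i → mode (k + i) a b = 0 := fun i hi => by
    have := hN (i + 1) (by omega)
    push_cast at this
    rwa [show k - 1 + ((i : ℤ) + 1) = k + i by ring] at this
  rw [res_eq_sum _ _ (mode 0 conf a) _ (N := N + 1) fun i hi => by
      rw [deriv, show k + (i : ℤ) - 1 = k - 1 + i by ring, hN i (by omega), smul_zero],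
    res_eq_sum x _ _ _ (N := N) hN',
    res_eq_sum _ (k - 1) _ _ (N := N + 1) fun i hi => hN i (by omega),
    Finset.smul_sum, Finset.smul_sum, ← sub_eq_zero, sub_neg_eq_add, add_left_comm,
    ← Finset.sum_add_distrib, Finset.sum_range_succ']
  rw [← add_assoc, ← Finset.sum_add_distrib]
  simp only [deriv]
  rw [Finset.sum_eq_zero]
  · simp
  · intro i _
    have h := choose_succ_mul (x + 1) i
    rw [add_sub_cancel_right] at h
    rw [show k - 1 + ((i + 1 : ℕ) : ℤ) = k + i by push_cast; ring,
      show k + ((i + 1 : ℕ) : ℤ) - 1 = k + i by push_cast; ring, smul_smul, smul_smul, smul_smul,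
      ← add_smul, ← add_smul, ← h]
    convert zero_smul ℂ _ using 2
    push_cast
    ring

theorem deriv_mem_wtSpace {n : ℤ} {a : V} (ha : a ∈ wtSpace V n) :
    mode 0 conf a ∈ wtSpace V (n + 1) := by
  rw [mem_wtSpace] at *
  -- This is [L(0), L(-1)] = L(-1).
  have h := virasoro (V := V) 0 (-1) a
  simp only [zero_add, neg_add_cancel, ha, map_smul] at h
  rw [sub_eq_iff_eq_add] at h
  rw [h]
  norm_num
  rw [add_smul, one_smul, add_comm]

theorem mode_neg_two_vac (a : V) : mode (-2) a vac = mode 0 conf a := by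
  have h := deriv (-1) a (vac : V)
  rw [mode_neg_one_vac] at h
  rw [h]
  norm_num

/-- Skew-symmetry, for a mode with arbitrary integer index. -/
theorem mode_skew_int (a b : V) (j : ℤ) (N : ℕ) (hN : ∀ i : ℕ, N ≤ i → mode (j + i) a b = 0) :
    mode j b a = ∑ i ∈ Finset.range N,
      (-(-1) ^ j * (-1) ^ i : ℂ) • mode (-1 - (i : ℤ)) (mode (j + i) a b) vac := by
  -- On the vacuum, with m = -1 and k = 0, the right side reduces to the single term -(-1)^j b_j a.
  have J := jacobi a b (vac : V) (-1) j 0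
  rw [finsum_range _ N, finsum_range _ 1] at J
  · rw [Finset.sum_range_one] at J
    simp only [Nat.cast_zero, add_zero, pow_zero, Ring.choose_zero_right, one_mul, one_smul,
      mode_neg_one_vac, sub_zero] at J
    rw [mode_vac _ b (by omega), map_zero, zero_sub] at J
    have h2 : ((-1 : ℂ) ^ j) * (-1) ^ j = 1 := by rw [← mul_zpow]; simp
    have : mode j b a = (-(-1 : ℂ) ^ j) • -((-1 : ℂ) ^ j • mode j b a) := by
      rw [smul_neg, neg_smul, neg_neg, smul_smul, h2, one_smul]
    rw [this, ← J, Finset.smul_sum]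
    refine Finset.sum_congr rfl fun i _ => ?_
    rw [smul_smul, choose_neg_pow]
    simp only [Int.cast_neg, Int.cast_one, neg_neg, add_sub_cancel_left]
    rw [Ring.choose_natCast]
    simp
  · intro i hi
    rw [mode_vac _ b (by omega), mode_vac _ a (by omega)]
    simp
  · intro i hi
    rw [hN _ hi]
    simp

end

end VertexOperatorAlgebra

/-! ### Congruences modulo O_g(V) and commutators in A_g(V) -/

namespace FiniteOrderAut

noncomputable section

open VertexOperatorAlgebra

variable {V : Type u} [AddCommGroup V] [Module ℂ V] [VertexOperatorAlgebra V]
variable {g : FiniteOrderAut V}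

theorem mem_eig_add_int {q : ℚ} {a : V} (ha : a ∈ g.eig q) (j : ℤ) : a ∈ g.eig (q + j) := by
  have := g.eig_sub_int (q + j) j
  rw [add_sub_cancel_right] at this
  rwa [← this]

/-- The projection is zero or a combination of powers of g, so it preserves the eigenspace
containing a; its value then lies in eigenspaces for two different eigenvalues. -/
theorem proj_eq_zero {p q : ℚ} {a : V} (ha : a ∈ g.eig p) (h : ¬ ∃ j : ℤ, q = p + j) :
    g.proj q a = 0 := by
  have hpow : ∀ k : ℕ, (g.toEquiv ^ k) a ∈ g.eig p := by
    intro k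
    induction k with
    | zero => simpa using ha
    | succ k ih =>
      rw [pow_succ', LinearEquiv.mul_apply, g.mem_eig.mp ih]
      exact Submodule.smul_mem _ _ ih
  have h1 : g.proj q a ∈ g.eig p := by
    unfold proj
    split_ifs
    · rw [avg_apply]
      exact Submodule.smul_mem _ _ (Submodule.sum_mem _ fun k _ =>
        Submodule.smul_mem _ _ (hpow k))
    · exact Submodule.zero_mem _
  have h2 := g.mem_eig.mp (g.proj_mem q a)
  rw [g.mem_eig.mp h1, ← sub_eq_zero, ← sub_smul, smul_eq_zero] at h2
  refine h2.resolve_left fun h3 => h ?_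
  obtain ⟨j, hj⟩ := Complex.exp_eq_exp_iff_exists_int.mp (sub_eq_zero.mp h3).symm
  refine ⟨j, ?_⟩
  have h4 : (q : ℂ) = p + j := by
    apply mul_left_cancel₀ Complex.two_pi_I_ne_zero
    linear_combination hj
  exact_mod_cast h4

theorem proj_mode {p : ℚ} (q : ℚ) {a : V} (ha : a ∈ g.eig p) (i : ℤ) (b : V) :
    g.proj (p + q) (mode i a b) = mode i a (g.proj q b) := by
  induction b using g.eig_induction with
  | zero => simp
  | add b c hb hc => simp only [map_add, hb, hc]
  | hom r hr b hb =>
    by_cases h : ∃ j : ℤ, q = r / g.T + j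
    · obtain ⟨j, rfl⟩ := h
      have hb' := mem_eig_add_int hb j
      rw [g.proj_apply hb', g.proj_apply (g.mode_mem_eig ha hb' i)]
    · rw [proj_eq_zero hb h, map_zero]
      refine proj_eq_zero (g.mode_mem_eig ha hb i) ?_
      rintro ⟨j, hj⟩
      exact h ⟨j, by linarith⟩

theorem vac_mem_eig : (vac : V) ∈ g.eig 0 := by
  simp [mem_eig, g.map_vac]

theorem conf_mem_eig : (conf : V) ∈ g.eig 0 := by
  simp [mem_eig, g.map_conf]

theorem conf_mem_wtSpace : (conf : V) ∈ wtSpace V 2 := by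
  have h2 := virasoro (V := V) 0 (-2) vac
  rw [mem_wtSpace]
  norm_num [mode_neg_one_vac, mode_vac] at h2 ⊢
  exact h2

/-- Members of `O_g(V)` with a higher pole. -/
theorem res_mem_Og {n : ℤ} {r : ℕ} {a : V} (b : V) (hr : r < g.T) (ha : a ∈ wtSpace V n)
    (ha' : a ∈ g.eig (r / g.T)) (j : ℕ) :
    res ((n : ℂ) - 1 + delta r + r / g.T) (-1 - delta r - j) a b ∈ g.Og := by
  induction j generalizing n a with
  | zero =>
    refine Submodule.subset_span ⟨n, r, a, b, hr, ha, ha', ?_⟩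
    simp [circ]
  | succ j ih =>
    -- For L(-1) a the exponent is x + 1. Integration by parts trades the derivative for a pole of
    -- one order more, with the nonzero coefficient k.
    have h1 := ih (deriv_mem_wtSpace ha) (g.L_mem_eig ha')
    have h2 := ih ha ha'
    set x : ℂ := (n : ℂ) - 1 + delta r + r / g.T with hx
    rw [show ((n + 1 : ℤ) : ℂ) - 1 + delta r + r / g.T = x + 1 by rw [hx]; push_cast; ring,
      res_deriv, res_add_one, sub_add_cancel, smul_add] at h1
    rw [show -1 - (delta r : ℤ) - ((j + 1 : ℕ) : ℤ) = -1 - (delta r : ℤ) - j - 1 by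
      push_cast; ring]
    set k : ℤ := -1 - (delta r : ℤ) - j with hk
    have hk0 : (k : ℂ) ≠ 0 := by
      rw [Int.cast_ne_zero]
      omega
    have h3 := Submodule.neg_mem _ h1
    rw [neg_neg] at h3
    have h4 := (Submodule.add_mem_iff_right _ (Submodule.smul_mem _ (x + 1) h2)).mp h3
    have h5 := (Submodule.add_mem_iff_left _ (Submodule.smul_mem _ (k : ℂ) h2)).mp h4
    exact (Submodule.smul_mem_iff _ hk0).mp h5

/-- For a in V^0, a ∘_g 1 = Res (1 + z)^w z^{-2} Y(a, z) 1 = L(-1) a + w a. -/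
theorem mkQ_deriv {w : ℤ} {a : V} (ha : a ∈ wtSpace V w) (ha' : a ∈ g.eig 0) :
    g.Og.mkQ (mode 0 conf a) = -(w : ℂ) • g.Og.mkQ a := by
  have h := res_mem_Og (g := g) (r := 0) (vac : V) g.T_pos ha (by simpa using ha') 0
  rw [res_eq_sum _ _ _ _ (N := 2)] at h
  · simp only [Finset.sum_range_succ, delta, Finset.sum_range_zero] at h
    norm_num [mode_neg_one_vac, mode_neg_two_vac] at h
    rw [← Submodule.Quotient.mk_eq_zero, ← Submodule.mkQ_apply, map_add, map_smul] at h
    rw [neg_smul, eq_neg_iff_add_eq_zero, h]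
  · intro i hi
    rw [mode_vac]
    simp [delta]
    omega

/-- Y(a, z) 1 = e^{zL(-1)} a. Each L(-1) multiplies by minus the weight and raises the weight by
one, so modulo O_g(V) this is (1 + z)^{-w} a. -/
theorem mkQ_exp {w : ℤ} {a : V} (ha : a ∈ wtSpace V w) (ha' : a ∈ g.eig 0) (i : ℕ) :
    g.Og.mkQ (mode (-1 - (i : ℤ)) a vac) = Ring.choose (-(w : ℂ)) i • g.Og.mkQ a := by
  induction i generalizing w a with
  | zero => simp [mode_neg_one_vac]
  | succ i ih =>
    have hd := deriv (-1 - (i : ℤ)) a (vac : V)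
    have h0 : (i : ℂ) + 1 ≠ 0 := by exact_mod_cast Nat.succ_ne_zero i
    have e : mode (-1 - ((i + 1 : ℕ) : ℤ)) a vac =
        ((i : ℂ) + 1)⁻¹ • mode (-1 - (i : ℤ)) (mode 0 conf a) vac := by
      rw [hd, smul_smul, show -1 - (i : ℤ) - 1 = -1 - ((i + 1 : ℕ) : ℤ) by push_cast; ring]
      rw [show ((i : ℂ) + 1)⁻¹ * -(((-1 - (i : ℤ)) : ℤ) : ℂ) = 1 by push_cast; field_simp; ring,
        one_smul]
    rw [e, map_smul, ih (deriv_mem_wtSpace ha) (g.L_mem_eig ha'), mkQ_deriv ha ha', smul_smul,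
      smul_smul]
    congr 1
    have := choose_succ_mul (-(w : ℂ)) i
    rw [mul_assoc, inv_mul_eq_iff_eq_mul₀ h0, this, Int.cast_add, Int.cast_one, neg_add', mul_comm]

/-- For r ≠ 0 the pole in the definition of ∘_g is simple, so a ∘_g 1 = a. -/
theorem mkQ_eq_zero {n : ℤ} {r : ℕ} {a : V} (hr : r < g.T) (h0 : r ≠ 0) (ha : a ∈ wtSpace V n)
    (ha' : a ∈ g.eig (r / g.T)) : g.Og.mkQ a = 0 := by
  have h := res_mem_Og (vac : V) hr ha ha' 0
  rw [res_eq_sum _ _ _ _ (N := 1)] at h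
  · simp only [Finset.sum_range_one, delta, h0] at h
    norm_num [mode_neg_one_vac] at h
    rwa [Submodule.mkQ_apply, Submodule.Quotient.mk_eq_zero]
  · intro i hi
    rw [mode_vac]
    simp [delta, h0]
    omega

theorem mkQ_proj (a : V) : g.Og.mkQ (g.proj 0 a) = g.Og.mkQ a := by
  induction a using wt_induction with
  | zero => simp
  | add a b ha hb => simp only [map_add, ha, hb]
  | hom n a ha =>
    conv_rhs => rw [← g.sum_proj a, map_sum, ← Finset.sum_erase_add _ _
      (Finset.mem_range.mpr g.T_pos)]
    rw [Finset.sum_eq_zero]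
    · simp
    · intro r hr
      rw [Finset.mem_erase, Finset.mem_range] at hr
      exact mkQ_eq_zero hr.2 hr.1 (g.proj_mem_wtSpace ha _) (g.proj_mem _ a)

theorem star_apply {n : ℤ} {a : V} (b : V) (ha : a ∈ wtSpace V n) (ha' : a ∈ g.eig 0) :
    g.star a b = res (n : ℂ) (-1) a b := by
  rw [star, LinearMap.comp_apply, g.proj_apply ha', byWeight_apply _ ha]

/-- `b *_g a` is congruent to `Res_z (1 + z)^{wt a - 1} z⁻¹ Y(a, z) b` modulo `O_g(V)`. -/
theorem mkQ_star_swap {n w : ℤ} {a b : V} (ha : a ∈ wtSpace V n) (ha' : a ∈ g.eig 0)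
    (hb : b ∈ wtSpace V w) (hb' : b ∈ g.eig 0) :
    g.Og.mkQ (g.star b a) = g.Og.mkQ (res ((n : ℂ) - 1) (-1) a b) := by
  obtain ⟨N₁, h₁⟩ := trunc_add a b (-1)
  obtain ⟨N₂, h₂⟩ := trunc_add b a (-1)
  set N := max N₁ N₂
  have hN₁ : ∀ i : ℕ, N ≤ i → mode (-1 + i) a b = 0 := fun i hi => h₁ i ((le_max_left _ _).trans hi)
  have hN₂ : ∀ i : ℕ, N ≤ i → mode (-1 + i) b a = 0 := fun i hi => h₂ i ((le_max_right _ _).trans hi)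
  rw [star_apply a hb hb', res_eq_sum _ _ _ _ hN₁, res_eq_sum _ _ _ _ hN₂, map_sum, map_sum]
  -- Skew-symmetry expresses b_{j-1} a through the vectors (a_{j+i-1} b)_{-1-i} 1, which `mkQ_exp`
  -- makes multiples of a_{j+i-1} b. The double sum is collected by l = j + i.
  have S := sum_antidiag N (fun j i => (-1) ^ (j + i) * (Ring.choose (w : ℂ) j *
    Ring.choose ((j + i : ℕ) - (n : ℂ) - w) i)) (fun l => g.Og.mkQ (mode (-1 + (l : ℤ)) a b))
    (fun l hl => by rw [hN₁ l hl, map_zero])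
  have key : ∀ l : ℕ, ∑ ji ∈ Finset.HasAntidiagonal.antidiagonal l, ((-1) ^ (ji.1 + ji.2) *
      (Ring.choose (w : ℂ) ji.1 * Ring.choose ((ji.1 + ji.2 : ℕ) - (n : ℂ) - w) ji.2)) =
      Ring.choose ((n : ℂ) - 1) l := by
    intro l
    -- Vandermonde for l - n = w + (l - n - w), where n + w - l is the weight of a_{l-1} b.
    rw [choose_neg_pow ((n : ℂ) - 1) l, show -((n : ℂ) - 1) + l - 1 = w + (l - n - w) by ring,
      Ring.add_choose_eq l (Commute.all _ _), Finset.mul_sum]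
    refine Finset.sum_congr rfl fun ji h => ?_
    rw [Finset.HasAntidiagonal.mem_antidiagonal] at h
    rw [h]
  simp only [key] at S
  simp only [map_smul]
  rw [← S]
  refine Finset.sum_congr rfl fun j _ => ?_
  rw [mode_skew_int a b (-1 + j) N (fun i hi => by
    have := hN₁ (j + i) (by omega)
    push_cast at this
    rwa [← add_assoc] at this), map_sum, Finset.smul_sum]
  refine Finset.sum_congr rfl fun i _ => ?_
  have h1 := mode_mem_wtSpace ha hb (-1 + j + i)
  have h2 := g.mode_mem_eig ha' hb' (-1 + j + i)
  rw [add_zero] at h2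
  rw [map_smul, mkQ_exp h1 h2, smul_smul, smul_smul,
    show (-1 : ℤ) + (j + i : ℕ) = -1 + j + i by push_cast; ring]
  congr 1
  rw [zpow_add₀ (by norm_num), zpow_natCast, pow_add,
    show -(((n + w - (-1 + (j : ℤ) + i) - 1) : ℤ) : ℂ) = ((j + i : ℕ) - (n : ℂ) - w) by
      push_cast; ring]
  norm_num
  ring

/-- The commutator formula in `A_g(V)`. -/
theorem rho_comm (U : AgMod.{u, v} g) {n w : ℤ} {a b : V} (ha : a ∈ wtSpace V n)
    (ha' : a ∈ g.eig 0) (hb : b ∈ wtSpace V w) (hb' : b ∈ g.eig 0) :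
    U.rho (g.Og.mkQ (res ((n : ℂ) - 1) 0 a b)) =
      U.rho (g.Og.mkQ a) * U.rho (g.Og.mkQ b) - U.rho (g.Og.mkQ b) * U.rho (g.Og.mkQ a) := by
  rw [← U.rho_mul, ← U.rho_mul, mkQ_star_swap ha ha' hb hb', star_apply b ha ha', ← map_sub,
    ← map_sub]
  congr 2
  -- The pole cancels: z⁻¹(1 + z)^n - z⁻¹(1 + z)^{n-1} = (1 + z)^{n-1}.
  have := res_add_one ((n : ℂ) - 1) (-1) a b
  rw [sub_add_cancel] at this
  rw [this]
  simp

end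

end FiniteOrderAut

namespace FiniteOrderAut

noncomputable section

open VertexOperatorAlgebra

variable {V : Type u} [AddCommGroup V] [Module ℂ V] [VertexOperatorAlgebra V]
variable {g : FiniteOrderAut V}

/-! ### The grading of `V[g]` -/

theorem elem_eq {q : ℚ} {a : V} (ha : a ∈ g.eig q) :
    g.elem q a = g.toVg ⟨Finsupp.single q a, single_mem ha⟩ := by
  unfold elem
  rw [LinearMap.comp_apply]
  congr 1
  ext1
  exact congrArg (Finsupp.single q) (g.proj_apply ha)

theorem elem_proj (q : ℚ) (a : V) : g.elem q (g.proj q a) = g.elem q a := by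
  rw [elem_eq (g.proj_mem q a)]
  rfl

theorem elem_eq_zero {p q : ℚ} {a : V} (ha : a ∈ g.eig p) (h : ¬ ∃ j : ℤ, q = p + j) :
    g.elem q a = 0 := by
  rw [← elem_proj, proj_eq_zero ha h, map_zero]

/-- This is the relation D(t^q ⊗ a) = 0 in V[g], for the component of a in the eigenspace for q. -/
theorem elem_deriv (q : ℚ) (a : V) : g.elem q (mode 0 conf a) = -(q : ℂ) • g.elem (q - 1) a := by
  have hc : g.proj q (mode 0 conf a) = mode 0 conf (g.proj q a) := by
    have := proj_mode (g := g) q conf_mem_eig 0 a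
    rwa [zero_add] at this
  have hp : g.proj (q - 1) a = g.proj q a := by
    -- The operator 1_{-1} is the identity, and the vacuum also lies in the eigenspace indexed by
    -- -1; so `proj_mode` shifts the index of the projection by an integer.
    have h := proj_mode (g := g) q (a := vac) (by
      simpa using mem_eig_add_int (g := g) vac_mem_eig (-1)) (-1) a
    rw [vac_mode, vac_mode, if_pos rfl, if_pos rfl] at h
    rw [← h]
    congr 2
    ring
  rw [← elem_proj q, ← elem_proj (q - 1), hc, hp]
  have h := g.proj_mem q a
  generalize g.proj q a = b at h
  have h' : b ∈ g.eig (q - 1) := by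
    simpa [sub_eq_add_neg] using mem_eig_add_int h (-1)
  rw [elem_eq (g.L_mem_eig h), elem_eq h', neg_smul, eq_neg_iff_add_eq_zero, ← map_smul, ← map_add,
    toVg_eq_zero]
  refine ⟨_, single_mem h, ?_⟩
  rw [loopD_single, add_comm]
  rfl

/-- The bracket of `V[g]`. -/
theorem lie_elem {p : ℚ} (q : ℚ) {a : V} (ha : a ∈ g.eig p) (b : V) {N : ℕ}
    (hN : ∀ i : ℕ, N ≤ i → mode (i : ℤ) a b = 0) :
    ⁅g.elem p a, g.elem q b⁆ =
      ∑ i ∈ Finset.range N, Ring.choose (p : ℂ) i • g.elem (p + q - i) (mode (i : ℤ) a b) := by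
  -- Both sides depend only on the component of b in the eigenspace for q, so b may be replaced by
  -- it.
  have hp : ∀ i : ℕ, g.elem (p + q - i) (mode (i : ℤ) a b) =
      g.elem (p + q - i) (mode (i : ℤ) a (g.proj q b)) := by
    intro i
    have h := proj_mode (g := g) q (p := p - i) (a := a) (by
      simpa [sub_eq_add_neg] using mem_eig_add_int ha (-i)) i b
    rw [← h, show p - i + q = p + q - i by ring, elem_proj]
  have hN' : ∀ i : ℕ, N ≤ i → mode (i : ℤ) a (g.proj q b) = 0 := by
    intro i hi
    rw [← proj_mode (g := g) q ha i b, hN i hi, map_zero]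
  rw [← elem_proj q b]
  simp only [hp]
  have hb := g.proj_mem q b
  generalize g.proj q b = c at hb hN'
  rw [elem_eq ha, elem_eq hb]
  change g.vgBracket _ _ = _
  have hm : ∀ i : ℕ, mode (i : ℤ) a c ∈ g.eig (p + q - i) := fun i => by
    rw [g.eig_sub_nat]
    exact g.mode_mem_eig ha hb i
  simp only [elem_eq (hm _), ← map_smul, ← map_sum]
  rw [vgBracket_toVg]
  congr 1
  ext1
  rw [invBracket, LinearMap.mk₂_apply]
  simp only [loopBracket_single _ _ _ _ N hN']
  rw [AddSubmonoidClass.coe_finsetSum]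
  rfl

theorem elem_mem_VgDeg {w : ℤ} {a : V} (ha : a ∈ wtSpace V w) (q : ℚ) :
    g.elem q a ∈ g.VgDeg ((w : ℚ) - q - 1) :=
  Submodule.subset_span ⟨w, q, a, ha, rfl, rfl⟩

/-- The bracket formula `lie_elem` requires eigenvectors, which the spanning set of `VgDeg` does not
provide; projecting a provides them. Scalars are absorbed into a. -/
theorem VgDeg_induction {n : ℚ} {p : g.Vg → Prop} {x : g.Vg} (hx : x ∈ g.VgDeg n) (zero : p 0)
    (add : ∀ x y, p x → p y → p (x + y))
    (elem : ∀ (w : ℤ) (q : ℚ) (a : V), a ∈ wtSpace V w → a ∈ g.eig q → (w : ℚ) - q - 1 = n →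
      p (g.elem q a)) : p x := by
  induction hx using Submodule.closure_induction with
  | zero => exact zero
  | add x y _ _ hx hy => exact add x y hx hy
  | smul_mem c x hx =>
    obtain ⟨w, q, a, ha, hn, rfl⟩ := hx
    rw [← elem_proj, ← map_smul]
    exact elem w q _ (Submodule.smul_mem _ _ (g.proj_mem_wtSpace ha q))
      (Submodule.smul_mem _ _ (g.proj_mem q a)) hn

theorem iSup_VgDeg : ⨆ n, g.VgDeg n = ⊤ := by
  rw [eq_top_iff]
  rintro x -
  obtain ⟨⟨x, hx⟩, rfl⟩ := g.toVg_surjective x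
  have key : ∀ y ∈ g.loopInv, ∃ h : y ∈ g.loopInv, g.toVg ⟨y, h⟩ ∈ ⨆ n, g.VgDeg n := by
    intro y hy
    refine loop_induction (p := fun y => ∃ h : y ∈ g.loopInv, g.toVg ⟨y, h⟩ ∈ ⨆ n, g.VgDeg n) hy
      ⟨Submodule.zero_mem _, ?_⟩ ?_ ?_
    · rw [show (⟨0, Submodule.zero_mem _⟩ : g.loopInv) = 0 from rfl, map_zero]
      exact Submodule.zero_mem _
    · rintro x y ⟨hx, hx'⟩ ⟨hy, hy'⟩
      refine ⟨Submodule.add_mem _ hx hy, ?_⟩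
      rw [show (⟨x + y, Submodule.add_mem _ hx hy⟩ : g.loopInv) = ⟨x, hx⟩ + ⟨y, hy⟩ from rfl,
        map_add]
      exact Submodule.add_mem _ hx' hy'
    · intro q a ha
      refine ⟨single_mem ha, ?_⟩
      rw [← elem_eq ha]
      clear ha
      induction a using wt_induction with
      | zero => simp
      | add a b ha hb => rw [map_add]; exact Submodule.add_mem _ ha hb
      | hom n a ha => exact Submodule.mem_iSup_of_mem _ (elem_mem_VgDeg ha q)
  exact (key x hx).2

theorem lie_mem_VgDeg {m n : ℚ} {x y : g.Vg} (hx : x ∈ g.VgDeg m) (hy : y ∈ g.VgDeg n) :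
    ⁅x, y⁆ ∈ g.VgDeg (m + n) := by
  refine VgDeg_induction (p := fun x => ⁅x, y⁆ ∈ g.VgDeg (m + n)) hx (by simp) (fun x x' h h' => ?_)
    (fun w p a ha ha' hm => ?_)
  · rw [add_lie]; exact Submodule.add_mem _ h h'
  refine VgDeg_induction (p := fun y => ⁅_, y⁆ ∈ g.VgDeg (m + n)) hy (by simp) (fun x x' h h' => ?_)
    (fun w' q b hb hb' hn => ?_)
  · rw [lie_add]; exact Submodule.add_mem _ h h'
  obtain ⟨N, hN⟩ := trunc_nat a b
  rw [lie_elem q ha' b hN]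
  refine Submodule.sum_mem _ fun i _ => Submodule.smul_mem _ _ ?_
  convert elem_mem_VgDeg (g := g) (mode_mem_wtSpace ha hb i) (p + q - i) using 2
  push_cast
  linarith

/-- ω(1) plays the role of L(0): [ω(1), a(q)] = (L(-1) a)(q + 1) + (L(0) a)(q) = (wt a - q - 1)
a(q). Degrees become eigenvalues, which yields the independence of the V[g]_n. -/
theorem lie_conf {n : ℚ} {x : g.Vg} (hx : x ∈ g.VgDeg n) :
    ⁅g.elem 1 conf, x⁆ = (n : ℂ) • x := by
  refine VgDeg_induction (p := fun x => ⁅g.elem 1 conf, x⁆ = (n : ℂ) • x) hx (by simp)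
    (fun x x' h h' => ?_) (fun w q a ha ha' hn => ?_)
  · rw [lie_add, h, h', smul_add]
  obtain ⟨N, hN⟩ := trunc_nat conf a
  rw [lie_elem q (by simpa using mem_eig_add_int (g := g) conf_mem_eig 1) a (N := N + 2)
    (fun i hi => hN i (by omega)), Finset.sum_range_succ', Finset.sum_range_succ',
    Finset.sum_eq_zero]
  · simp only [zero_add, Nat.cast_one, Nat.cast_zero, mem_wtSpace.mp ha, elem_deriv, map_smul,
      Rat.cast_one, Ring.choose_one_right, Ring.choose_zero_right, one_smul, sub_zero,
      add_sub_cancel_left, ← add_smul, ← hn]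
    congr 1
    push_cast
    ring
  · intro i _
    rw [Rat.cast_one, ← Nat.cast_one, Ring.choose_natCast, Nat.choose_eq_zero_of_lt (by omega)]
    simp

theorem iSupIndep_VgDeg : iSupIndep g.VgDeg := by
  have h := Module.End.eigenspaces_iSupIndep (LieAlgebra.ad ℂ g.Vg (g.elem 1 conf) : Module.End ℂ g.Vg)
  have h' := h.comp (f := fun n : ℚ => (n : ℂ)) Rat.cast_injective
  refine h'.mono fun n x hx => ?_
  exact Module.End.mem_eigenspace_iff.mpr (lie_conf hx)

theorem VgDeg_eq_bot {n : ℚ} (hn : ¬ ∃ k : ℤ, n = k / g.T) : g.VgDeg n = ⊥ := by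
  have hT : (g.T : ℚ) ≠ 0 := by exact_mod_cast g.T_pos.ne'
  rw [eq_bot_iff]
  refine Submodule.span_le.mpr ?_
  rintro x ⟨w, q, a, ha, h, rfl⟩
  have : g.proj q = 0 := by
    unfold proj
    rw [if_neg]
    rintro ⟨k, rfl⟩
    refine hn ⟨(w - 1) * g.T - k, ?_⟩
    rw [← h]
    push_cast
    field_simp
    ring
  rw [← elem_proj, this]
  simp

/-- L(-1) 1 = 0, so (q + 1) 1(q) = 0. -/
theorem elem_vac_eq_zero {q : ℚ} (hq : q ≠ -1) : g.elem q vac = 0 := by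
  have h := elem_deriv (g := g) (q + 1) vac
  rw [mode_vac _ _ le_rfl, map_zero, add_sub_cancel_right, eq_comm, smul_eq_zero] at h
  refine h.resolve_left fun h => hq ?_
  have h' : (q : ℂ) + 1 = 0 := by
    push_cast at h
    linear_combination -h
  have h'' : q + 1 = 0 := by exact_mod_cast h'
  linarith

/-- The modes 1_i with i ≥ 0 vanish, so 1(-1) is central. -/
theorem lie_vac (x : g.Vg) : ⁅g.elem (-1) vac, x⁆ = 0 := by
  have hx : x ∈ ⨆ n, g.VgDeg n := by rw [iSup_VgDeg]; trivial
  induction hx using Submodule.iSup_induction' with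
  | zero => simp
  | add x y _ _ hx hy => rw [lie_add, hx, hy, add_zero]
  | mem n x hx =>
    refine VgDeg_induction (p := fun x => ⁅g.elem (-1) vac, x⁆ = 0) hx (by simp)
      (fun x y hx hy => by rw [lie_add, hx, hy, add_zero]) (fun w q a ha ha' hn => ?_)
    rw [lie_elem q (by simpa using mem_eig_add_int (g := g) vac_mem_eig (-1)) a (N := 0)]
    · simp
    · intro i _
      rw [vac_mode, if_neg (by omega)]

/-! ### The decomposition of V[g] into P and the positive part -/

variable (g) in
/-- The part of `V[g]` of positive degree. -/
def posPart : Submodule ℂ g.Vg := ⨆ n ∈ Set.Ioi (0 : ℚ), g.VgDeg n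

variable (g) in
/-- The part `P = V[g]_- ⊕ V[g]_0` of `V[g]`. -/
def nonposPart : Submodule ℂ g.Vg := ⨆ n ∈ Set.Iic (0 : ℚ), g.VgDeg n

theorem lie_mem_biSup {s : Set ℚ} (hs : ∀ m ∈ s, ∀ n ∈ s, m + n ∈ s) {x y : g.Vg}
    (hx : x ∈ ⨆ n ∈ s, g.VgDeg n) (hy : y ∈ ⨆ n ∈ s, g.VgDeg n) : ⁅x, y⁆ ∈ ⨆ n ∈ s, g.VgDeg n := by
  rw [iSup_subtype'] at hx hy
  induction hx using Submodule.iSup_induction' with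
  | zero => simp
  | add x x' _ _ h h' => rw [add_lie]; exact Submodule.add_mem _ h h'
  | mem m x hx =>
    induction hy using Submodule.iSup_induction' with
    | zero => simp
    | add x x' _ _ h h' => rw [lie_add]; exact Submodule.add_mem _ h h'
    | mem n y hy =>
      exact Submodule.mem_iSup_of_mem _ (Submodule.mem_iSup_of_mem (hs _ m.2 _ n.2)
        (lie_mem_VgDeg hx hy))

theorem isCompl_nonposPart_posPart : IsCompl g.nonposPart g.posPart := by
  constructor
  · refine iSupIndep_VgDeg.disjoint_biSup_biSup ?_
    rw [Set.disjoint_left]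
    intro x hx hx'
    exact not_lt.mpr (Set.mem_Iic.mp hx) (Set.mem_Ioi.mp hx')
  · rw [codisjoint_iff, eq_top_iff, ← iSup_VgDeg]
    refine iSup_le fun n => ?_
    rcases le_or_gt n 0 with h | h
    · exact le_sup_of_le_left (le_iSup₂_of_le n h le_rfl)
    · exact le_sup_of_le_right (le_iSup₂_of_le n h le_rfl)

theorem lie_mem_nonposPart {x y : g.Vg} (hx : x ∈ g.nonposPart) (hy : y ∈ g.nonposPart) :
    ⁅x, y⁆ ∈ g.nonposPart :=
  lie_mem_biSup (s := Set.Iic 0) (fun _ hm _ hn => add_nonpos (Set.mem_Iic.mp hm)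
    (Set.mem_Iic.mp hn)) hx hy

theorem lie_mem_posPart {x y : g.Vg} (hx : x ∈ g.posPart) (hy : y ∈ g.posPart) :
    ⁅x, y⁆ ∈ g.posPart :=
  lie_mem_biSup (s := Set.Ioi 0) (fun _ hm _ hn => add_pos (Set.mem_Ioi.mp hm)
    (Set.mem_Ioi.mp hn)) hx hy

variable (g) in
/-- `P` as a Lie subalgebra. -/
def nonposLie : LieSubalgebra ℂ g.Vg :=
  { g.nonposPart with
    lie_mem' := lie_mem_nonposPart }

end

end FiniteOrderAut

namespace FiniteOrderAut

noncomputable section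

open VertexOperatorAlgebra TensorProduct

variable {V : Type u} [AddCommGroup V] [Module ℂ V] [VertexOperatorAlgebra V]
variable {g : FiniteOrderAut V}

/-! ### The action of `P` on `U` and the projection `M(U) → U` -/

open Classical in
/-- The linear map on finite sums of terms `t^q ⊗ a` that takes `t^q ⊗ a` to the action of
`a + O_g(V)` if `q = wt a - 1`, and to `0` for the other `q`. -/
def loopRho (U : AgMod.{u, v} g) : Loop V →ₗ[ℂ] Module.End ℂ U.carrier :=
  Finsupp.lsum ℂ fun q => byWeight fun n => if (n : ℚ) - 1 = q then U.rho ∘ₗ g.Og.mkQ else 0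

open Classical in
theorem loopRho_single (U : AgMod.{u, v} g) (q : ℚ) {w : ℤ} {a : V} (ha : a ∈ wtSpace V w) :
    loopRho U (Finsupp.single q a) = if (w : ℚ) - 1 = q then U.rho (g.Og.mkQ a) else 0 := by
  rw [loopRho, Finsupp.lsum_single, byWeight_apply _ ha]
  split_ifs <;> rfl

/-- Only p = w matters, and then D gives w a + L(-1) a, which lies in O_g(V). So the action of the
zero modes descends to V[g]. -/
theorem loopRho_loopD (U : AgMod.{u, v} g) (p : ℚ) (a : V) :
    loopRho U (loopD (Finsupp.single p (g.proj p a))) = 0 := by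
  induction a using wt_induction with
  | zero => simp
  | add a b ha hb => simp only [map_add, Finsupp.single_add, ha, hb, add_zero]
  | hom w a ha =>
    have hb := g.proj_mem_wtSpace ha p
    have hb' := g.proj_mem p a
    generalize g.proj p a = b at hb hb'
    rw [loopD_single, map_add, map_smul, loopRho_single U _ hb,
      loopRho_single U _ (deriv_mem_wtSpace hb)]
    by_cases h : (w : ℚ) = p
    · subst h
      rw [if_pos rfl, if_pos (by push_cast; ring), mkQ_deriv hb (by
        simpa using mem_eig_add_int hb' (-w)), map_smul, ← add_smul]
      simp
    · rw [if_neg (fun h' => h (by linarith)), if_neg (fun h' => h (by push_cast at h'; linarith))]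
      simp

/-- The linear map on `V[g]` that takes `a(wt a - 1)` to the action of `a + O_g(V)` on `U` for
homogeneous `a ∈ V^0`, and that vanishes on the spaces of degree other than `0`. -/
def zeroAct (U : AgMod.{u, v} g) : g.Vg →ₗ[ℂ] Module.End ℂ U.carrier :=
  (g.loopDInv.comap g.loopInv.subtype).liftQ (loopRho U ∘ₗ g.loopInv.subtype) (by
    rintro x ⟨z, hz, hx⟩
    rw [LinearMap.mem_ker, LinearMap.comp_apply, ← hx]
    refine loop_induction (p := fun z => loopRho U (loopD z) = 0) hz (by simp)
      (fun x y hx hy => by rw [map_add, map_add, hx, hy, add_zero]) fun q a ha => ?_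
    rw [← g.proj_apply ha]
    exact loopRho_loopD U q a)

open Classical in
theorem zeroAct_elem (U : AgMod.{u, v} g) {q : ℚ} {w : ℤ} {a : V} (ha : a ∈ wtSpace V w)
    (ha' : a ∈ g.eig q) :
    zeroAct U (g.elem q a) = if (w : ℚ) - 1 = q then U.rho (g.Og.mkQ a) else 0 := by
  rw [elem_eq ha', ← loopRho_single U q ha]
  rfl

theorem zeroAct_eq_zero (U : AgMod.{u, v} g) {n : ℚ} (hn : n ≠ 0) {x : g.Vg} (hx : x ∈ g.VgDeg n) :
    zeroAct U x = 0 := by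
  refine VgDeg_induction (p := fun x => zeroAct U x = 0) hx (by simp)
    (fun x y hx hy => by rw [map_add, hx, hy, add_zero]) fun w q a ha ha' h => ?_
  rw [zeroAct_elem U ha ha', if_neg]
  intro h'
  exact hn (by linarith)

/-- The bracket formula in degree 0 produces the class of Res (1 + z)^{wt a - 1} Y(a, z) b, which
acts as the commutator by `rho_comm`. -/
theorem zeroAct_lie_zero (U : AgMod.{u, v} g) {x y : g.Vg} (hx : x ∈ g.VgDeg 0)
    (hy : y ∈ g.VgDeg 0) :
    zeroAct U ⁅x, y⁆ = zeroAct U x * zeroAct U y - zeroAct U y * zeroAct U x := by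
  refine VgDeg_induction (p := fun x => zeroAct U ⁅x, y⁆ =
    zeroAct U x * zeroAct U y - zeroAct U y * zeroAct U x) hx (by simp) (fun x x' h h' => ?_)
    (fun w p a ha ha' hm => ?_)
  · rw [add_lie, map_add, map_add, h, h']; noncomm_ring
  refine VgDeg_induction (p := fun y => zeroAct U ⁅g.elem p a, y⁆ =
    zeroAct U (g.elem p a) * zeroAct U y - zeroAct U y * zeroAct U (g.elem p a)) hy (by simp)
    (fun x x' h h' => ?_) (fun w' q b hb hb' hn => ?_)
  · rw [lie_add, map_add, map_add, h, h']; noncomm_ring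
  obtain rfl : p = (w : ℚ) - 1 := by linarith
  obtain rfl : q = (w' : ℚ) - 1 := by linarith
  have ha0 : a ∈ g.eig 0 := by
    have := mem_eig_add_int ha' (1 - w)
    push_cast at this
    rwa [show (w : ℚ) - 1 + (1 - w) = 0 by ring] at this
  have hb0 : b ∈ g.eig 0 := by
    have := mem_eig_add_int hb' (1 - w')
    push_cast at this
    rwa [show (w' : ℚ) - 1 + (1 - w') = 0 by ring] at this
  obtain ⟨N, hN⟩ := trunc_nat a b
  rw [lie_elem _ ha' b hN, zeroAct_elem U ha ha', zeroAct_elem U hb hb', if_pos rfl, if_pos rfl,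
    ← rho_comm U ha ha0 hb hb0, res_eq_sum _ _ _ _ (N := N) (by simpa using hN)]
  simp only [map_sum, map_smul]
  refine Finset.sum_congr rfl fun i _ => ?_
  rw [zeroAct_elem U (mode_mem_wtSpace ha hb i) (by
    rw [g.eig_sub_nat]
    exact g.mode_mem_eig ha' hb' i), if_pos (by push_cast; ring)]
  simp

/-- If one entry has negative degree, so has the bracket, and both sides vanish. Outside P the
argument breaks down, since degrees n and -n bracket into degree 0. -/
theorem zeroAct_lie (U : AgMod.{u, v} g) {x y : g.Vg} (hx : x ∈ g.nonposPart)
    (hy : y ∈ g.nonposPart) :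
    zeroAct U ⁅x, y⁆ = zeroAct U x * zeroAct U y - zeroAct U y * zeroAct U x := by
  rw [nonposPart, iSup_subtype'] at hx hy
  induction hx using Submodule.iSup_induction' with
  | zero => simp
  | add x x' _ _ h h' => rw [add_lie, map_add, map_add, h, h']; noncomm_ring
  | mem m x hx =>
    induction hy using Submodule.iSup_induction' with
    | zero => simp
    | add x x' _ _ h h' => rw [lie_add, map_add, map_add, h, h']; noncomm_ring
    | mem n y hy =>
      obtain ⟨m, hm⟩ := m
      obtain ⟨n, hn⟩ := n
      rw [Set.mem_Iic] at hm hn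
      simp only at hx hy
      rcases hm.lt_or_eq with hm | rfl
      · rw [zeroAct_eq_zero U (by linarith : m + n ≠ 0 ) (lie_mem_VgDeg hx hy),
          zeroAct_eq_zero U hm.ne hx]
        simp
      rcases hn.lt_or_eq with hn | rfl
      · rw [zeroAct_eq_zero U (by linarith : 0 + n ≠ 0) (lie_mem_VgDeg hx hy),
          zeroAct_eq_zero U hn.ne hy]
        simp
      exact zeroAct_lie_zero U hx hy

variable (g) in
/-- The projection of `V[g]` to `P` along the part of positive degree. -/
def nonposProj : g.Vg →ₗ[ℂ] g.nonposLie :=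
  (Submodule.projection _ _ (isCompl_nonposPart_posPart (g := g))).codRestrict
    g.nonposLie.toSubmodule fun x => (Submodule.projectionOnto _ _ isCompl_nonposPart_posPart x).2

theorem nonposProj_coe (x : g.nonposLie) : g.nonposProj x = x :=
  Subtype.ext (Submodule.projection_apply_left isCompl_nonposPart_posPart (⟨x, x.2⟩ : g.nonposPart))

theorem nonposProj_eq_zero {x : g.Vg} : g.nonposProj x = 0 ↔ x ∈ g.posPart := by
  rw [← Submodule.projection_apply_eq_zero_iff (isCompl_nonposPart_posPart (g := g)),
    Subtype.ext_iff]
  rfl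

/-- In PBW terms M(U) is U(V[g]_+) ⊗ U, and π is the augmentation on the first factor. Here π is
induced by x ⊗ z ↦ E(x) z, with E from `exists_extension`; the property E(x p) = E(x) ρ(p) makes it
vanish on the relations. -/
theorem exists_indProj (U : AgMod.{u, v} g) : ∃ π : Ind U →ₗ[ℂ] U.carrier,
    (∀ z, π (indIncl U z) = z) ∧
    ∀ n > (0 : ℚ), ∀ y ∈ g.VgDeg n, ∀ w : Ind U, π (g.iota y • w) = 0 := by
  obtain ⟨E, h1, hP, hpos⟩ := EnvAlg.exists_extension g.nonposProj nonposProj_coe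
    (fun y z hy hz => by
      rw [nonposProj_eq_zero] at *
      exact lie_mem_posPart hy hz)
    (zeroAct U ∘ₗ g.nonposLie.toSubmodule.subtype) (fun x y => zeroAct_lie U x.2 y.2)
  have hP' : ∀ (x : g.UEg) (n : ℚ) (_ : n ≤ 0), ∀ y ∈ g.VgDeg n,
      E (x * g.iota y) = E x * zeroAct U y := fun x n hn y hy =>
    hP x ⟨y, Submodule.mem_iSup_of_mem n (Submodule.mem_iSup_of_mem hn hy)⟩
  let F : g.UEg ⊗[ℂ] U.carrier →ₗ[ℂ] U.carrier := TensorProduct.lift E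
  have hF : (indRel U).restrictScalars ℂ ≤ LinearMap.ker F := by
    intro x hx
    rw [Submodule.restrictScalars_mem] at hx
    rw [LinearMap.mem_ker]
    induction hx using Submodule.closure_induction with
    | zero => simp
    | add x y _ _ hx hy => rw [map_add, hx, hy, add_zero]
    | smul_mem t x hx =>
      rcases hx with ⟨n, hn, y, hy, z, rfl⟩ | ⟨w, a, ha, ha', z, rfl⟩
      · rw [TensorProduct.smul_tmul', TensorProduct.lift.tmul, smul_eq_mul, hP' t n hn.le y hy,
          zeroAct_eq_zero U hn.ne hy]
        simp
      · have hd : g.elem ((w : ℚ) - 1) a ∈ g.VgDeg 0 := by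
          convert elem_mem_VgDeg (g := g) ha ((w : ℚ) - 1) using 2
          ring
        have ha1 : a ∈ g.eig ((w : ℚ) - 1) := by
          simpa using mem_eig_add_int ha' (w - 1)
        rw [smul_sub, TensorProduct.smul_tmul', TensorProduct.smul_tmul', map_sub,
          TensorProduct.lift.tmul, TensorProduct.lift.tmul, smul_eq_mul, smul_eq_mul, mul_one,
          hP' t 0 le_rfl _ hd, zeroAct_elem U ha ha1, if_pos rfl]
        simp
  refine ⟨((indRel U).restrictScalars ℂ).liftQ F hF ∘ₗ
    (Submodule.Quotient.restrictScalarsEquiv ℂ (indRel U)).symm.toLinearMap, fun z => ?_,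
    fun n hn y hy w => ?_⟩
  · change F (1 ⊗ₜ z) = z
    simp [F, h1]
  · obtain ⟨t, rfl⟩ := Submodule.mkQ_surjective _ w
    change F (g.iota y • t) = 0
    induction t with
    | zero => simp
    | add s t hs ht => rw [smul_add, map_add, hs, ht, add_zero]
    | tmul x z =>
      rw [TensorProduct.smul_tmul', TensorProduct.lift.tmul, smul_eq_mul]
      have := hpos y x (nonposProj_eq_zero.mpr
        (Submodule.mem_iSup_of_mem n (Submodule.mem_iSup_of_mem hn hy)))
      change E (EnvAlg.incl ℂ g.Vg y * x) z = 0
      rw [this]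
      rfl

/-- The projection of `M(U)` onto `U` that vanishes in positive degree. -/
def indProj (U : AgMod.{u, v} g) : Ind U →ₗ[ℂ] U.carrier := (exists_indProj U).choose

theorem indProj_indIncl (U : AgMod.{u, v} g) (z : U.carrier) : indProj U (indIncl U z) = z :=
  (exists_indProj U).choose_spec.1 z

theorem indProj_smul (U : AgMod.{u, v} g) {n : ℚ} (hn : 0 < n) {y : g.Vg} (hy : y ∈ g.VgDeg n)
    (w : Ind U) : indProj U (g.iota y • w) = 0 :=
  (exists_indProj U).choose_spec.2 n hn y hy w

end

end FiniteOrderAut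

/-- An independent family of submodules that contains a family spanning everything equals it. -/
theorem iSupIndep.le_of_iSup_eq_top {R M ι : Type*} [Ring R] [AddCommGroup M] [Module R M]
    {A G : ι → Submodule R M} (hA : iSupIndep A) (hG : ∀ i, G i ≤ A i) (h : ⨆ i, G i = ⊤) (i : ι) :
    A i ≤ G i := by
  intro x hx
  have hx' : x ∈ G i ⊔ ⨆ j, ⨆ (_ : j ≠ i), G j := by
    have : ⨆ j, G j ≤ G i ⊔ ⨆ j, ⨆ (_ : j ≠ i), G j := iSup_le fun j => by
      by_cases hj : j = i
      · subst hj; exact le_sup_left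
      · exact le_sup_of_le_right (le_iSup₂_of_le j hj le_rfl)
    rw [h] at this
    exact this trivial
  obtain ⟨y, hy, z, hz, rfl⟩ := Submodule.mem_sup.mp hx'
  have h1 : z ∈ A i := (Submodule.add_mem_iff_right _ (hG i hy)).mp hx
  have h2 : z ∈ ⨆ j, ⨆ (_ : j ≠ i), A j :=
    iSup₂_mono (fun j _ => hG j) hz
  rw [(Submodule.disjoint_def.mp (hA i)) z h1 h2, add_zero]
  exact hy

namespace FiniteOrderAut

noncomputable section

open VertexOperatorAlgebra TensorProduct

variable {V : Type u} [AddCommGroup V] [Module ℂ V] [VertexOperatorAlgebra V]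
variable {g : FiniteOrderAut V}

/-! ### Modules over the enveloping algebra of `V[g]` -/

section Modules

variable {N : Type*} [AddCommGroup N] [Module g.UEg N]

theorem iota_smul_comm (x y : g.Vg) (w : N) :
    g.iota x • g.iota y • w = g.iota ⁅x, y⁆ • w + g.iota y • g.iota x • w := by
  have h : g.iota ⁅x, y⁆ = g.iota x * g.iota y - g.iota y * g.iota x := EnvAlg.incl_lie x y
  rw [h, sub_smul, mul_smul, mul_smul, sub_add_cancel]

variable [Module ℂ N] [IsScalarTower ℂ g.UEg N]

theorem smul_mem_of_iota {S : Submodule ℂ N}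
    (hS : ∀ n, ∀ y ∈ g.VgDeg n, ∀ s ∈ S, g.iota y • s ∈ S) (x : g.UEg) {s : N} (hs : s ∈ S) :
    x • s ∈ S := by
  induction x using EnvAlg.induction_left with
  | one => rwa [one_smul]
  | add x y hx hy => rw [add_smul]; exact Submodule.add_mem _ hx hy
  | smul c x hx => rw [smul_assoc]; exact Submodule.smul_mem _ _ hx
  | mul y x hx =>
    rw [mul_smul]
    change g.iota y • (x • s) ∈ S
    generalize x • s = t at hx
    have hy : y ∈ ⨆ n, g.VgDeg n := by rw [iSup_VgDeg]; trivial
    induction hy using Submodule.iSup_induction' with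
    | zero => simp
    | add y z _ _ hy hz => rw [map_add, add_smul]; exact Submodule.add_mem _ hy hz
    | mem n y hy => exact hS n y hy t hx

/-- If `W` is stable under `P` and is contained in a subspace `S` stable under the part of `V[g]` of
positive degree, then `S` contains the `V[g]`-submodule generated by `W`. -/
theorem smul_mem_of_triangular {W S : Submodule ℂ N}
    (hW : ∀ n ≤ (0 : ℚ), ∀ y ∈ g.VgDeg n, ∀ w ∈ W, g.iota y • w ∈ W) (hWS : W ≤ S)
    (hS : ∀ n > (0 : ℚ), ∀ y ∈ g.VgDeg n, ∀ s ∈ S, g.iota y • s ∈ S) (x : g.UEg) {w : N}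
    (hw : w ∈ W) : x • w ∈ S := by
  -- S₀ is the span of products of positive elements applied to W; it lies in S, and it has to be
  -- shown stable under all of V[g].
  let S₀ : Submodule ℂ N := Submodule.span ℂ {x | ∃ (l : List g.Vg) (w : N),
    (∀ y ∈ l, ∃ n > (0 : ℚ), y ∈ g.VgDeg n) ∧ w ∈ W ∧ x = (l.map g.iota).prod • w}
  have hpos : ∀ n > (0 : ℚ), ∀ y ∈ g.VgDeg n, ∀ s ∈ S₀, g.iota y • s ∈ S₀ := by
    intro n hn y hy s hs
    induction hs using Submodule.span_induction with
    | zero => simp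
    | add s t _ _ hs ht => rw [smul_add]; exact Submodule.add_mem _ hs ht
    | smul c s _ hs =>
      rw [smul_algebra_smul_comm]
      exact Submodule.smul_mem _ _ hs
    | mem s hs =>
      obtain ⟨l, w, hl, hw, rfl⟩ := hs
      refine Submodule.subset_span ⟨y :: l, w, ?_, hw, ?_⟩
      · intro z hz
        rcases List.mem_cons.mp hz with rfl | hz
        · exact ⟨n, hn, hy⟩
        · exact hl z hz
      · rw [List.map_cons, List.prod_cons, mul_smul]
  -- Induction on the number of positive factors: y z s = [y, z] s + z y s, where [y, z] and y meet
  -- a product with one factor fewer, and the positive z in front preserves S₀.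
  have hgen : ∀ (l : List g.Vg), (∀ y ∈ l, ∃ n > (0 : ℚ), y ∈ g.VgDeg n) → ∀ w ∈ W, ∀ n,
      ∀ y ∈ g.VgDeg n, g.iota y • (l.map g.iota).prod • w ∈ S₀ := by
    intro l
    induction l with
    | nil =>
      intro _ w hw n y hy
      rw [List.map_nil, List.prod_nil, one_smul]
      rcases le_or_gt n 0 with hn | hn
      · exact Submodule.subset_span ⟨[], _, by simp, hW n hn y hy w hw, by simp⟩
      · exact hpos n hn y hy w (Submodule.subset_span ⟨[], _, by simp, hw, by simp⟩)
    | cons z l ih =>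
      intro hl w hw n y hy
      obtain ⟨m, hm, hz⟩ := hl z List.mem_cons_self
      have hl' : ∀ y ∈ l, ∃ n > (0 : ℚ), y ∈ g.VgDeg n := fun y hy => hl y (List.mem_cons_of_mem _ hy)
      rw [List.map_cons, List.prod_cons, mul_smul, iota_smul_comm]
      exact Submodule.add_mem _ (ih hl' w hw _ _ (lie_mem_VgDeg hy hz))
        (hpos m hm z hz _ (ih hl' w hw n y hy))
  have hle : S₀ ≤ S := by
    refine Submodule.span_le.mpr ?_
    rintro _ ⟨l, w, hl, hw, rfl⟩
    induction l with
    | nil => simpa using hWS hw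
    | cons z l ih =>
      obtain ⟨m, hm, hz⟩ := hl z List.mem_cons_self
      rw [List.map_cons, List.prod_cons, mul_smul]
      exact hS m hm z hz _ (ih fun y hy => hl y (List.mem_cons_of_mem _ hy))
  refine hle (smul_mem_of_iota (S := S₀) (fun n y hy s hs => ?_) x
    (Submodule.subset_span ⟨[], _, by simp, hw, by simp⟩))
  induction hs using Submodule.span_induction with
  | zero => simp
  | add s t _ _ hs ht => rw [smul_add]; exact Submodule.add_mem _ hs ht
  | smul c s _ hs =>
    rw [smul_algebra_smul_comm]
    exact Submodule.smul_mem _ _ hs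
  | mem s hs =>
    obtain ⟨l, w, hl, hw, rfl⟩ := hs
    exact hgen l hl w hw n y hy

end Modules

/-- The homogeneous subspaces of the enveloping algebra of `V[g]`. -/
def envDeg (g : FiniteOrderAut V) (n : ℚ) : Submodule ℂ g.UEg :=
  Submodule.span ℂ {x | ∃ l : List (ℚ × g.Vg), (∀ p ∈ l, p.2 ∈ g.VgDeg p.1) ∧
    (l.map Prod.fst).sum = n ∧ x = (l.map fun p => g.iota p.2).prod}

theorem iota_mul_mem_envDeg {m n : ℚ} {y : g.Vg} (hy : y ∈ g.VgDeg m) {x : g.UEg}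
    (hx : x ∈ g.envDeg n) : g.iota y * x ∈ g.envDeg (m + n) := by
  induction hx using Submodule.span_induction with
  | zero => simp
  | add s t _ _ hs ht => rw [mul_add]; exact Submodule.add_mem _ hs ht
  | smul c s _ hs => rw [mul_smul_comm]; exact Submodule.smul_mem _ _ hs
  | mem s hs =>
    obtain ⟨l, hl, hn, rfl⟩ := hs
    refine Submodule.subset_span ⟨(m, y) :: l, ?_, ?_, ?_⟩
    · intro p hp
      rcases List.mem_cons.mp hp with rfl | hp
      · exact hy
      · exact hl p hp
    · simp [hn]
    · simp

theorem iSup_envDeg : ⨆ n, g.envDeg n = ⊤ := by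
  rw [eq_top_iff]
  rintro x -
  have h1 : (1 : g.UEg) ∈ ⨆ n, g.envDeg n :=
    Submodule.mem_iSup_of_mem 0 (Submodule.subset_span ⟨[], by simp, by simp, by simp⟩)
  have h := smul_mem_of_iota (g := g) (N := g.UEg) (S := ⨆ n, g.envDeg n) (fun m y hy s hs => ?_) x h1
  · rwa [smul_eq_mul, mul_one] at h
  · induction hs using Submodule.iSup_induction' with
    | zero => simp
    | add s t _ _ hs ht => rw [smul_add]; exact Submodule.add_mem _ hs ht
    | mem n s hs => exact Submodule.mem_iSup_of_mem _ (iota_mul_mem_envDeg hy hs)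

/-! ### The structure of `M(U)` -/

theorem Ind_induction (U : AgMod.{u, v} g) {p : Ind U → Prop} (w : Ind U)
    (add : ∀ w w', p w → p w' → p (w + w')) (smul : ∀ (x : g.UEg) z, p (x • indIncl U z)) : p w := by
  obtain ⟨t, rfl⟩ := Submodule.mkQ_surjective _ w
  induction t with
  | zero => simpa using smul 0 0
  | add s t hs ht => rw [map_add]; exact add _ _ hs ht
  | tmul x z =>
    have := smul x z
    rw [indIncl, LinearMap.comp_apply, LinearMap.restrictScalars_apply, ← map_smul,
      TensorProduct.mk_apply, TensorProduct.smul_tmul', smul_eq_mul, mul_one] at this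
    exact this

theorem iota_smul_indIncl (U : AgMod.{u, v} g) {n : ℚ} (hn : n ≤ 0) {y : g.Vg}
    (hy : y ∈ g.VgDeg n) (z : U.carrier) :
    g.iota y • indIncl U z = indIncl U (zeroAct U y z) := by
  have key : ∀ (x : g.UEg) (z : U.carrier), (indRel U).mkQ (x ⊗ₜ z) = x • indIncl U z := by
    intro x z
    rw [indIncl, LinearMap.comp_apply, LinearMap.restrictScalars_apply, ← map_smul,
      TensorProduct.mk_apply, TensorProduct.smul_tmul', smul_eq_mul, mul_one]
  rcases hn.lt_or_eq with hn | rfl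
  · rw [zeroAct_eq_zero U hn.ne hy, LinearMap.zero_apply, map_zero, ← key, Submodule.mkQ_apply,
      Submodule.Quotient.mk_eq_zero]
    exact Submodule.subset_span (Or.inl ⟨n, hn, y, hy, z, rfl⟩)
  · refine VgDeg_induction (p := fun y => g.iota y • indIncl U z = indIncl U (zeroAct U y z)) hy
      (by simp) (fun x y hx hy => ?_) fun w q a ha ha' h => ?_
    · rw [map_add, add_smul, hx, hy, map_add, LinearMap.add_apply, map_add]
    obtain rfl : q = (w : ℚ) - 1 := by linarith
    have ha0 : a ∈ g.eig 0 := by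
      have := mem_eig_add_int ha' (1 - w)
      push_cast at this
      rwa [show (w : ℚ) - 1 + (1 - w) = 0 by ring] at this
    rw [zeroAct_elem U ha ha', if_pos rfl, ← sub_eq_zero, ← one_smul g.UEg (indIncl U (U.rho _ z)),
      ← key, ← key, ← map_sub, Submodule.mkQ_apply, Submodule.Quotient.mk_eq_zero]
    exact Submodule.subset_span (Or.inr ⟨w, a, ha, ha0, z, rfl⟩)

/-- The functor `M` on morphisms. -/
def indMap {U W : AgMod.{u, v} g} (f : U ⟶ W) : Ind U →ₗ[g.UEg] Ind W :=
  Submodule.mapQ (indRel U) (indRel W) (AlgebraTensorModule.map LinearMap.id f.toLin) (by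
    refine Submodule.span_le.mpr ?_
    rintro _ (⟨n, hn, y, hy, z, rfl⟩ | ⟨w, a, ha, ha', z, rfl⟩)
    · exact Submodule.subset_span (Or.inl ⟨n, hn, y, hy, f.toLin z, rfl⟩)
    · refine Submodule.subset_span (Or.inr ⟨w, a, ha, ha', f.toLin z, ?_⟩)
      rw [map_sub, AlgebraTensorModule.map_tmul, AlgebraTensorModule.map_tmul, f.comm]
      rfl)

theorem indMap_indIncl {U W : AgMod.{u, v} g} (f : U ⟶ W) (z : U.carrier) :
    indMap f (indIncl U z) = indIncl W (f.toLin z) := rfl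

theorem indGr_induction (U : AgMod.{u, v} g) {n : ℚ} {p : Ind U → Prop} {w : Ind U}
    (hw : w ∈ indGr U n) (zero : p 0) (add : ∀ w w', p w → p w' → p (w + w'))
    (smul : ∀ x ∈ g.envDeg n, ∀ z, p (x • indIncl U z)) : p w := by
  induction hw using Submodule.closure_induction with
  | zero => exact zero
  | add x y _ _ hx hy => exact add _ _ hx hy
  | smul_mem c x hx =>
    obtain ⟨l, z, hl, hn, rfl⟩ := hx
    rw [← smul_assoc]
    exact smul _ (Submodule.smul_mem _ _ (Submodule.subset_span ⟨l, hl, hn, rfl⟩)) z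

theorem smul_indIncl_mem_indGr (U : AgMod.{u, v} g) {n : ℚ} {x : g.UEg} (hx : x ∈ g.envDeg n)
    (z : U.carrier) : x • indIncl U z ∈ indGr U n := by
  induction hx using Submodule.span_induction with
  | zero => simp
  | add s t _ _ hs ht => rw [add_smul]; exact Submodule.add_mem _ hs ht
  | smul c s _ hs => rw [smul_assoc]; exact Submodule.smul_mem _ _ hs
  | mem s hs =>
    obtain ⟨l, hl, hn, rfl⟩ := hs
    exact Submodule.subset_span ⟨l, z, hl, hn, rfl⟩

theorem indMap_mem_indGr {U W : AgMod.{u, v} g} (f : U ⟶ W) {n : ℚ} {w : Ind U}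
    (hw : w ∈ indGr U n) : indMap f w ∈ indGr W n := by
  refine indGr_induction U (p := fun w => indMap f w ∈ indGr W n) hw (by simp) (fun w w' h h' => ?_)
    fun x hx z => ?_
  · rw [map_add]; exact Submodule.add_mem _ h h'
  · rw [map_smul, indMap_indIncl]
    exact smul_indIncl_mem_indGr W hx _

theorem iota_smul_mem_indGr (U : AgMod.{u, v} g) {m n : ℚ} {y : g.Vg} (hy : y ∈ g.VgDeg m)
    {w : Ind U} (hw : w ∈ indGr U n) : g.iota y • w ∈ indGr U (m + n) := by
  refine indGr_induction U (p := fun w => g.iota y • w ∈ indGr U (m + n)) hw (by simp)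
    (fun w w' h h' => ?_) fun x hx z => ?_
  · rw [smul_add]; exact Submodule.add_mem _ h h'
  · rw [← mul_smul]
    exact smul_indIncl_mem_indGr U (iota_mul_mem_envDeg hy hx) z

theorem indIncl_mem_indGr (U : AgMod.{u, v} g) (z : U.carrier) : indIncl U z ∈ indGr U 0 := by
  have h1 : (1 : g.UEg) ∈ g.envDeg 0 := Submodule.subset_span ⟨[], by simp, by simp, by simp⟩
  simpa using smul_indIncl_mem_indGr U h1 z

/-! ### The degree operator and the grading of M(U) -/

theorem conf_mem_VgDeg : g.elem 1 conf ∈ g.VgDeg 0 := by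
  convert elem_mem_VgDeg (g := g) conf_mem_wtSpace 1 using 2
  norm_num

theorem rho_eq_zeroAct (U : AgMod.{u, v} g) {w : ℤ} {a : V} (ha : a ∈ wtSpace V w)
    (ha' : a ∈ g.eig 0) : U.rho (g.Og.mkQ a) = zeroAct U (g.elem ((w : ℚ) - 1) a) := by
  rw [zeroAct_elem U ha (by simpa using mem_eig_add_int ha' (w - 1)), if_pos rfl]

/-- The action of the conformal vector, as an endomorphism of the `A_g(V)`-module `U`. -/
def confHom (U : AgMod.{u, v} g) : U ⟶ U :=
  AgMod.Hom.mk (zeroAct U (g.elem 1 conf)) fun a x => by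
    induction a using Submodule.Quotient.induction_on with
    | H a =>
      change zeroAct U (g.elem 1 conf) (U.rho (g.Og.mkQ a) x) =
        U.rho (g.Og.mkQ a) (zeroAct U (g.elem 1 conf) x)
      rw [← mkQ_proj]
      induction a using wt_induction with
      | zero => simp
      | add a b ha hb => simp only [map_add, LinearMap.add_apply, ha, hb]
      | hom w a ha =>
        rw [rho_eq_zeroAct U (g.proj_mem_wtSpace ha 0) (g.proj_mem 0 a)]
        have hd : g.elem ((w : ℚ) - 1) (g.proj 0 a) ∈ g.VgDeg 0 := by
          convert elem_mem_VgDeg (g := g) (g.proj_mem_wtSpace ha 0) ((w : ℚ) - 1) using 2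
          ring
        -- ω(1) commutes with V[g]_0 by `lie_conf`, so the class of ω acts on U by an
        -- A_g(V)-endomorphism.
        have h := zeroAct_lie_zero U conf_mem_VgDeg hd
        rw [lie_conf hd, Rat.cast_zero, zero_smul, map_zero, eq_comm, sub_eq_zero] at h
        exact LinearMap.congr_fun h x

/-- The derivation [ω(1), ·] of U(V[g]) multiplies products of total degree n by n. -/
theorem iota_conf_smul {N : Type*} [AddCommGroup N] [Module ℂ N] [Module g.UEg N]
    [IsScalarTower ℂ g.UEg N] {n : ℚ} {x : g.UEg} (hx : x ∈ g.envDeg n) (w : N) :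
    g.iota (g.elem 1 conf) • x • w = (n : ℂ) • x • w + x • g.iota (g.elem 1 conf) • w := by
  induction hx using Submodule.span_induction with
  | zero => simp
  | add s t _ _ hs ht => simp only [add_smul, smul_add, hs, ht]; abel
  | smul c s _ hs =>
    rw [smul_assoc, smul_algebra_smul_comm, hs, smul_add, smul_comm c (n : ℂ), smul_assoc]
  | mem s hs =>
    obtain ⟨l, hl, rfl, rfl⟩ := hs
    induction l with
    | nil => simp
    | cons p l ih =>
      simp only [List.map_cons, List.prod_cons, List.sum_cons, mul_smul]
      rw [iota_smul_comm, ih fun q hq => hl q (List.mem_cons_of_mem _ hq),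
        lie_conf (hl p List.mem_cons_self), map_smul, smul_assoc, smul_add,
        smul_algebra_smul_comm, Rat.cast_add, add_smul]
      abel

/-- The operator on `M(U)` which is `n` on `M(U)(n)`. -/
def indDegOp (U : AgMod.{u, v} g) : Module.End ℂ (Ind U) :=
  Algebra.lsmul ℂ ℂ (Ind U) (g.iota (g.elem 1 conf)) - (indMap (confHom U)).restrictScalars ℂ

theorem indDegOp_apply (U : AgMod.{u, v} g) (w : Ind U) :
    indDegOp U w = g.iota (g.elem 1 conf) • w - indMap (confHom U) w := rfl

/-- On x u with x of degree n, ω(1) gives n x u + x ω(1) u. As ω need not act on U as a scalar, the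
second term is removed by the functorial extension to M(U) of its action on U. -/
theorem indGr_le_eigenspace (U : AgMod.{u, v} g) (n : ℚ) :
    indGr U n ≤ Module.End.eigenspace (indDegOp U) (n : ℂ) := by
  intro w hw
  rw [Module.End.mem_eigenspace_iff]
  refine indGr_induction U (p := fun w => indDegOp U w = (n : ℂ) • w) hw (by simp)
    (fun w w' h h' => ?_) fun x hx z => ?_
  · rw [map_add, h, h', smul_add]
  · rw [indDegOp_apply, map_smul, indMap_indIncl, iota_conf_smul hx,
      iota_smul_indIncl U le_rfl conf_mem_VgDeg]
    exact add_sub_cancel_right _ _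

theorem iSupIndep_indGr (U : AgMod.{u, v} g) : iSupIndep (indGr U) :=
  ((Module.End.eigenspaces_iSupIndep (indDegOp U)).comp (f := fun n : ℚ => (n : ℂ))
    Rat.cast_injective).mono (indGr_le_eigenspace U)

-- The candidates on the right are contained in the M(U)(n), and they span M(U) by the triangular
-- argument with W = U. As the M(U)(n) are independent, they cannot be larger.
open Classical in
theorem indGr_le (U : AgMod.{u, v} g) (n : ℚ) : indGr U n ≤
    if n = 0 then LinearMap.range (indIncl U) else
      if 0 < n then indGr U n ⊓ LinearMap.ker (indProj U) else ⊥ := by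
  let G : ℚ → Submodule ℂ (Ind U) := fun n => if n = 0 then LinearMap.range (indIncl U) else
      if 0 < n then indGr U n ⊓ LinearMap.ker (indProj U) else ⊥
  refine (iSupIndep_indGr U).le_of_iSup_eq_top (G := G) (fun n => ?_) ?_ n
  · simp only [G]
    split_ifs with h h'
    · subst h
      rintro _ ⟨z, rfl⟩
      exact indIncl_mem_indGr U z
    · exact inf_le_left
    · exact bot_le
  · rw [eq_top_iff]
    rintro w -
    have h0 : LinearMap.range (indIncl U) ≤ ⨆ n, G n := by
      refine le_iSup_of_le 0 ?_
      simp [G]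
    refine Ind_induction U w (fun w w' h h' => Submodule.add_mem _ h h') fun x z => ?_
    refine smul_mem_of_triangular (W := LinearMap.range (indIncl U)) ?_ h0 ?_ x ⟨z, rfl⟩
    · rintro n hn y hy _ ⟨z, rfl⟩
      exact ⟨_, (iota_smul_indIncl U hn hy z).symm⟩
    · intro n hn y hy s hs
      have hmem : ∀ m ≥ 0, ∀ s ∈ indGr U m, g.iota y • s ∈ ⨆ n, G n := by
        intro m hm s hs
        refine Submodule.mem_iSup_of_mem (n + m) ?_
        have : 0 < n + m := by linarith
        simp only [G, if_neg this.ne', if_pos this]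
        exact ⟨iota_smul_mem_indGr U hy hs, indProj_smul U hn hy s⟩
      induction hs using Submodule.iSup_induction' with
      | zero => simp
      | add s t _ _ hs ht => rw [smul_add]; exact Submodule.add_mem _ hs ht
      | mem m s hs =>
        simp only [G] at hs
        split_ifs at hs with h h'
        · obtain ⟨z, rfl⟩ := hs
          exact hmem 0 le_rfl _ (indIncl_mem_indGr U z)
        · exact hmem m h'.le _ hs.1
        · rw [Submodule.mem_bot] at hs
          simp [hs]

theorem indGr_zero (U : AgMod.{u, v} g) : indGr U 0 = LinearMap.range (indIncl U) := by
  refine le_antisymm (by simpa using indGr_le U 0) ?_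
  rintro _ ⟨z, rfl⟩
  exact indIncl_mem_indGr U z

theorem indGr_eq_bot_of_neg (U : AgMod.{u, v} g) {n : ℚ} (hn : n < 0) : indGr U n = ⊥ := by
  have := indGr_le U n
  rwa [if_neg hn.ne, if_neg hn.not_gt, le_bot_iff] at this

theorem indProj_eq_zero (U : AgMod.{u, v} g) {n : ℚ} (hn : n ≠ 0) {w : Ind U}
    (hw : w ∈ indGr U n) : indProj U w = 0 := by
  have := indGr_le U n hw
  rw [if_neg hn] at this
  split_ifs at this with h
  · exact this.2
  · rw [Submodule.mem_bot] at this
    rw [this, map_zero]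

theorem iSup_indGr (U : AgMod.{u, v} g) : ⨆ n, indGr U n = ⊤ := by
  rw [eq_top_iff]
  rintro w -
  refine Ind_induction U w (fun w w' h h' => Submodule.add_mem _ h h') fun x z => ?_
  have hx : x ∈ ⨆ n, g.envDeg n := by rw [iSup_envDeg]; trivial
  induction hx using Submodule.iSup_induction' with
  | zero => simp
  | add s t _ _ hs ht => rw [add_smul]; exact Submodule.add_mem _ hs ht
  | mem n x hx => exact Submodule.mem_iSup_of_mem n (smul_indIncl_mem_indGr U hx z)

theorem indGr_eq_bot (U : AgMod.{u, v} g) {n : ℚ} (hn : ¬ ∃ k : ℕ, n = k / g.T) :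
    indGr U n = ⊥ := by
  rcases lt_or_ge n 0 with h0 | h0
  · exact indGr_eq_bot_of_neg U h0
  have hT : (0 : ℚ) < g.T := by exact_mod_cast g.T_pos
  have hn' : ¬ ∃ k : ℤ, n = k / g.T := by
    rintro ⟨k, rfl⟩
    have hk : (0 : ℤ) ≤ k := by
      rw [le_div_iff₀ hT, zero_mul] at h0
      exact_mod_cast h0
    obtain ⟨k, rfl⟩ := Int.eq_ofNat_of_zero_le hk
    exact hn ⟨k, by simp⟩
  rw [eq_bot_iff]
  refine Submodule.span_le.mpr ?_
  rintro _ ⟨l, z, hl, hs, rfl⟩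
  -- Either all degrees in the list lie in (1/T)ℤ, or some factor is zero.
  have key : ∀ l : List (ℚ × g.Vg), (∀ p ∈ l, p.2 ∈ g.VgDeg p.1) →
      (∃ k : ℤ, (l.map Prod.fst).sum = k / g.T) ∨ (l.map fun p => g.iota p.2).prod = 0 := by
    intro l hl
    induction l with
    | nil => exact Or.inl ⟨0, by simp⟩
    | cons p l ih =>
      rcases ih fun q hq => hl q (List.mem_cons_of_mem _ hq) with ⟨k, hk⟩ | h
      · by_cases hp : ∃ j : ℤ, p.1 = j / g.T
        · obtain ⟨j, hj⟩ := hp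
          refine Or.inl ⟨j + k, ?_⟩
          rw [List.map_cons, List.sum_cons, hj, hk]
          push_cast
          ring
        · have := hl p List.mem_cons_self
          rw [VgDeg_eq_bot hp, Submodule.mem_bot] at this
          right
          simp [this]
      · right
        simp [h]
  rcases key l hl with ⟨k, hk⟩ | h
  · exact absurd ⟨k, hs.symm.trans hk⟩ hn'
  · rw [h, zero_smul]
    exact Submodule.zero_mem _

/-- Both sides agree on U and vanish in the other degrees. This is why the radical, and hence L, is
functorial. -/
theorem indProj_indMap {U W : AgMod.{u, v} g} (f : U ⟶ W) (w : Ind U) :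
    indProj W (indMap f w) = f.toLin (indProj U w) := by
  have hw : w ∈ ⨆ n, indGr U n := by rw [iSup_indGr]; trivial
  induction hw using Submodule.iSup_induction' with
  | zero => simp
  | add s t _ _ hs ht => simp only [map_add, hs, ht]
  | mem n w hw =>
    by_cases hn : n = 0
    · subst hn
      rw [indGr_zero] at hw
      obtain ⟨z, rfl⟩ := hw
      rw [indMap_indIncl, indProj_indIncl, indProj_indIncl]
    · rw [indProj_eq_zero U hn hw, indProj_eq_zero W hn (indMap_mem_indGr f hw), map_zero]

theorem envDeg_smul_mem_indGr (U : AgMod.{u, v} g) {m n : ℚ} {x : g.UEg} (hx : x ∈ g.envDeg m)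
    {w : Ind U} (hw : w ∈ indGr U n) : x • w ∈ indGr U (m + n) := by
  induction hx using Submodule.span_induction with
  | zero => simp
  | add s t _ _ hs ht => rw [add_smul]; exact Submodule.add_mem _ hs ht
  | smul c s _ hs => rw [smul_assoc]; exact Submodule.smul_mem _ _ hs
  | mem s hs =>
    obtain ⟨l, hl, rfl, rfl⟩ := hs
    induction l with
    | nil => simpa using hw
    | cons p l ih =>
      simp only [List.map_cons, List.prod_cons, List.sum_cons, mul_smul, add_assoc]
      exact iota_smul_mem_indGr U (hl p List.mem_cons_self)
        (ih fun q hq => hl q (List.mem_cons_of_mem _ hq))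

/-! ### J as the radical of the projection to U -/

/-- The radical of `M(U)`: the largest submodule contained in the kernel of the projection to
`U`. -/
def indRad (U : AgMod.{u, v} g) : Submodule g.UEg (Ind U) where
  carrier := {w | ∀ x : g.UEg, indProj U (x • w) = 0}
  zero_mem' := fun x => by simp
  add_mem' := fun hw hw' x => by rw [smul_add, map_add, hw, hw', add_zero]
  smul_mem' := fun y w hw x => by rw [← mul_smul]; exact hw _

theorem isGradedAvoiding_indRad (U : AgMod.{u, v} g) : IsGradedAvoiding U (indRad U) where
  graded := by
    intro w hw
    have hw' : w ∈ ⨆ n, indGr U n := by rw [iSup_indGr]; trivial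
    obtain ⟨f, hf, rfl⟩ := (Submodule.mem_iSup_iff_exists_finsupp _ _).mp hw'
    refine Submodule.sum_mem _ fun n _ => Submodule.mem_iSup_of_mem n ⟨?_, hf n⟩
    intro x
    have hx : x ∈ ⨆ n, g.envDeg n := by rw [iSup_envDeg]; trivial
    induction hx using Submodule.iSup_induction' with
    | zero => simp
    | add s t _ _ hs ht => rw [add_smul, map_add, hs, ht, add_zero]
    | mem m x hx =>
      -- If m + n = 0, the other components of w are sent by x to nonzero degrees, so the projection
      -- of x (f n) equals that of x w, which is zero.
      by_cases hmn : m + n = 0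
      · have h := hw x
        rw [Finsupp.sum, Finset.smul_sum, map_sum, Finset.sum_eq_single n] at h
        · exact h
        · intro k _ hk
          exact indProj_eq_zero U (fun h => hk (by linarith)) (envDeg_smul_mem_indGr U hx (hf k))
        · intro hn
          rw [Finsupp.notMem_support_iff.mp hn, smul_zero, map_zero]
      · exact indProj_eq_zero U hmn (envDeg_smul_mem_indGr U hx (hf n))
  inter_eq := by
    rw [eq_bot_iff]
    rintro _ ⟨hw, z, rfl⟩
    have := hw 1
    rw [one_smul, indProj_indIncl] at this
    rw [this, map_zero]
    exact Submodule.zero_mem _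

/-- By M(U)(0) = U, a graded submodule avoiding U has no component in degree 0; so it lies in the
kernel of the projection, and being a submodule, in the radical. -/
theorem le_indRad (U : AgMod.{u, v} g) {J : Submodule g.UEg (Ind U)} (hJ : IsGradedAvoiding U J) :
    J ≤ indRad U := by
  have key : J.restrictScalars ℂ ≤ LinearMap.ker (indProj U) := by
    refine hJ.graded.trans (iSup_le fun n => ?_)
    by_cases hn : n = 0
    · rw [hn, indGr_zero, hJ.inter_eq]
      exact bot_le
    · exact fun w hw => indProj_eq_zero U hn hw.2
  exact fun w hw x => key (J.smul_mem x hw)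

theorem maxJ_eq (U : AgMod.{u, v} g) : maxJ U = indRad U :=
  le_antisymm (sSup_le fun _ hJ => le_indRad U hJ) (le_sSup (isGradedAvoiding_indRad U))

theorem isGreatest_maxJ (U : AgMod.{u, v} g) : IsGreatest {J | IsGradedAvoiding U J} (maxJ U) := by
  rw [maxJ_eq]
  exact ⟨isGradedAvoiding_indRad U, fun _ hJ => le_indRad U hJ⟩

/-! ### The structure of `L(U)` -/

theorem LMk_surjective (U : AgMod.{u, v} g) : Function.Surjective (LMk U) := by
  intro w
  obtain ⟨t, ht⟩ := Submodule.mkQ_surjective (maxJ U) w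
  exact ⟨t, ht⟩

theorem LMk_smul (U : AgMod.{u, v} g) (x : g.UEg) (w : Ind U) : LMk U (x • w) = x • LMk U w := rfl

/-- The projection of `L(U)` onto `U`. -/
def LProj (U : AgMod.{u, v} g) : LCar U →ₗ[ℂ] U.carrier :=
  ((maxJ U).restrictScalars ℂ).liftQ (indProj U) (fun w hw => by
    rw [Submodule.restrictScalars_mem, maxJ_eq] at hw
    simpa using hw 1) ∘ₗ (Submodule.Quotient.restrictScalarsEquiv ℂ (maxJ U)).symm.toLinearMap

/-- The submodule divided out is exactly the radical of the projection. -/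
theorem LCar_eq_zero (U : AgMod.{u, v} g) {w : LCar U} (h : ∀ x : g.UEg, LProj U (x • w) = 0) :
    w = 0 := by
  obtain ⟨w, rfl⟩ := LMk_surjective U w
  change (maxJ U).mkQ w = 0
  rw [Submodule.mkQ_apply, Submodule.Quotient.mk_eq_zero, maxJ_eq]
  exact h

/-- The functor `L` on morphisms. -/
def LMap {U W : AgMod.{u, v} g} (f : U ⟶ W) : LCar U →ₗ[g.UEg] LCar W :=
  Submodule.mapQ (maxJ U) (maxJ W) (indMap f) fun w hw => by
    rw [maxJ_eq] at hw
    rw [Submodule.mem_comap, maxJ_eq]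
    intro x
    rw [← map_smul, indProj_indMap, hw x, map_zero]

theorem LMap_mem_LGr {U W : AgMod.{u, v} g} (f : U ⟶ W) {n : ℚ} {w : LCar U}
    (hw : w ∈ LGr U n) : LMap f w ∈ LGr W n := by
  obtain ⟨w, hw, rfl⟩ := hw
  exact ⟨_, indMap_mem_indGr f hw, rfl⟩

/-- The degree operator descends to L(U), since ω(1) and the functorial map both do, and L(U)(n)
lies in its eigenspace for n. -/
theorem iSupIndep_LGr (U : AgMod.{u, v} g) : iSupIndep (LGr U) := by
  let d : Module.End ℂ (LCar U) := Algebra.lsmul ℂ ℂ (LCar U) (g.iota (g.elem 1 conf)) -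
    (LMap (confHom U)).restrictScalars ℂ
  refine ((Module.End.eigenspaces_iSupIndep d).comp (f := fun n : ℚ => (n : ℂ))
    Rat.cast_injective).mono ?_
  rintro n _ ⟨w, hw, rfl⟩
  refine Module.End.mem_eigenspace_iff.mpr ?_
  have := congrArg (LMk U) (Module.End.mem_eigenspace_iff.mp (indGr_le_eigenspace U n hw))
  rw [map_smul, indDegOp_apply, map_sub, LMk_smul] at this
  exact this

theorem iSup_LGr (U : AgMod.{u, v} g) : ⨆ n, LGr U n = ⊤ := by
  unfold LGr
  rw [← Submodule.map_iSup, iSup_indGr, Submodule.map_top]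
  exact LinearMap.range_eq_top.mpr (LMk_surjective U)

theorem LGr_eq_bot (U : AgMod.{u, v} g) {n : ℚ} (hn : ¬ ∃ k : ℕ, n = k / g.T) : LGr U n = ⊥ := by
  rw [LGr, indGr_eq_bot U hn, Submodule.map_bot]

theorem LGr_eq_bot_of_neg (U : AgMod.{u, v} g) {n : ℚ} (hn : n < 0) : LGr U n = ⊥ := by
  rw [LGr, indGr_eq_bot_of_neg U hn, Submodule.map_bot]

theorem LProj_eq_zero (U : AgMod.{u, v} g) {n : ℚ} (hn : n ≠ 0) {w : LCar U}
    (hw : w ∈ LGr U n) : LProj U w = 0 := by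
  obtain ⟨w, hw, rfl⟩ := hw
  exact indProj_eq_zero U hn hw

theorem iota_smul_mem_LGr (U : AgMod.{u, v} g) {m n : ℚ} {y : g.Vg} (hy : y ∈ g.VgDeg m)
    {w : LCar U} (hw : w ∈ LGr U n) : g.iota y • w ∈ LGr U (m + n) := by
  obtain ⟨w, hw, rfl⟩ := hw
  exact ⟨_, iota_smul_mem_indGr U hy hw, rfl⟩

/-- The natural map from `U` to `L(U)`. -/
def LIncl (U : AgMod.{u, v} g) : U.carrier →ₗ[ℂ] LCar U := LMk U ∘ₗ indIncl U

theorem LGr_zero (U : AgMod.{u, v} g) : LGr U 0 = LinearMap.range (LIncl U) := by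
  rw [LGr, indGr_zero, LIncl, LinearMap.range_comp]

theorem LProj_LIncl (U : AgMod.{u, v} g) (z : U.carrier) : LProj U (LIncl U z) = z :=
  indProj_indIncl U z

theorem iota_smul_LIncl (U : AgMod.{u, v} g) {n : ℚ} (hn : n ≤ 0) {y : g.Vg}
    (hy : y ∈ g.VgDeg n) (z : U.carrier) :
    g.iota y • LIncl U z = LIncl U (zeroAct U y z) :=
  congrArg (LMk U) (iota_smul_indIncl U hn hy z)

theorem LProj_iota_smul (U : AgMod.{u, v} g) {n : ℚ} (hn : 0 < n) {y : g.Vg} (hy : y ∈ g.VgDeg n)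
    (w : LCar U) : LProj U (g.iota y • w) = 0 := by
  obtain ⟨w, rfl⟩ := LMk_surjective U w
  exact indProj_smul U hn hy w

theorem LMap_LIncl {U W : AgMod.{u, v} g} (f : U ⟶ W) (z : U.carrier) :
    LMap f (LIncl U z) = LIncl W (f.toLin z) := rfl

/-- A subspace of `L(U)` containing `U` and stable under `V[g]` is everything. -/
theorem LCar_eq_top (U : AgMod.{u, v} g) {S : Submodule ℂ (LCar U)}
    (hS : ∀ n, ∀ y ∈ g.VgDeg n, ∀ s ∈ S, g.iota y • s ∈ S) (h : ∀ z, LIncl U z ∈ S) (w : LCar U) :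
    w ∈ S := by
  obtain ⟨w, rfl⟩ := LMk_surjective U w
  refine Ind_induction U (p := fun w => LMk U w ∈ S) w (fun w w' h h' => ?_) fun x z => ?_
  · rw [map_add]; exact Submodule.add_mem _ h h'
  · rw [LMk_smul]
    exact smul_mem_of_iota hS x (h z)

end

end FiniteOrderAut

namespace FiniteOrderAut

noncomputable section

open VertexOperatorAlgebra Filter

variable {V : Type u} [AddCommGroup V] [Module ℂ V] [VertexOperatorAlgebra V]
variable {g : FiniteOrderAut V}

/-! ### The twisted Jacobi identity

For operators `Y q a` we compare the two sides of the twisted Jacobi identity. All three sums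
occurring in it are first cut off at a natural number `K`. -/

section Jacobi

variable {N : Type*} [AddCommGroup N] [Module ℂ N] (Y : ℚ → V →ₗ[ℂ] Module.End ℂ N)

/-- `∑_{i < K} (m choose i) (a_{n+i} b)_{m+k-i} w`. -/
def iterSum (a b : V) (m : ℚ) (n : ℤ) (k : ℚ) (K : ℕ) (w : N) : N :=
  ∑ i ∈ Finset.range K, Ring.choose (m : ℂ) i • Y (m + k - i) (mode (n + i) a b) w

/-- `∑_{i < K} (-1)^i (n choose i) a_{m+n-i} b_{k+i} w`. -/
def leftSum (a b : V) (m : ℚ) (n : ℤ) (k : ℚ) (K : ℕ) (w : N) : N :=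
  ∑ i ∈ Finset.range K, Ring.choose (n : ℂ) i • (-1 : ℂ) ^ i • Y (m + n - i) a (Y (k + i) b w)

/-- `∑_{i < K} (-1)^i (n choose i) b_{n+k-i} a_{m+i} w`. -/
def rightSum (a b : V) (m : ℚ) (n : ℤ) (k : ℚ) (K : ℕ) (w : N) : N :=
  ∑ i ∈ Finset.range K, Ring.choose (n : ℂ) i • (-1 : ℂ) ^ i • Y (n + k - i) b (Y (m + i) a w)

/-- The difference of the two sides of the twisted Jacobi identity. -/
def jac (a b : V) (m : ℚ) (n : ℤ) (k : ℚ) (w : N) : N :=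
  ∑ᶠ i : ℕ, Ring.choose (m : ℂ) i • Y (m + k - i) (mode (n + i) a b) w -
    ∑ᶠ i : ℕ, ((-1) ^ i * Ring.choose (n : ℂ) i) •
      (Y (m + n - i) a (Y (k + i) b w) - (-1 : ℂ) ^ n • Y (n + k - i) b (Y (m + i) a w))

/-- The modes of each vector eventually annihilate each vector of `N`. -/
def IsTruncated : Prop := ∀ (a : V) (w : N), ∃ K : ℚ, ∀ n ≥ K, Y n a w = 0

variable (g) in
/-- The commutator formula for the operators `Y q a`. -/
def HasCommutator : Prop := ∀ (p q : ℚ) (a b : V) (w : N), a ∈ g.eig p →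
  Y p a (Y q b w) - Y q b (Y p a w) =
    ∑ᶠ i : ℕ, Ring.choose (p : ℂ) i • Y (p + q - i) (mode (i : ℤ) a b) w

variable {Y}

theorem eventually_mode_eq_zero (a b : V) (n : ℤ) :
    ∀ᶠ K : ℕ in atTop, ∀ i : ℕ, K ≤ i → mode (n + i) a b = 0 := by
  obtain ⟨K, hK⟩ := trunc_add a b n
  exact (eventually_ge_atTop K).mono fun K' h i hi => hK i (h.trans hi)

theorem eventually_act_eq_zero (htr : IsTruncated Y) (a : V) (w : N) (k : ℚ) :
    ∀ᶠ K : ℕ in atTop, ∀ i : ℕ, K ≤ i → Y (k + i) a w = 0 := by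
  obtain ⟨K, hK⟩ := htr a w
  obtain ⟨K', hK'⟩ := exists_nat_ge (K - k)
  refine (eventually_ge_atTop K').mono fun K'' h i hi => hK _ ?_
  have : (K' : ℚ) ≤ i := by exact_mod_cast h.trans hi
  linarith

theorem eventually_jac_eq (htr : IsTruncated Y) (a b : V) (m : ℚ) (n : ℤ) (k : ℚ)
    (w : N) : ∀ᶠ K : ℕ in atTop,
    jac Y a b m n k w = iterSum Y a b m n k K w -
      (leftSum Y a b m n k K w - (-1 : ℂ) ^ n • rightSum Y a b m n k K w) := by
  filter_upwards [eventually_mode_eq_zero a b n, eventually_act_eq_zero htr b w k,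
    eventually_act_eq_zero htr a w m] with K h1 h2 h3
  rw [jac, finsum_range _ K, finsum_range _ K, iterSum, leftSum, rightSum]
  · congr 1
    rw [Finset.smul_sum, ← Finset.sum_sub_distrib]
    refine Finset.sum_congr rfl fun i _ => ?_
    rw [smul_sub, smul_comm ((-1 : ℂ) ^ n), smul_comm ((-1 : ℂ) ^ n), mul_comm, mul_smul, mul_smul]
  · intro i hi
    rw [h2 i hi, h3 i hi]
    simp
  · intro i hi
    rw [h1 i hi]
    simp

theorem jac_add (htr : IsTruncated Y) (a b : V) (m : ℚ) (n : ℤ) (k : ℚ) (w w' : N) :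
    jac Y a b m n k (w + w') = jac Y a b m n k w + jac Y a b m n k w' := by
  obtain ⟨K, h1, h2, h3⟩ := ((eventually_jac_eq htr a b m n k (w + w')).and
    ((eventually_jac_eq htr a b m n k w).and (eventually_jac_eq htr a b m n k w'))).exists
  rw [h1, h2, h3]
  simp only [iterSum, leftSum, rightSum, map_add, smul_add, Finset.sum_add_distrib]
  abel

theorem jac_smul (htr : IsTruncated Y) (a b : V) (m : ℚ) (n : ℤ) (k : ℚ) (c : ℂ) (w : N) :
    jac Y a b m n k (c • w) = c • jac Y a b m n k w := by
  obtain ⟨K, h1, h2⟩ := ((eventually_jac_eq htr a b m n k (c • w)).and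
    (eventually_jac_eq htr a b m n k w)).exists
  rw [h1, h2]
  simp only [iterSum, leftSum, rightSum, map_smul, smul_sub, Finset.smul_sum, smul_comm c]

theorem jac_add_right (htr : IsTruncated Y) (a b b' : V) (m : ℚ) (n : ℤ) (k : ℚ) (w : N) :
    jac Y a (b + b') m n k w = jac Y a b m n k w + jac Y a b' m n k w := by
  obtain ⟨K, h1, h2, h3⟩ := ((eventually_jac_eq htr a (b + b') m n k w).and
    ((eventually_jac_eq htr a b m n k w).and (eventually_jac_eq htr a b' m n k w))).exists
  rw [h1, h2, h3]
  simp only [iterSum, leftSum, rightSum, map_add, LinearMap.add_apply, smul_add,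
    Finset.sum_add_distrib]
  abel

theorem jac_add_left (htr : IsTruncated Y) (a a' b : V) (m : ℚ) (n : ℤ) (k : ℚ) (w : N) :
    jac Y (a + a') b m n k w = jac Y a b m n k w + jac Y a' b m n k w := by
  obtain ⟨K, h1, h2, h3⟩ := ((eventually_jac_eq htr (a + a') b m n k w).and
    ((eventually_jac_eq htr a b m n k w).and (eventually_jac_eq htr a' b m n k w))).exists
  rw [h1, h2, h3]
  simp only [iterSum, leftSum, rightSum, map_add, LinearMap.add_apply, smul_add,
    Finset.sum_add_distrib]
  abel

theorem jac_zero_left (b : V) (m : ℚ) (n : ℤ) (k : ℚ) (w : N) : jac Y 0 b m n k w = 0 := by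
  simp [jac]

theorem jac_zero_right (a : V) (m : ℚ) (n : ℤ) (k : ℚ) (w : N) : jac Y a 0 m n k w = 0 := by
  simp [jac]

theorem sum_choose_succ {W : Type*} [AddCommGroup W] [Module ℂ W] (x : ℂ) (K : ℕ) (f : ℕ → W) :
    ∑ i ∈ Finset.range (K + 1), Ring.choose (x + 1) i • f i =
      ∑ i ∈ Finset.range (K + 1), Ring.choose x i • f i +
        ∑ i ∈ Finset.range K, Ring.choose x i • f (i + 1) := by
  rw [Finset.sum_range_succ', Finset.sum_range_succ' _ K]
  simp only [Ring.choose_succ_succ, add_smul, Finset.sum_add_distrib, Ring.choose_zero_right]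
  abel

/-- Multiplication of the Jacobi identity by `z₁ - z₂ = z₀`. -/
theorem jac_succ (htr : IsTruncated Y) (a b : V) (m : ℚ) (n : ℤ) (k : ℚ) (w : N) :
    jac Y a b (m + 1) n k w = jac Y a b m (n + 1) k w + jac Y a b m n (k + 1) w := by
  obtain ⟨K, hmode, hb, ha, hs⟩ := ((eventually_mode_eq_zero a b n).and
    ((eventually_act_eq_zero htr b w k).and ((eventually_act_eq_zero htr a w m).and
    (eventually_forall_ge_atTop.mpr ((eventually_jac_eq htr a b (m + 1) n k w).and
      ((eventually_jac_eq htr a b m (n + 1) k w).and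
        (eventually_jac_eq htr a b m n (k + 1) w))))))).exists
  obtain ⟨h1, h2, h3⟩ := hs (K + 1) (by omega)
  rw [h1, h2, h3]
  -- Pascal's rule is used for (m + 1 choose i) in the iterate sum and for (n + 1 choose i) in the
  -- two product sums. With the cut-off K + 1, the shift of i by one loses only a vanishing last
  -- term.
  have I := sum_choose_succ (m : ℂ) K fun i => Y (m + 1 + k - i) (mode (n + i) a b) w
  have I' : iterSum Y a b m (n + 1) k (K + 1) w = ∑ i ∈ Finset.range K,
      Ring.choose (m : ℂ) i • Y (m + 1 + k - (i + 1 : ℕ)) (mode (n + (i + 1 : ℕ)) a b) w := by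
    rw [iterSum, Finset.sum_range_succ]
    have := hmode (K + 1) (by omega)
    push_cast at this ⊢
    rw [show n + 1 + (K : ℤ) = n + (K + 1) by ring, this, map_zero, LinearMap.zero_apply, smul_zero,
      add_zero]
    refine Finset.sum_congr rfl fun i _ => ?_
    rw [show n + 1 + (i : ℤ) = n + (i + 1) by ring,
      show m + 1 + k - ((i : ℚ) + 1) = m + k - i by ring]
  have I'' : iterSum Y a b m n (k + 1) (K + 1) w = ∑ i ∈ Finset.range (K + 1),
      Ring.choose (m : ℂ) i • Y (m + 1 + k - i) (mode (n + i) a b) w := by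
    refine Finset.sum_congr rfl fun i _ => ?_
    rw [show m + (k + 1) - (i : ℚ) = m + 1 + k - i by ring]
  have A := sum_choose_succ (n : ℂ) K fun i => (-1 : ℂ) ^ i • Y (m + 1 + n - i) a (Y (k + i) b w)
  have A' : leftSum Y a b m n (k + 1) (K + 1) w = -∑ i ∈ Finset.range K, Ring.choose (n : ℂ) i •
      (-1 : ℂ) ^ (i + 1) • Y (m + 1 + n - (i + 1 : ℕ)) a (Y (k + (i + 1 : ℕ)) b w) := by
    rw [leftSum, Finset.sum_range_succ]
    have := hb (K + 1) (by omega)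
    push_cast at this ⊢
    rw [show k + 1 + (K : ℚ) = k + (K + 1) by ring, this, map_zero, smul_zero, smul_zero, add_zero,
      ← Finset.sum_neg_distrib]
    refine Finset.sum_congr rfl fun i _ => ?_
    rw [show k + 1 + (i : ℚ) = k + (i + 1) by ring,
      show m + 1 + n - ((i : ℚ) + 1) = m + n - i by ring, pow_succ, mul_neg_one, neg_smul, smul_neg,
      neg_neg]
  have A'' : leftSum Y a b m (n + 1) k (K + 1) w = ∑ i ∈ Finset.range (K + 1),
      Ring.choose ((n : ℂ) + 1) i • (-1 : ℂ) ^ i • Y (m + 1 + n - i) a (Y (k + i) b w) := by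
    refine Finset.sum_congr rfl fun i _ => ?_
    push_cast
    rw [show m + ((n : ℚ) + 1) - i = m + 1 + n - i by ring]
  have B := sum_choose_succ (n : ℂ) K fun i => (-1 : ℂ) ^ i • Y (n + 1 + k - i) b (Y (m + i) a w)
  have B' : rightSum Y a b (m + 1) n k (K + 1) w = -∑ i ∈ Finset.range K, Ring.choose (n : ℂ) i •
      (-1 : ℂ) ^ (i + 1) • Y (n + 1 + k - (i + 1 : ℕ)) b (Y (m + (i + 1 : ℕ)) a w) := by
    rw [rightSum, Finset.sum_range_succ]
    have := ha (K + 1) (by omega)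
    push_cast at this ⊢
    rw [show m + 1 + (K : ℚ) = m + (K + 1) by ring, this, map_zero, smul_zero, smul_zero, add_zero,
      ← Finset.sum_neg_distrib]
    refine Finset.sum_congr rfl fun i _ => ?_
    rw [show m + 1 + (i : ℚ) = m + (i + 1) by ring,
      show n + 1 + k - ((i : ℚ) + 1) = n + k - i by ring, pow_succ, mul_neg_one, neg_smul, smul_neg,
      neg_neg]
  have B'' : rightSum Y a b m (n + 1) k (K + 1) w = ∑ i ∈ Finset.range (K + 1),
      Ring.choose ((n : ℂ) + 1) i • (-1 : ℂ) ^ i • Y (n + 1 + k - i) b (Y (m + i) a w) := by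
    refine Finset.sum_congr rfl fun i _ => ?_
    push_cast
    rfl
  have B3 : rightSum Y a b m n (k + 1) (K + 1) w = ∑ i ∈ Finset.range (K + 1),
      Ring.choose (n : ℂ) i • (-1 : ℂ) ^ i • Y (n + 1 + k - i) b (Y (m + i) a w) := by
    refine Finset.sum_congr rfl fun i _ => ?_
    rw [show n + (k + 1) - (i : ℚ) = n + 1 + k - i by ring]
  have I3 : iterSum Y a b (m + 1) n k (K + 1) w = ∑ i ∈ Finset.range (K + 1),
      Ring.choose ((m : ℂ) + 1) i • Y (m + 1 + k - i) (mode (n + i) a b) w := by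
    refine Finset.sum_congr rfl fun i _ => ?_
    push_cast
    rfl
  have A3 : leftSum Y a b (m + 1) n k (K + 1) w = ∑ i ∈ Finset.range (K + 1),
      Ring.choose (n : ℂ) i • (-1 : ℂ) ^ i • Y (m + 1 + n - i) a (Y (k + i) b w) := rfl
  rw [I3, I', I'', A3, A', A'', B', B'', B3, I, A, B, zpow_add_one₀ (by norm_num)]
  simp only [mul_neg_one, neg_smul, smul_add, smul_neg]
  abel

theorem comm_eq_sum (hcomm : HasCommutator g Y) {p : ℚ} (q : ℚ) {a : V} (b : V) (w : N)
    (ha : a ∈ g.eig p) {L : ℕ}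
    (hL : ∀ i : ℕ, L ≤ i → mode (i : ℤ) a b = 0) : Y p a (Y q b w) = Y q b (Y p a w) +
      ∑ i ∈ Finset.range L, Ring.choose (p : ℂ) i • Y (p + q - i) (mode (i : ℤ) a b) w := by
  rw [← sub_eq_iff_eq_add', hcomm p q a b w ha, finsum_range _ L]
  intro i hi
  rw [hL i hi]
  simp

/-- For n = 0 only i = 0 survives on the right, and the identity is the commutator formula. -/
theorem jac_zero (hcomm : HasCommutator g Y) (m k : ℚ) {a : V} (b : V) (w : N) (ha : a ∈ g.eig m) :
    jac Y a b m 0 k w = 0 := by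
  have h := hcomm m k a b w ha
  rw [jac, finsum_range (fun i : ℕ => ((-1) ^ i * _) • (_ : N)) 1]
  · simp only [zero_add, Finset.sum_range_one]
    rw [← h]
    simp
  · intro i hi
    rw [Int.cast_zero, Ring.choose_zero_pos _ (by omega)]
    simp

/-- By `jac_succ`, the value at (m, n + 1, k) is the value at (m + 1, n, k) minus that at (m, n, k +
1). -/
theorem jac_natCast (htr : IsTruncated Y) (hcomm : HasCommutator g Y) (n : ℕ) (m k : ℚ) {a : V}
    (b : V) (w : N) (ha : a ∈ g.eig m) :
    jac Y a b m n k w = 0 := by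
  induction n generalizing m k with
  | zero => exact jac_zero hcomm m k b w ha
  | succ n ih =>
    have h := jac_succ htr a b m n k w
    rw [ih m _ ha, ih (m + 1) _ (by simpa using mem_eig_add_int ha 1), add_zero] at h
    push_cast
    exact h.symm

/-! ### Commutators of c_p with the Jacobi operators -/

section Ad

variable {p : ℚ} {c a b : V} {L : ℕ}

/-- The commutator formula is applied as c_p passes a and then b. The shift p - j goes into m or k,
while n stays fixed. -/
theorem leftSum_ad (hcomm : HasCommutator g Y) (hc : c ∈ g.eig p)
    (hL : ∀ j : ℕ, L ≤ j → mode (j : ℤ) c a = 0) (hL' : ∀ j : ℕ, L ≤ j → mode (j : ℤ) c b = 0)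
    (m : ℚ) (n : ℤ) (k : ℚ) (K : ℕ) (w : N) :
    Y p c (leftSum Y a b m n k K w) = leftSum Y a b m n k K (Y p c w) +
      ∑ j ∈ Finset.range L, Ring.choose (p : ℂ) j •
        (leftSum Y (mode (j : ℤ) c a) b (m + p - j) n k K w +
          leftSum Y a (mode (j : ℤ) c b) m n (k + p - j) K w) := by
  simp only [leftSum, map_sum, ← Finset.sum_add_distrib, Finset.smul_sum]
  rw [Finset.sum_comm (s := Finset.range L), ← Finset.sum_add_distrib]
  refine Finset.sum_congr rfl fun i _ => ?_
  rw [map_smul, map_smul, comm_eq_sum hcomm _ a _ hc hL, comm_eq_sum hcomm _ b _ hc hL', map_add,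
    map_sum, smul_add, smul_add, smul_add, smul_add, Finset.smul_sum, Finset.smul_sum,
    Finset.smul_sum, Finset.smul_sum, add_assoc, ← Finset.sum_add_distrib]
  congr 1
  refine Finset.sum_congr rfl fun j _ => ?_
  rw [map_smul, smul_add, smul_comm (Ring.choose (p : ℂ) j), smul_comm (Ring.choose (p : ℂ) j),
    smul_comm (Ring.choose (p : ℂ) j), smul_comm (Ring.choose (p : ℂ) j), add_comm]
  congr 5
  · congr 2
    ring
  · congr 3
    ring

theorem rightSum_ad (hcomm : HasCommutator g Y) (hc : c ∈ g.eig p)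
    (hL : ∀ j : ℕ, L ≤ j → mode (j : ℤ) c a = 0) (hL' : ∀ j : ℕ, L ≤ j → mode (j : ℤ) c b = 0)
    (m : ℚ) (n : ℤ) (k : ℚ) (K : ℕ) (w : N) :
    Y p c (rightSum Y a b m n k K w) = rightSum Y a b m n k K (Y p c w) +
      ∑ j ∈ Finset.range L, Ring.choose (p : ℂ) j •
        (rightSum Y (mode (j : ℤ) c a) b (m + p - j) n k K w +
          rightSum Y a (mode (j : ℤ) c b) m n (k + p - j) K w) := by
  simp only [rightSum, map_sum, ← Finset.sum_add_distrib, Finset.smul_sum]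
  rw [Finset.sum_comm (s := Finset.range L), ← Finset.sum_add_distrib]
  refine Finset.sum_congr rfl fun i _ => ?_
  rw [map_smul, map_smul, comm_eq_sum hcomm _ b _ hc hL', comm_eq_sum hcomm _ a _ hc hL, map_add,
    map_sum, smul_add, smul_add, smul_add, smul_add, Finset.smul_sum, Finset.smul_sum,
    Finset.smul_sum, Finset.smul_sum, add_assoc, ← Finset.sum_add_distrib]
  congr 1
  refine Finset.sum_congr rfl fun j _ => ?_
  rw [map_smul, smul_add, smul_comm (Ring.choose (p : ℂ) j), smul_comm (Ring.choose (p : ℂ) j),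
    smul_comm (Ring.choose (p : ℂ) j), smul_comm (Ring.choose (p : ℂ) j)]
  congr 5
  · congr 3
    ring
  · congr 2
    ring

/-- After c_p has passed (a_{n+i} b)_{m+k-i}, the vectors c_l (a_{n+i} b) are expanded by the
commutator formula in V. Terms containing c_l b already have the required form; those containing c_j
a are resummed with `choose_jacobi`. -/
theorem iterSum_ad (hcomm : HasCommutator g Y) (hc : c ∈ g.eig p)
    (hL : ∀ j : ℕ, L ≤ j → mode (j : ℤ) c a = 0) (hL' : ∀ j : ℕ, L ≤ j → mode (j : ℤ) c b = 0)
    (m : ℚ) (n : ℤ) (k : ℚ) (K : ℕ)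
    (hK : ∀ j < L, ∀ e : ℕ, K ≤ e → mode (n + e) (mode (j : ℤ) c a) b = 0) (w : N) :
    Y p c (iterSum Y a b m n k K w) = iterSum Y a b m n k K (Y p c w) +
      ∑ j ∈ Finset.range L, Ring.choose (p : ℂ) j •
        (iterSum Y (mode (j : ℤ) c a) b (m + p - j) n k K w +
          iterSum Y a (mode (j : ℤ) c b) m n (k + p - j) K w) := by
  -- R cuts off the sums over l. It is at least L + K so that no term is lost when they are
  -- reindexed by l ↦ j + l.
  obtain ⟨R, hR, hLR⟩ : ∃ R, (∀ i < K, ∀ l : ℕ, R ≤ l → mode (l : ℤ) c (mode (n + i) a b) = 0) ∧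
      L + K ≤ R := by
    have h : ∀ᶠ R : ℕ in atTop, ∀ i ∈ Finset.range K, ∀ l : ℕ, R ≤ l →
        mode (l : ℤ) c (mode (n + i) a b) = 0 := by
      rw [Filter.eventually_all_finset]
      intro i _
      simpa using eventually_mode_eq_zero c (mode (n + i) a b) 0
    obtain ⟨R, h1, h2⟩ := (h.and (eventually_ge_atTop (L + K))).exists
    exact ⟨R, fun i hi => h1 i (Finset.mem_range.mpr hi), h2⟩
  have expand : ∀ i l : ℕ, mode (l : ℤ) c (mode (n + i) a b) = mode (n + i) a (mode (l : ℤ) c b) +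
      ∑ j ∈ Finset.range L, (l.choose j : ℂ) • mode (l + (n + i) - j) (mode (j : ℤ) c a) b := by
    intro i l
    rw [← sub_eq_iff_eq_add', VertexOperatorAlgebra.commutator, finsum_range _ L]
    · simp only [Int.cast_natCast, Ring.choose_natCast]
    · intro j hj
      rw [hL j hj]
      simp
  have e1 : Y p c (iterSum Y a b m n k K w) = iterSum Y a b m n k K (Y p c w) +
      ∑ i ∈ Finset.range K, ∑ l ∈ Finset.range R, (Ring.choose (m : ℂ) i * Ring.choose (p : ℂ) l) •
        Y (p + (m + k - i) - l) (mode (l : ℤ) c (mode (n + i) a b)) w := by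
    simp only [iterSum, map_sum]
    rw [← Finset.sum_add_distrib]
    refine Finset.sum_congr rfl fun i hi => ?_
    rw [map_smul, comm_eq_sum hcomm _ _ _ hc (hR i (Finset.mem_range.mp hi)), smul_add,
      Finset.smul_sum]
    simp only [smul_smul]
  rw [e1]
  congr 1
  simp only [expand, map_add, map_sum, map_smul, LinearMap.add_apply, LinearMap.sum_apply,
    LinearMap.smul_apply, smul_add, Finset.sum_add_distrib, Finset.smul_sum]
  rw [add_comm]
  congr 1
  · rw [Finset.sum_comm]
    rw [Finset.sum_congr rfl fun l _ => Finset.sum_comm, Finset.sum_comm]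
    refine Finset.sum_congr rfl fun j hj => ?_
    have hj' := Finset.mem_range.mp hj
    -- The operator in each term depends on l and i only through e = l - j + i.
    let Z : ℕ → N := fun e => Y (m + p + k - j - e) (mode (n + e) (mode (j : ℤ) c a) b) w
    have hZ : ∀ e, K ≤ e → Z e = 0 := fun e he => by
      simp only [Z, hK j hj' e he, map_zero, LinearMap.zero_apply]
    have S := sum_antidiag K (fun l i => Ring.choose (p : ℂ) (j + l) * (j + l).choose j *
      Ring.choose (m : ℂ) i) Z hZ
    simp only [choose_jacobi] at S
    have RHS : Ring.choose (p : ℂ) j • iterSum Y (mode (j : ℤ) c a) b (m + p - j) n k K w =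
        ∑ l ∈ Finset.range K, (Ring.choose (p : ℂ) j * Ring.choose ((p : ℂ) + m - j) l) • Z l := by
      rw [iterSum, Finset.smul_sum]
      refine Finset.sum_congr rfl fun l _ => ?_
      rw [smul_smul, show m + p - j + k - (l : ℚ) = m + p + k - j - l by ring]
      congr 2
      push_cast
      ring_nf
    rw [RHS, ← S]
    -- Terms with l < j vanish through (l choose j), and those with l ≥ j + K because then e ≥ K.
    have split : ∀ f : ℕ → N, (∀ l, l < j → f l = 0) → (∀ l, j + K ≤ l → f l = 0) →
        ∑ l ∈ Finset.range R, f l = ∑ l ∈ Finset.range K, f (j + l) := by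
      intro f h1 h2
      rw [← Finset.sum_subset (Finset.range_subset_range.mpr (by omega : j + K ≤ R))
        (fun l _ hl => h2 l (by simpa using hl)), Finset.sum_range_add,
        Finset.sum_eq_zero fun l hl => h1 l (Finset.mem_range.mp hl), zero_add]
    rw [split]
    · refine Finset.sum_congr rfl fun l _ => Finset.sum_congr rfl fun i _ => ?_
      simp only [Z]
      rw [smul_smul, show ((j + l : ℕ) : ℤ) + (n + i) - j = n + ((l + i : ℕ) : ℤ) by push_cast; ring,
        show p + (m + k - i) - ((j + l : ℕ) : ℚ) = m + p + k - j - ((l + i : ℕ) : ℚ) by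
          push_cast; ring]
      congr 1
      ring
    · intro l hl
      refine Finset.sum_eq_zero fun i _ => ?_
      rw [Nat.choose_eq_zero_of_lt hl]
      simp
    · intro l hl
      refine Finset.sum_eq_zero fun i _ => ?_
      have := hK j hj' (l + i - j) (by omega)
      rw [show (l : ℤ) + (n + i) - j = n + ((l + i - j : ℕ) : ℤ) by omega, this]
      simp
  · rw [Finset.sum_comm, ← Finset.sum_subset (Finset.range_subset_range.mpr (by omega : L ≤ R))]
    · refine Finset.sum_congr rfl fun l _ => ?_
      rw [iterSum, Finset.smul_sum]
      refine Finset.sum_congr rfl fun i _ => ?_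
      rw [smul_smul, mul_comm, show p + (m + k - i) - (l : ℚ) = m + (k + p - l) - i by ring]
    · intro l _ hl
      refine Finset.sum_eq_zero fun i _ => ?_
      rw [hL' l (by simpa using hl)]
      simp

/-- The operators `jac a b m n k` are stable under commutators with the `c_p`. -/
theorem jac_ad (htr : IsTruncated Y) (hcomm : HasCommutator g Y)
    (hc : c ∈ g.eig p)
    (hL : ∀ j : ℕ, L ≤ j → mode (j : ℤ) c a = 0) (hL' : ∀ j : ℕ, L ≤ j → mode (j : ℤ) c b = 0)
    (m : ℚ) (n : ℤ) (k : ℚ) (w : N) :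
    Y p c (jac Y a b m n k w) = jac Y a b m n k (Y p c w) +
      ∑ j ∈ Finset.range L, Ring.choose (p : ℂ) j •
        (jac Y (mode (j : ℤ) c a) b (m + p - j) n k w +
          jac Y a (mode (j : ℤ) c b) m n (k + p - j) w) := by
  have hA : ∀ᶠ K : ℕ in atTop, ∀ j ∈ Finset.range L, ∀ e : ℕ, K ≤ e →
      mode (n + e) (mode (j : ℤ) c a) b = 0 := by
    rw [Filter.eventually_all_finset]
    exact fun j _ => eventually_mode_eq_zero _ _ _
  have hB := (Filter.eventually_all_finset (Finset.range L)).mpr fun j _ =>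
    (eventually_jac_eq htr (mode (j : ℤ) c a) b (m + p - j) n k w).and
      (eventually_jac_eq htr a (mode (j : ℤ) c b) m n (k + p - j) w)
  obtain ⟨K, h1, h2, h3, h4⟩ := (hA.and (hB.and ((eventually_jac_eq htr a b m n k w).and
    (eventually_jac_eq htr a b m n k (Y p c w))))).exists
  rw [Finset.sum_congr rfl fun j hj => by rw [(h2 j hj).1, (h2 j hj).2], h3, h4, map_sub, map_sub,
    map_smul, leftSum_ad hcomm hc hL hL', rightSum_ad hcomm hc hL hL',
    iterSum_ad hcomm hc hL hL' m n k K fun j hj => h1 j (Finset.mem_range.mpr hj)]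
  simp only [smul_add, smul_sub, Finset.sum_add_distrib, Finset.sum_sub_distrib, Finset.smul_sum,
    smul_comm ((-1 : ℂ) ^ n)]
  abel

end Ad

end Jacobi

end

end FiniteOrderAut

namespace FiniteOrderAut

noncomputable section

open VertexOperatorAlgebra

variable {V : Type u} [AddCommGroup V] [Module ℂ V] [VertexOperatorAlgebra V]
variable {g : FiniteOrderAut V}

/-! ### `L(U)` is an admissible module -/

theorem LY_apply (U : AgMod.{u, v} g) (q : ℚ) (a : V) (w : LCar U) :
    LY U q a w = g.iota (g.elem q a) • w := rfl

theorem LY_mem_LGr (U : AgMod.{u, v} g) {w : ℤ} {a : V} (ha : a ∈ wtSpace V w) (m : ℚ) {n : ℚ}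
    {x : LCar U} (hx : x ∈ LGr U n) : LY U m a x ∈ LGr U (n + w - m - 1) := by
  rw [LY_apply, show n + w - m - 1 = ((w : ℚ) - m - 1) + n by ring]
  exact iota_smul_mem_LGr U (elem_mem_VgDeg ha m) hx

/-- L(U) has no negative degrees, and a_n lowers the degree more as n grows. -/
theorem LY_trunc (U : AgMod.{u, v} g) : IsTruncated (LY U) := by
  intro a w
  induction a using wt_induction with
  | zero => exact ⟨0, by simp⟩
  | add a b ha hb =>
    obtain ⟨K, hK⟩ := ha
    obtain ⟨K', hK'⟩ := hb
    refine ⟨max K K', fun n hn => ?_⟩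
    rw [map_add, LinearMap.add_apply, hK n ((le_max_left _ _).trans hn),
      hK' n ((le_max_right _ _).trans hn), add_zero]
  | hom d a ha =>
    have hw : w ∈ ⨆ n, LGr U n := by rw [iSup_LGr]; trivial
    induction hw using Submodule.iSup_induction' with
    | zero => exact ⟨0, by simp⟩
    | add x y _ _ hx hy =>
      obtain ⟨K, hK⟩ := hx
      obtain ⟨K', hK'⟩ := hy
      refine ⟨max K K', fun n hn => ?_⟩
      rw [map_add, hK n ((le_max_left _ _).trans hn), hK' n ((le_max_right _ _).trans hn), add_zero]
    | mem m x hx =>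
      refine ⟨m + d, fun n hn => ?_⟩
      have := LY_mem_LGr U ha n hx
      rwa [LGr_eq_bot_of_neg U (by linarith), Submodule.mem_bot] at this

theorem LY_comm (U : AgMod.{u, v} g) : HasCommutator g (LY U) := by
  intro p q a b w ha
  obtain ⟨N, hN⟩ := trunc_nat a b
  rw [finsum_range _ N]
  · rw [LY_apply, LY_apply, iota_smul_comm, lie_elem q ha b hN, LY_apply, LY_apply,
      add_sub_cancel_right, map_sum, Finset.sum_smul]
    refine Finset.sum_congr rfl fun i _ => ?_
    rw [map_smul, smul_assoc, LY_apply]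
  · intro i hi
    rw [hN i hi]
    simp

/-- No condition a ∈ V^0 is needed: a(wt a - 1) and the class of a modulo O_g(V) both see only the
component of a in V^0. -/
theorem LY_LIncl (U : AgMod.{u, v} g) {w : ℤ} {a : V} (ha : a ∈ wtSpace V w) (z : U.carrier) :
    LY U ((w : ℚ) - 1) a (LIncl U z) = LIncl U (U.rho (g.Og.mkQ a) z) := by
  have hp : g.elem ((w : ℚ) - 1) a = g.elem ((w : ℚ) - 1) (g.proj 0 a) := by
    have h := proj_mode (g := g) 0 (p := (w : ℚ) - 1) (a := vac) (by
      simpa using mem_eig_add_int (g := g) vac_mem_eig (w - 1)) (-1) a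
    rw [vac_mode, vac_mode, if_pos rfl, if_pos rfl, add_zero] at h
    rw [← elem_proj, h]
  have hd : g.elem ((w : ℚ) - 1) (g.proj 0 a) ∈ g.VgDeg 0 := by
    convert elem_mem_VgDeg (g := g) (g.proj_mem_wtSpace ha 0) ((w : ℚ) - 1) using 2
    ring
  rw [LY_apply, hp, iota_smul_LIncl U le_rfl hd, ← rho_eq_zeroAct U (g.proj_mem_wtSpace ha 0)
    (g.proj_mem 0 a), mkQ_proj]

theorem LY_LIncl_eq_zero (U : AgMod.{u, v} g) {w : ℤ} {a : V} (ha : a ∈ wtSpace V w) {q : ℚ}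
    (hq : (w : ℚ) - q - 1 < 0) (z : U.carrier) : LY U q a (LIncl U z) = 0 := by
  rw [LY_apply, iota_smul_LIncl U hq.le (elem_mem_VgDeg ha q),
    zeroAct_eq_zero U hq.ne (elem_mem_VgDeg ha q), LinearMap.zero_apply, map_zero]

/-! ### The Jacobi identity on the image of U -/

theorem jac_mem_LGr (U : AgMod.{u, v} g) {p q : ℤ} {a b : V} (ha : a ∈ wtSpace V p)
    (hb : b ∈ wtSpace V q) (m : ℚ) (n : ℤ) (k : ℚ) {d : ℚ} {w : LCar U} (hw : w ∈ LGr U d) :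
    jac (LY U) a b m n k w ∈ LGr U (d + p + q - n - m - k - 2) := by
  obtain ⟨K, hK⟩ := (eventually_jac_eq (LY_trunc U) a b m n k w).exists
  rw [hK]
  refine Submodule.sub_mem _ (Submodule.sum_mem _ fun i _ => Submodule.smul_mem _ _ ?_)
    (Submodule.sub_mem _ (Submodule.sum_mem _ fun i _ =>
      Submodule.smul_mem _ _ (Submodule.smul_mem _ _ ?_)) (Submodule.smul_mem _ _
        (Submodule.sum_mem _ fun i _ => Submodule.smul_mem _ _ (Submodule.smul_mem _ _ ?_))))
  · convert LY_mem_LGr U (mode_mem_wtSpace ha hb (n + i)) (m + k - i) hw using 2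
    push_cast
    ring
  · convert LY_mem_LGr U ha (m + n - i) (LY_mem_LGr U hb (k + i) hw) using 2
    ring
  · convert LY_mem_LGr U hb (n + k - i) (LY_mem_LGr U ha (m + i) hw) using 2
    ring

/-- By `hd` the total degree is 0, so every operator in the sum is a mode of index wt - 1 and acts
through A_g(V). -/
theorem iterSum_LIncl (U : AgMod.{u, v} g) {p q : ℤ} {a b : V} (ha : a ∈ wtSpace V p)
    (hb : b ∈ wtSpace V q) (m : ℚ) (n : ℤ) (k : ℚ) (hd : (p : ℚ) + q - n - m - k - 2 = 0) {K : ℕ}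
    (hK : ∀ i : ℕ, K ≤ i → mode (n + i) a b = 0) (z : U.carrier) :
    iterSum (LY U) a b m n k K (LIncl U z) = LIncl U (U.rho (g.Og.mkQ (res (m : ℂ) n a b)) z) := by
  rw [res_eq_sum _ _ _ _ hK, iterSum]
  simp only [map_sum, map_smul, LinearMap.sum_apply, LinearMap.smul_apply]
  refine Finset.sum_congr rfl fun i _ => ?_
  rw [← LY_LIncl U (mode_mem_wtSpace ha hb (n + i))]
  congr 4
  push_cast
  linarith

/-- The twisted Jacobi identity on lowest weight vectors in degree `0`, for one choice of `m`. -/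
theorem LProj_jac_base (U : AgMod.{u, v} g) {p q : ℤ} {a b : V} {r : ℕ} (hr : r < g.T)
    (ha : a ∈ wtSpace V p) (ha' : a ∈ g.eig (r / g.T)) (hb : b ∈ wtSpace V q) {n : ℤ} (hn : n < 0)
    (k : ℚ) (z : U.carrier) :
    LProj U (jac (LY U) a b ((p : ℚ) - 1 + delta r + r / g.T) n k (LIncl U z)) = 0 := by
  have hz : LIncl U z ∈ LGr U 0 := by rw [LGr_zero]; exact ⟨z, rfl⟩
  -- This is the smallest m in r/T + ℤ for which all a_{m+i}, i ≥ 0, have negative degree and so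
  -- kill U; the right sum then vanishes.
  set m : ℚ := (p : ℚ) - 1 + delta r + r / g.T with hm
  by_cases hd : (p : ℚ) + q - n - m - k - 2 = 0
  swap
  · exact LProj_eq_zero U (fun h => hd (by linarith)) (jac_mem_LGr U ha hb m n k hz)
  have hT : (0 : ℚ) < g.T := by exact_mod_cast g.T_pos
  have hrT : (r / g.T : ℚ) < 1 := by rw [div_lt_one hT]; exact_mod_cast hr
  have hr0 : (0 : ℚ) ≤ r / g.T := by positivity
  have hpos : (0 : ℚ) < (r / g.T : ℚ) + delta r := by
    unfold delta
    split_ifs with h0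
    · simp [h0]
    · have : (0 : ℚ) < r := by exact_mod_cast Nat.pos_of_ne_zero h0
      simp only [Nat.cast_zero, add_zero]
      positivity
  have hmC : (m : ℂ) = (p : ℂ) - 1 + delta r + r / g.T := by rw [hm]; push_cast; rfl
  obtain ⟨K, ⟨hK, hmode⟩, hK1⟩ := (((eventually_jac_eq (LY_trunc U) a b m n k (LIncl U z)).and
    (eventually_mode_eq_zero a b n)).and (Filter.eventually_ge_atTop 1)).exists
  have hright : rightSum (LY U) a b m n k K (LIncl U z) = 0 := by
    refine Finset.sum_eq_zero fun i _ => ?_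
    have hi : (0 : ℚ) ≤ i := by positivity
    rw [LY_LIncl_eq_zero U ha (by linarith)]
    simp
  rw [hK, hright, smul_zero, sub_zero, iterSum_LIncl U ha hb m n k hd hmode]
  -- By `hd`, b_{k+i} has degree n + δ_r + r/T - i. If n ≤ -1 - δ_r this is negative, so the left
  -- sum vanishes, and the iterate sum comes from an element of O_g(V).
  by_cases hn' : n + 1 + delta r ≤ 0
  · have hleft : leftSum (LY U) a b m n k K (LIncl U z) = 0 := by
      refine Finset.sum_eq_zero fun i _ => ?_
      have hi : (0 : ℚ) ≤ i := by positivity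
      have hnQ : (n : ℚ) + 1 + delta r ≤ 0 := by exact_mod_cast hn'
      rw [LY_LIncl_eq_zero U hb (by linarith)]
      simp
    obtain ⟨j, hj⟩ : ∃ j : ℕ, n = -1 - delta r - j := ⟨(-1 - delta r - n).toNat, by omega⟩
    have hO := res_mem_Og b hr ha ha' j
    rw [← hmC, ← hj, ← Submodule.Quotient.mk_eq_zero, ← Submodule.mkQ_apply] at hO
    rw [hleft, hO]
    simp
  -- The remaining case is r = 0, n = -1, where the identity says that a *_g b acts as a followed
  -- after b.
  · have hr1 : r = 0 := by
      by_contra h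
      simp only [delta, if_neg h] at hn'
      omega
    subst hr1
    have hn1 : n = -1 := by
      simp only [delta, if_true] at hn'
      omega
    subst hn1
    simp only [delta, if_true, Nat.cast_one, Nat.cast_zero, zero_div, add_zero,
      sub_add_cancel] at hm hmC
    have hk : k = (q : ℚ) - 1 := by
      push_cast at hd
      linarith
    have ha0 : a ∈ g.eig 0 := by simpa using ha'
    have hleft : leftSum (LY U) a b m (-1) k K (LIncl U z) =
        LIncl U (U.rho (g.Og.mkQ a) (U.rho (g.Og.mkQ b) z)) := by
      rw [leftSum, Finset.sum_eq_single_of_mem 0 (Finset.mem_range.mpr (by omega))]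
      · rw [hk, hm]
        simp only [Nat.cast_zero, add_zero, pow_zero, Ring.choose_zero_right, one_smul, sub_zero]
        rw [LY_LIncl U hb, Int.cast_neg, Int.cast_one, ← sub_eq_add_neg, LY_LIncl U ha]
      · intro i _ hi
        have hi' : (1 : ℚ) ≤ i := by exact_mod_cast Nat.one_le_iff_ne_zero.mpr hi
        rw [LY_LIncl_eq_zero U hb (by linarith)]
        simp
    rw [hleft, hmC, ← star_apply b ha ha0, U.rho_mul, Module.End.mul_apply, sub_self, map_zero]

/-- Descending induction on n, starting from n ≥ 0. Once n + 1 is known, `jac_succ` shows that (m +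
1, k) and (m, k + 1) give the same value, so m can be moved to the one in `LProj_jac_base`, where k
is arbitrary. -/
theorem LProj_jac_homogeneous (U : AgMod.{u, v} g) {p q : ℤ} {a b : V} {r : ℕ} (hr : r < g.T)
    (ha : a ∈ wtSpace V p) (ha' : a ∈ g.eig (r / g.T)) (hb : b ∈ wtSpace V q) (n : ℤ) (j : ℤ)
    (k : ℚ) (z : U.carrier) :
    LProj U (jac (LY U) a b ((p : ℚ) - 1 + delta r + r / g.T + j) n k (LIncl U z)) = 0 := by
  set μ : ℚ := (p : ℚ) - 1 + delta r + r / g.T with hμ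
  have hμ' : ∀ j : ℤ, a ∈ g.eig (μ + j) := fun j => by
    have := mem_eig_add_int ha' (p - 1 + delta r + j)
    push_cast at this
    rwa [show (r / g.T : ℚ) + (p - 1 + delta r + j) = μ + j by rw [hμ]; ring] at this
  have hnonneg : ∀ n : ℕ, ∀ (j : ℤ) (k : ℚ),
      LProj U (jac (LY U) a b (μ + j) n k (LIncl U z)) = 0 := fun n j k => by
    rw [jac_natCast (LY_trunc U) (LY_comm U) n _ k b _ (hμ' j), map_zero]
  have step : ∀ n : ℤ, n < 0 → (∀ (j : ℤ) (k : ℚ),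
      LProj U (jac (LY U) a b (μ + j) (n + 1) k (LIncl U z)) = 0) → ∀ (j : ℤ) (k : ℚ),
      LProj U (jac (LY U) a b (μ + j) n k (LIncl U z)) = 0 := by
    intro n hn ih j
    have shift : ∀ (j : ℤ) (k : ℚ), LProj U (jac (LY U) a b (μ + (j + 1 : ℤ)) n k (LIncl U z)) =
        LProj U (jac (LY U) a b (μ + j) n (k + 1) (LIncl U z)) := by
      intro j k
      have := congrArg (LProj U) (jac_succ (LY_trunc U) a b (μ + j) n k (LIncl U z))
      rw [map_add, ih, zero_add] at this
      rw [← this, Int.cast_add, Int.cast_one, ← add_assoc μ]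
    induction j using Int.induction_on with
    | zero =>
      intro k
      simpa using LProj_jac_base U hr ha ha' hb hn k z
    | succ j hj =>
      intro k
      rw [shift, hj]
    | pred j hj =>
      intro k
      have h := shift (-j - 1) (k - 1)
      rw [sub_add_cancel, sub_add_cancel] at h
      rw [← h, hj]
  have hneg : ∀ t : ℕ, ∀ (j : ℤ) (k : ℚ),
      LProj U (jac (LY U) a b (μ + j) (-t) k (LIncl U z)) = 0 := by
    intro t
    induction t with
    | zero => simpa using hnonneg 0
    | succ t ih =>
      refine step _ (by push_cast; omega) ?_
      rw [show -((t + 1 : ℕ) : ℤ) + 1 = -t by push_cast; ring]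
      exact ih
  obtain ⟨t, rfl | rfl⟩ := Int.eq_nat_or_neg n
  · exact hnonneg t j k
  · exact hneg t j k

theorem exists_rat_of_mem_eig {m : ℚ} {a : V} (ha : a ∈ g.eig m) (h0 : a ≠ 0) :
    ∃ r < g.T, ∃ j : ℤ, m = r / g.T + j := by
  have h : ∃ k : ℤ, m = k / g.T := by
    by_contra h
    apply h0
    rw [← g.proj_apply ha, proj, if_neg h]
    rfl
  obtain ⟨k, rfl⟩ := h
  have hT : (g.T : ℤ) ≠ 0 := by exact_mod_cast g.T_pos.ne'
  have hT' : (g.T : ℚ) ≠ 0 := by exact_mod_cast g.T_pos.ne'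
  have h1 := Int.emod_nonneg k hT
  have h2 := Int.emod_lt_of_pos k (by exact_mod_cast g.T_pos : (0 : ℤ) < g.T)
  refine ⟨(k % g.T).toNat, by omega, k / g.T, ?_⟩
  have h3 : (((k % g.T).toNat : ℤ) : ℚ) = ((k % g.T : ℤ) : ℚ) := by
    rw [Int.toNat_of_nonneg h1]
  have h4 : (k : ℚ) = ((k % g.T : ℤ) : ℚ) + g.T * ((k / g.T : ℤ) : ℚ) := by
    exact_mod_cast (Int.emod_add_mul_ediv k g.T).symm
  rw [Int.cast_natCast] at h3
  rw [h3]
  field_simp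
  exact h4

theorem LProj_jac (U : AgMod.{u, v} g) {m : ℚ} {a : V} (ha : a ∈ g.eig m) (b : V) (n : ℤ) (k : ℚ)
    (z : U.carrier) : LProj U (jac (LY U) a b m n k (LIncl U z)) = 0 := by
  rw [← g.proj_apply ha]
  clear ha
  induction a using wt_induction with
  | zero => rw [map_zero, jac_zero_left, map_zero]
  | add a a' h h' => rw [map_add, jac_add_left (LY_trunc U), map_add, h, h', add_zero]
  | hom p a ha =>
    induction b using wt_induction with
    | zero => rw [jac_zero_right, map_zero]
    | add b b' h h' => rw [jac_add_right (LY_trunc U), map_add, h, h', add_zero]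
    | hom q b hb =>
      by_cases h0 : g.proj m a = 0
      · rw [h0, jac_zero_left, map_zero]
      obtain ⟨r, hr, j, hj⟩ := exists_rat_of_mem_eig (g.proj_mem m a) h0
      have h1 : g.proj m a ∈ g.eig (r / g.T) := by
        have := mem_eig_add_int (g.proj_mem m a) (-j)
        rwa [hj, Int.cast_neg, add_neg_cancel_right, ← hj] at this
      have := LProj_jac_homogeneous U hr (g.proj_mem_wtSpace ha m) h1 hb n
        (j - (p - 1 + delta r)) k z
      convert this using 3
      rw [hj]
      push_cast
      ring

/-- The span W of all values of `jac` on U is stable under P, by `jac_ad` and because P preserves U.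
It lies in the kernel of the projection to U, so the triangular argument and nondegeneracy give W =
0. -/
theorem jac_LIncl (U : AgMod.{u, v} g) {m : ℚ} {a : V} (ha : a ∈ g.eig m) (b : V) (n : ℤ) (k : ℚ)
    (z : U.carrier) : jac (LY U) a b m n k (LIncl U z) = 0 := by
  let W : Submodule ℂ (LCar U) := Submodule.span ℂ {x | ∃ (m : ℚ) (a b : V) (n : ℤ) (k : ℚ)
    (z : U.carrier), a ∈ g.eig m ∧ x = jac (LY U) a b m n k (LIncl U z)}
  have hmem : ∀ (m : ℚ) (a b : V) (n : ℤ) (k : ℚ) (z : U.carrier), a ∈ g.eig m →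
      jac (LY U) a b m n k (LIncl U z) ∈ W := fun m a b n k z ha =>
    Submodule.subset_span ⟨m, a, b, n, k, z, ha, rfl⟩
  have hW : ∀ d ≤ (0 : ℚ), ∀ y ∈ g.VgDeg d, ∀ w ∈ W, g.iota y • w ∈ W := by
    intro d hd y hy w hw
    refine VgDeg_induction (p := fun y => g.iota y • w ∈ W) hy (by simp) (fun x y hx hy => ?_)
      fun t p c hc hc' hdeg => ?_
    · rw [map_add, add_smul]; exact Submodule.add_mem _ hx hy
    induction hw using Submodule.span_induction with
    | zero => simp
    | add x y _ _ hx hy => rw [smul_add]; exact Submodule.add_mem _ hx hy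
    | smul e x _ hx => rw [smul_algebra_smul_comm]; exact Submodule.smul_mem _ _ hx
    | mem x hx =>
      obtain ⟨m, a, b, n, k, z, ha, rfl⟩ := hx
      obtain ⟨L, h1, h2⟩ := ((eventually_mode_eq_zero c a 0).and
        (eventually_mode_eq_zero c b 0)).exists
      have h := jac_ad (LY_trunc U) (LY_comm U) hc' (by simpa using h1) (by simpa using h2) m n k
        (LIncl U z)
      rw [← LY_apply, h]
      refine Submodule.add_mem _ ?_ (Submodule.sum_mem _ fun j _ => Submodule.smul_mem _ _
        (Submodule.add_mem _ ?_ (hmem _ _ _ _ _ _ ha)))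
      · rw [LY_apply, iota_smul_LIncl U hd (hdeg ▸ elem_mem_VgDeg hc p)]
        exact hmem _ _ _ _ _ _ ha
      · refine hmem _ _ _ _ _ _ ?_
        rw [g.eig_sub_nat, add_comm]
        exact g.mode_mem_eig hc' ha j
  have hker : W ≤ LinearMap.ker (LProj U) := by
    refine Submodule.span_le.mpr ?_
    rintro _ ⟨m, a, b, n, k, z, ha, rfl⟩
    exact LProj_jac U ha b n k z
  refine LCar_eq_zero U fun x => ?_
  exact smul_mem_of_triangular hW hker
    (fun d hd y hy s _ => LProj_iota_smul U hd hy s) x (hmem m a b n k z ha)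

/-- The vectors satisfying all the identities form a subspace that contains U and is stable under
V[g]. All identities are taken at once because commuting with c_p changes a, b, m and k. -/
theorem jac_eq_zero (U : AgMod.{u, v} g) {m : ℚ} {a : V} (ha : a ∈ g.eig m) (b : V) (n : ℤ) (k : ℚ)
    (w : LCar U) : jac (LY U) a b m n k w = 0 := by
  let S : Submodule ℂ (LCar U) :=
    { carrier := {w | ∀ (m : ℚ) (a b : V) (n : ℤ) (k : ℚ), a ∈ g.eig m →
        jac (LY U) a b m n k w = 0}
      zero_mem' := fun m a b n k _ => by simp [jac]
      add_mem' := fun hx hy m a b n k h => by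
        rw [jac_add (LY_trunc U), hx m a b n k h, hy m a b n k h, add_zero]
      smul_mem' := fun c x hx m a b n k h => by
        rw [jac_smul (LY_trunc U), hx m a b n k h, smul_zero] }
  refine LCar_eq_top U (S := S) ?_ (fun z m a b n k ha => jac_LIncl U ha b n k z) w m a b n k ha
  intro d y hy s hs
  refine VgDeg_induction (p := fun y => g.iota y • s ∈ S) hy (by simp) (fun x y hx hy => ?_)
    fun t p c hc hc' hdeg => ?_
  · rw [map_add, add_smul]; exact Submodule.add_mem _ hx hy
  intro m a b n k ha
  obtain ⟨L, h1, h2⟩ := ((eventually_mode_eq_zero c a 0).and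
    (eventually_mode_eq_zero c b 0)).exists
  have h := jac_ad (LY_trunc U) (LY_comm U) hc' (by simpa using h1) (by simpa using h2) m n k s
  rw [hs m a b n k ha, map_zero, Finset.sum_eq_zero, add_zero] at h
  · exact h.symm
  · intro j _
    rw [hs _ a _ n _ ha, hs _ _ b n _, add_zero, smul_zero]
    rw [g.eig_sub_nat, add_comm]
    exact g.mode_mem_eig hc' ha j

/-- 1(-1) is central and acts as the identity on U, which generates L(U). -/
theorem iota_vac_smul (U : AgMod.{u, v} g) (w : LCar U) : g.iota (g.elem (-1) vac) • w = w := by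
  let S : Submodule ℂ (LCar U) := LinearMap.ker (LY U (-1) vac - LinearMap.id)
  have hS : ∀ w, w ∈ S ↔ g.iota (g.elem (-1) vac) • w = w := fun w => by
    rw [LinearMap.mem_ker, LinearMap.sub_apply, LY_apply, LinearMap.id_apply, sub_eq_zero]
  rw [← hS]
  refine LCar_eq_top U (fun n y hy s hs => ?_) (fun z => ?_) w
  · rw [hS] at *
    rw [iota_smul_comm, lie_vac, map_zero, zero_smul, zero_add, hs]
  · rw [hS]
    have := LY_LIncl U (vac_mem_wtSpace (V := V)) z
    rw [U.rho_one, Module.End.one_apply, LY_apply] at this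
    simpa using this

theorem isWeakTwisted_L (U : AgMod.{u, v} g) : g.IsWeakTwisted (LY U) where
  support r _ a ha n hn := LinearMap.ext fun w => by
    rw [LY_apply, elem_eq_zero ha hn, map_zero, zero_smul, LinearMap.zero_apply]
  trunc := LY_trunc U
  vacuum n := LinearMap.ext fun w => by
    rw [LY_apply]
    split_ifs with h
    · rw [h, iota_vac_smul, Module.End.one_apply]
    · rw [elem_vac_eq_zero h, map_zero, zero_smul, LinearMap.zero_apply]
  jacobi := by
    rintro r _ a ha b w m n k ⟨j, rfl⟩
    rw [← sub_eq_zero]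
    exact jac_eq_zero U (mem_eig_add_int ha j) b n k w

theorem isAdmissible_L (U : AgMod.{u, v} g) : g.IsAdmissible (LY U) (LGr U) where
  weak := isWeakTwisted_L U
  internal := DirectSum.isInternal_submodule_of_iSupIndep_of_iSup_eq_top (iSupIndep_LGr U)
    (iSup_LGr U)
  gr_support := fun _ hn => LGr_eq_bot U hn
  map_gr := fun _ _ ha m _ _ hx => LY_mem_LGr U ha m hx

/-! ### Lowest weight vectors of `L(U)` -/

theorem LIncl_mem_Omega (U : AgMod.{u, v} g) (z : U.carrier) : LIncl U z ∈ Omega (LY U) :=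
  fun _ _ ha _ hq => LY_LIncl_eq_zero U ha hq z

/-- L(U)(n) ∩ Ω is stable under P: negative degrees kill it, and degree 0 preserves Ω by `oMap_mem`.
For n ≠ 0 it lies in the kernel of the projection, so it is zero by the triangular argument. -/
theorem eq_zero_of_mem_Omega (U : AgMod.{u, v} g) {n : ℚ} (hn : n ≠ 0) {w : LCar U}
    (hw : w ∈ LGr U n) (hw' : w ∈ Omega (LY U)) : w = 0 := by
  have hn' : 0 < n ∨ n < 0 := by rcases lt_trichotomy n 0 with h | h | h <;> tauto
  rcases hn' with hn' | hn'
  swap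
  · rwa [LGr_eq_bot_of_neg U hn', Submodule.mem_bot] at hw
  refine LCar_eq_zero U fun x => ?_
  refine smul_mem_of_triangular (W := LGr U n ⊓ Omega (LY U)) (S := LinearMap.ker (LProj U)) ?_
    (fun w hw => LProj_eq_zero U hn hw.1) (fun d hd y hy s _ => LProj_iota_smul U hd hy s) x
    ⟨hw, hw'⟩
  rintro d hd y hy w ⟨h1, h2⟩
  refine VgDeg_induction (p := fun y => g.iota y • w ∈ LGr U n ⊓ Omega (LY U)) hy (by simp)
    (fun x y hx hy => ?_) fun t p c hc hc' hdeg => ?_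
  · rw [map_add, add_smul]; exact Submodule.add_mem _ hx hy
  rcases hd.lt_or_eq with hd | rfl
  · have := h2 t c hc p (by linarith)
    rw [LY_apply] at this
    rw [this]
    exact Submodule.zero_mem _
  · obtain rfl : p = (t : ℚ) - 1 := by linarith
    refine ⟨?_, ?_⟩
    · have := LY_mem_LGr U hc ((t : ℚ) - 1) h1
      rwa [show n + t - ((t : ℚ) - 1) - 1 = n by ring] at this
    · have := oMap_mem (isWeakTwisted_L U) c h2
      rwa [oMap_apply _ hc] at this

theorem mem_Omega_iff (U : AgMod.{u, v} g) {w : LCar U} :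
    w ∈ Omega (LY U) ↔ ∃ z, LIncl U z = w := by
  refine ⟨fun hw => ?_, fun ⟨z, hz⟩ => hz ▸ LIncl_mem_Omega U z⟩
  have hw' : w ∈ ⨆ n, LGr U n := by rw [iSup_LGr]; trivial
  obtain ⟨f, hf, rfl⟩ := (Submodule.mem_iSup_iff_exists_finsupp _ _).mp hw'
  -- Ω is graded: a_q shifts all degrees by the same amount, so the images of the components lie in
  -- independent subspaces and vanish separately.
  have hcomp : ∀ n, f n ∈ Omega (LY U) := by
    intro n d a ha q hq
    have h := hw d a ha q hq
    rw [Finsupp.sum, map_sum] at h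
    by_cases hn : n ∈ f.support
    · have hind : iSupIndep fun m => LGr U (m + d - q - 1) :=
        (iSupIndep_LGr U).comp (f := fun m : ℚ => m + d - q - 1) fun x y hxy => by
          simpa using hxy
      exact (iSupIndep_iff_finsetSum_eq_zero_imp_eq_zero _).mp hind f.support
        (fun m => LY U q a (f m)) (fun m _ => LY_mem_LGr U ha q (hf m)) h n hn
    · rw [Finsupp.notMem_support_iff.mp hn, map_zero]
  have h0 : f.sum (fun _ x => x) = f 0 := by
    rw [Finsupp.sum]
    refine Finset.sum_eq_single 0 (fun n _ hn => eq_zero_of_mem_Omega U hn (hf n) (hcomp n)) ?_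
    exact fun h => Finsupp.notMem_support_iff.mp h
  rw [h0]
  have := hf 0
  rw [LGr_zero] at this
  exact this

end

end FiniteOrderAut

namespace FiniteOrderAut

noncomputable section

open VertexOperatorAlgebra

variable {V : Type u} [AddCommGroup V] [Module ℂ V] [VertexOperatorAlgebra V]
variable {g : FiniteOrderAut V}

/-! ### The functor `L` -/

/-- The morphism of admissible modules induced by a morphism of `A_g(V)`-modules. -/
def LHom {U W : AgMod.{u, v} g} (f : U ⟶ W) :
    LObj U (isAdmissible_L U) ⟶ LObj W (isAdmissible_L W) :=
  AdmMod.Hom.mk (M := LObj U (isAdmissible_L U)) (N := LObj W (isAdmissible_L W))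
    ((LMap f).restrictScalars ℂ) (fun _ _ x => (LMap f).map_smul _ x)
    (fun _ _ hx => LMap_mem_LGr f hx)

/-- Maps of V[g]-modules that agree on U agree on L(U). -/
theorem LMap_id (U : AgMod.{u, v} g) (w : LCar U) : LMap (𝟙 U) w = w := by
  let S : Submodule ℂ (LCar U) := LinearMap.ker ((LMap (𝟙 U)).restrictScalars ℂ - LinearMap.id)
  have hS : ∀ w, w ∈ S ↔ LMap (𝟙 U) w = w := fun w => by
    rw [LinearMap.mem_ker, LinearMap.sub_apply, LinearMap.restrictScalars_apply,
      LinearMap.id_apply, sub_eq_zero]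
  rw [← hS]
  refine LCar_eq_top U (fun n y hy s hs => ?_) (fun z => ?_) w
  · rw [hS] at *
    rw [map_smul, hs]
  · rw [hS, LMap_LIncl]
    rfl

theorem LMap_comp {U W X : AgMod.{u, v} g} (f : U ⟶ W) (h : W ⟶ X) (w : LCar U) :
    LMap (f ≫ h) w = LMap h (LMap f w) := by
  let S : Submodule ℂ (LCar U) := LinearMap.ker ((LMap (f ≫ h)).restrictScalars ℂ -
    ((LMap h).restrictScalars ℂ) ∘ₗ (LMap f).restrictScalars ℂ)
  have hS : ∀ w, w ∈ S ↔ LMap (f ≫ h) w = LMap h (LMap f w) := fun w => by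
    rw [LinearMap.mem_ker, LinearMap.sub_apply, LinearMap.comp_apply,
      LinearMap.restrictScalars_apply, LinearMap.restrictScalars_apply,
      LinearMap.restrictScalars_apply, sub_eq_zero]
  rw [← hS]
  refine LCar_eq_top U (fun n y hy s hs => ?_) (fun z => ?_) w
  · rw [hS] at *
    rw [map_smul, hs, map_smul, map_smul]
  · rw [hS, LMap_LIncl, LMap_LIncl, LMap_LIncl]
    rfl

theorem LHom_id (U : AgMod.{u, v} g) : LHom (𝟙 U) = 𝟙 (LObj U (isAdmissible_L U)) :=
  AdmMod.Hom.ext (LinearMap.ext fun w => LMap_id U w)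

theorem LHom_comp {U W X : AgMod.{u, v} g} (f : U ⟶ W) (h : W ⟶ X) :
    LHom (f ≫ h) = LHom f ≫ LHom h :=
  AdmMod.Hom.ext (LinearMap.ext fun w => LMap_comp f h w)

variable (g) in
/-- The functor `L`. -/
def LFunctor : AgMod.{u, max u v} g ⥤ AdmMod.{u, max u v} g where
  obj U := LObj U (isAdmissible_L U)
  map f := LHom f
  map_id := LHom_id
  map_comp f h := LHom_comp f h

/-- The natural map from `U` to `Ω(L(U))`, as a linear equivalence. -/
def OmegaEquiv (U : AgMod.{u, v} g) : U.carrier ≃ₗ[ℂ] Omega (LY U) :=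
  LinearEquiv.ofBijective ((LIncl U).codRestrict (Omega (LY U)) (LIncl_mem_Omega U))
    ⟨fun x y h => by
      have := congrArg (fun t : Omega (LY U) => LProj U (t : LCar U)) h
      simpa only [LinearMap.codRestrict_apply, LProj_LIncl] using this,
    fun ⟨w, hw⟩ => by
      obtain ⟨z, hz⟩ := (mem_Omega_iff U).mp hw
      exact ⟨z, Subtype.ext hz⟩⟩

theorem OmegaEquiv_rho (U : AgMod.{u, v} g) (a : g.Ag) (z : U.carrier) :
    OmegaEquiv U (U.rho a z) = omegaRho (LY U) (isWeakTwisted_L U) a (OmegaEquiv U z) := by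
  induction a using Submodule.Quotient.induction_on with
  | H a =>
    apply Subtype.ext
    change LIncl U (U.rho (g.Og.mkQ a) z) = oMap (LY U) a (LIncl U z)
    induction a using wt_induction with
    | zero => simp
    | add a b ha hb => simp only [map_add, LinearMap.add_apply, ha, hb]
    | hom n a ha => rw [oMap_apply _ ha, LY_LIncl U ha]

/-- The natural map from `U` to `Ω(L(U))` is an isomorphism of `A_g(V)`-modules. -/
def OmegaIso (U : AgMod.{u, max u v} g) : OmegaObj (LObj U (isAdmissible_L U)) ≅ U where
  hom := AgMod.Hom.mk (U := OmegaObj (LObj U (isAdmissible_L U))) (OmegaEquiv U).symm.toLinearMap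
    fun a (x : Omega (LY U)) => by
      apply (OmegaEquiv U).injective
      have h := OmegaEquiv_rho U a ((OmegaEquiv U).symm x)
      rw [LinearEquiv.apply_symm_apply] at h
      exact ((OmegaEquiv U).apply_symm_apply _).trans h.symm
  inv := AgMod.Hom.mk (W := OmegaObj (LObj U (isAdmissible_L U))) (OmegaEquiv U).toLinearMap
    (OmegaEquiv_rho U)
  hom_inv_id := AgMod.Hom.ext (LinearMap.ext fun x => (OmegaEquiv U).apply_symm_apply x)
  inv_hom_id := AgMod.Hom.ext (LinearMap.ext fun x => (OmegaEquiv U).symm_apply_apply x)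

variable (g) in
/-- The natural isomorphism between `Ω ∘ L` and the identity. -/
def OmegaNatIso : LFunctor.{u, v} g ⋙ OmegaFunctor g ≅ 𝟭 (AgMod.{u, max u v} g) :=
  -- Built from the identity to Ω ∘ L, where naturality is `LMap_LIncl`, and then inverted.
  (NatIso.ofComponents (fun U => (OmegaIso.{u, v} U).symm) (fun {U W} f => by
    refine AgMod.Hom.ext (LinearMap.ext fun z => Subtype.ext ?_)
    exact (LMap_LIncl f z).symm)).symm

theorem OmegaNatIso_inv_app (U : AgMod.{u, max u v} g) (z : U.carrier) :
    (Omega (LY U)).subtype (((OmegaNatIso.{u, v} g).inv.app U).toLin z) = LMk U (indIncl U z) := rfl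

end

end FiniteOrderAut

/-! ### The main theorem -/

open FiniteOrderAut in
theorem theorem6p3 {V : Type u} [AddCommGroup V] [Module ℂ V] [VertexOperatorAlgebra V]
    (g : FiniteOrderAut V) :
    (∀ U : AgMod.{u, max u v} g, IsGreatest {J | IsGradedAvoiding U J} (maxJ U)) ∧
    ∃ hadm : ∀ U : AgMod.{u, max u v} g, g.IsAdmissible (LY U) (LGr U),
    ∃ (map : ∀ U W : AgMod.{u, max u v} g, (U ⟶ W) → (LObj U (hadm U) ⟶ LObj W (hadm W)))
      (map_id : ∀ U, map U U (𝟙 U) = 𝟙 (LObj U (hadm U)))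
      (map_comp : ∀ (U W X : AgMod.{u, max u v} g) (f : U ⟶ W) (h : W ⟶ X),
        map U X (f ≫ h) = map U W f ≫ map W X h),
      (∀ (U W : AgMod.{u, max u v} g) (f : U ⟶ W) (z : U.carrier),
        (map U W f).toLin (LMk U (indIncl U z)) = LMk W (indIncl W (f.toLin z))) ∧
      ∃ e : ({ obj := fun U => LObj U (hadm U)
               map := fun {U W} f => map U W f
               map_id := map_id
               map_comp := fun {U W X} f h => map_comp U W X f h } :
              AgMod.{u, max u v} g ⥤ AdmMod.{u, max u v} g) ⋙ OmegaFunctor g ≅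
            𝟭 (AgMod.{u, max u v} g),
        ∀ (U : AgMod.{u, max u v} g) (z : U.carrier),
          (Omega (LY U)).subtype ((e.inv.app U).toLin z) = LMk U (indIncl U z) :=
  ⟨isGreatest_maxJ, isAdmissible_L, fun _ _ f => LHom f, LHom_id, fun _ _ _ f h => LHom_comp f h,
    fun _ _ f z => LMap_LIncl f z, OmegaNatIso.{u, v} g, OmegaNatIso_inv_app⟩
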